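/- Let $K=\mathbb{Q}(q,M_1,M_2)$ and let $W=K\langle L_1,L_2\rangle$ be the localized $q$-Weyl algebra: the Ore algebra of all finite sums $\sum_{a,b\ge 0}R_{a,b}\,L_1^aL_2^b$ with $R_{a,b}\in K$, in which $L_1L_2=L_2L_1$, $L_1R(q,M_1,M_2)=R(q,qM_1,M_2)L_1$ and $L_2R(q,M_1,M_2)=R(q,M_1,qM_2)L_2$. Let $\tau$ be the ring automorphism of $W$ given by $\tau(P(M_1,M_2,L_1,L_2))=P(M_2,M_1,L_2,L_1)$. Consider the operators \[ \begin{aligned} P_1={}&-q^6M_1^3M_2(q^3M_1-1)(qM_2-1)(q^4M_1M_2-1)(q^5M_1M_2^2-1)F_1L_1^2\\ &-q^4M_1M_2(q^2M_1-1)(q^2M_2-1)(M_1-M_2)(q^4M_1M_2-1)F_6L_1L_2\\ &+q^6M_1M_2^3(qM_1-1)(q^3M_2-1)(q^4M_1M_2-1)(q^5M_1^2M_2-1)\tau(F_1)L_2^2\\ &+M_2(q^2M_1-1)(qM_2-1)(q^3M_1M_2-1)(q^5M_1^2M_2-1)F_7L_1\\ &+(-M_1)(qM_1-1)(q^2M_2-1)(q^3M_1M_2-1)(q^5M_1M_2^2-1)\tau(F_7)L_2\\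 &+q^3(qM_1-1)(qM_2-1)(M_1-M_2)(q^2M_1M_2-1)F_2\\ P_2={}&-q^{21}M_1^3M_2^7(q^4M_2-1)(q^5M_1M_2-1)(q^5M_1M_2^2-1)F_1L_2^3\\ &+q^7M_1^2M_2^3(q^2M_1-1)(q^2M_2-1)(q^4M_1M_2-1)(q^6M_1M_2^2-1)F_8L_1L_2\\ &+q^6M_2^3(q^3M_2-1)(q^4M_1M_2-1)F_{16}L_2^2\\ &+q^8M_1^2M_2^2(q^2M_1-1)(qM_2-1)(q^3M_1M_2-1)(q^6M_1M_2^2-1)F_3L_1\\ &+(q^2M_2-1)(q^3M_1M_2-1)(q^5M_1M_2^2-1)F_{14}L_2\\ &-q^2(qM_2-1)(q^2M_1M_2-1)F_9\\ P_3={}&-q^{17}M_1^3M_2^5(q^2M_1-1)(q^3M_2-1)(q^5M_1M_2-1)(q^5M_1M_2^2-1)F_1L_1L_2^2\\ &+q^5M_1M_2^2(q^2M_1-1)(q^2M_2-1)(q^4M_1M_2-1)(q^6M_1M_2^2-1)F_{12}L_1L_2\\ &+q^6M_2^3(qM_1-1)(q^3M_2-1)(q^4M_1M_2-1)F_{13}L_2^2\\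 &+q^7M_1M_2^2(q^2M_1-1)(qM_2-1)(q^3M_1M_2-1)F_{11}L_1\\ &-(qM_1-1)(q^2M_2-1)(q^3M_1M_2-1)(q^5M_1M_2^2-1)F_{15}L_2\\ &+q^2(qM_1-1)(qM_2-1)(q^2M_1M_2-1)(q^6M_1M_2^2-1)F_4\\ Q_1={}&q^{47}M_1^5M_2^{10}(q^6M_2-1)(q^7M_1M_2-1)(q^6M_1M_2^2-1)(q^7M_1M_2^2-1)F_5L_2^5\\ &-q^{24}M_1^2M_2^6(q^5M_2-1)(q^6M_1M_2-1)(q^6M_1M_2^2-1)F_{20}L_2^4\\ &+q^9M_2^3(q^4M_2-1)(q^5M_1M_2-1)(q^9M_1M_2^2-1)F_{23}L_2^3\\ &+(q^3M_2-1)(q^4M_1M_2-1)(q^7M_1M_2^2-1)F_{24}L_2^2\\ &+q^2(q^2M_2-1)(q^3M_1M_2-1)(q^{10}M_1M_2^2-1)F_{18}L_2\\ &-q^6(qM_2-1)(q^2M_1M_2-1)(q^9M_1M_2^2-1)(q^{10}M_1M_2^2-1)F_{10}\\ Q_2={}&q^8M_1^3M_2^2(q-1)(q^2M_1-1)(q^2M_1^2+qM_1+1)(qM_2-1)(q^3M_1M_2-1)\\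 &\qquad\times(q^6M_1M_2^2-1)(q^7M_1M_2^2-1)(q^8M_1M_2^2-1)F_5L_1\\ &-q^{37}M_1^5M_2^{10}(q^5M_2-1)(q^6M_1M_2-1)(q^6M_1M_2^2-1)F_8L_2^4\\ &+q^{18}M_1^2M_2^6(q^4M_2-1)(q^5M_1M_2-1)F_{19}L_2^3\\ &-q^6M_2^3(q^3M_2-1)(q^4M_1M_2-1)(q^7M_1M_2^2-1)F_{21}L_2^2\\ &-(q^2M_2-1)(q^3M_1M_2-1)F_{22}L_2\\ &+q^2(qM_2-1)(q^2M_1M_2-1)(q^8M_1M_2^2-1)F_{17} \end{aligned} \] Here $F_1,\dots,F_{24}\in\mathbb{Z}[q,M_1,M_2]$ are explicit polynomials, listed term by term in the definitions below (the entry $\langle c,i,j,k\rangle$ stands for $c\,q^iM_1^jM_2^k$); for instance $$F_{1}=q^{18}M_1^{6}M_2^{6}-q^{15}M_1^{6}M_2^{4}-q^{15}M_1^{4}M_2^{6}+q^{14}M_1^{5}M_2^{4}-q^{14}M_1^{4}M_2^{5}+q^{13}M_1^{5}M_2^{4}-q^{12}M_1^{5}M_2^{4}-q^{11}M_1^{3}M_2^{4}+q^{11}M_1^{2}M_2^{5}-q^{10}M_1^{5}M_2^{2}+q^{10}M_1^{4}M_2^{3}+q^{9}M_1^{4}M_2^{2}-q^{9}M_1^{3}M_2^{3}+q^{8}M_1^{4}M_2^{2}+2q^{8}M_1^{3}M_2^{3}+q^{8}M_1^{2}M_2^{4}-q^{7}M_1^{4}M_2^{2}-q^{7}M_1^{3}M_2^{3}-q^{6}M_1^{2}M_2^{2}-q^{4}M_1^{2}M_2-q^{4}M_2^{3}+q^{3}M_1^{3}+q^{3}M_1M_2^{2}+qM_2-M_1,$$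 $$F_{2}=q^{19}M_1^{6}M_2^{6}-q^{16}M_1^{6}M_2^{4}-q^{16}M_1^{4}M_2^{6}-q^{13}M_1^{5}M_2^{4}-q^{13}M_1^{4}M_2^{5}+q^{11}M_1^{4}M_2^{3}+q^{11}M_1^{3}M_2^{4}+q^{10}M_1^{5}M_2^{2}+q^{10}M_1^{2}M_2^{5}+q^{9}M_1^{4}M_2^{2}+q^{9}M_1^{3}M_2^{3}+q^{9}M_1^{2}M_2^{4}-2q^{8}M_1^{3}M_2^{3}+q^{7}M_1^{3}M_2^{3}-q^{5}M_1^{2}M_2^{2}-q^{4}M_1^{2}M_2-q^{4}M_1M_2^{2}-q^{3}M_1^{3}-q^{3}M_1^{2}M_2-q^{3}M_1M_2^{2}-q^{3}M_2^{3}+q^{2}M_1^{2}M_2+q^{2}M_1M_2^{2}+M_1+M_2,$$ $$F_{6}=q^{22}M_1^{7}M_2^{7}-q^{20}M_1^{7}M_2^{7}-q^{18}M_1^{7}M_2^{6}-q^{18}M_1^{6}M_2^{7}+q^{15}M_1^{7}M_2^{4}+q^{15}M_1^{6}M_2^{5}+q^{15}M_1^{5}M_2^{6}-2q^{15}M_1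^{5}M_2^{5}+q^{15}M_1^{4}M_2^{7}+q^{14}M_1^{6}M_2^{4}+q^{14}M_1^{4}M_2^{6}+q^{13}M_1^{5}M_2^{5}+q^{12}M_1^{5}M_2^{5}-q^{12}M_1^{4}M_2^{4}-q^{11}M_1^{6}M_2^{2}-q^{11}M_1^{2}M_2^{6}-q^{10}M_1^{4}M_2^{4}+q^{9}M_1^{4}M_2^{3}+q^{9}M_1^{3}M_2^{4}-q^{8}M_1^{5}M_2^{2}-3q^{8}M_1^{4}M_2^{3}-3q^{8}M_1^{3}M_2^{4}-q^{8}M_1^{2}M_2^{5}+q^{7}M_1^{4}M_2^{3}+q^{7}M_1^{3}M_2^{4}+q^{6}M_1^{3}M_2^{2}+q^{6}M_1^{2}M_2^{3}+q^{4}M_1^{4}+q^{4}M_1^{3}M_2+2q^{4}M_1^{2}M_2^{2}+q^{4}M_1M_2^{3}+q^{4}M_2^{4}-q^{3}M_1^{3}M_2-q^{3}M_1M_2^{3}-qM_1^{2}-qM_1M_2-qM_2^{2}+M_1M_2,$$ $$F_{7}=q^{24}M_1^{8}M_2^{7}-q^{21}M_1^{8}M_2^{5}-q^{21}M_1^{6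}M_2^{7}+q^{19}M_1^{6}M_2^{6}-q^{18}M_1^{7}M_2^{5}-q^{18}M_1^{6}M_2^{6}+q^{16}M_1^{5}M_2^{5}-q^{16}M_1^{4}M_2^{6}+q^{15}M_1^{7}M_2^{3}+q^{15}M_1^{4}M_2^{6}+q^{14}M_1^{6}M_2^{3}+q^{14}M_1^{5}M_2^{4}+2q^{14}M_1^{4}M_2^{5}-3q^{13}M_1^{5}M_2^{4}+q^{12}M_1^{5}M_2^{4}-q^{12}M_1^{4}M_2^{3}+q^{11}M_1^{3}M_2^{4}-q^{11}M_1^{2}M_2^{5}+q^{10}M_1^{5}M_2^{2}-q^{10}M_1^{4}M_2^{3}-2q^{10}M_1^{4}M_2^{2}+q^{9}M_1^{3}M_2^{3}+q^{9}M_1^{2}M_2^{4}-q^{8}M_1^{5}M_2+q^{8}M_1^{4}M_2^{2}-3q^{8}M_1^{3}M_2^{3}-q^{8}M_1^{2}M_2^{4}+q^{7}M_1^{4}M_2^{2}+q^{7}M_1^{4}+q^{7}M_1^{3}M_2^{3}-q^{5}M_1^{4}+q^{5}M_1^{3}M_2+q^{4}M_1^{2}M_2+q^{4}M_2^{3}-q^{3}M_1^{3}-q^{3}M_1M_2^{2}-qM_2+M_1.$$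 Let $J=\langle P_1,P_2,P_3\rangle$ be the left ideal of $W$ generated by $P_1,P_2,P_3$. A subset $G\subseteq J$ is a Gröbner basis of $J$ for a monomial order if the leading monomial $L_1^aL_2^b$ of every nonzero element of $J$ is divisible by the leading monomial of some nonzero element of $G$; a monomial is below the staircase of $J$ if it is not divisible by the leading monomial of any nonzero element of $J$. For $w\in\mathbb{R}^2$ let $\mathrm{in}_w(J)$ be the left ideal of $W$ generated by the initial forms $\mathrm{in}_w(P)$, $P\in J$, where $\mathrm{in}_w(P)$ is the sum of the terms $R\,L_1^aL_2^b$ of $P$ for which $w_1a+w_2b$ is maximal. The Gröbner fan $\mathrm{GF}(J)$ consists of the closures of the classes of vectors $w\in\mathbb{R}_{>0}^2$ with the same $\mathrm{in}_w(J)$, together with the nonempty faces of these closures. Then: (a) $\{P_1,P_2,P_3\}$ is a Gröbner basis of $J$ with respect to the total degree lexicographic order with $L_1>L_2$, and $J$ is zero-dimensional of rank $5$, that is, $\dim_K W/J=5$. (b) $J=\langle Q_1,Q_2\rangle$, and $\{Q_1,Q_2\}$ is a Gröbner basis of $J$ with respect to the lexicographic order with $L_1>L_2$. The monomials below the staircase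 of $J$ are $1,L_2,L_1,L_2^2,L_1L_2$ for the total degree lexicographic order and $1,L_2,L_2^2,L_2^3,L_2^4$ for the lexicographic order. (c) $\mathrm{GF}(J)$ is a fan with support $\mathbb{R}_{\ge 0}^2$, and its rays (one-dimensional cones) that contain a vector with two positive coordinates, i.e. those other than the two coordinate half-axes bounding the quadrant, are exactly the rays generated by $(4,1),(2,1),(1,1),(1,2),(1,4)$, in $(L_1,L_2)$-coordinates. (d) $\tau(J)=J$, and $\tau(P_1)=-P_1$. -/

import Mathlib

open MvPolynomial

noncomputable section

namespace QWeyl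

/-! ### The coefficient field `ℚ(q, M₁, M₂)` -/

/-- The field `ℚ(q, M₁, M₂)`; the polynomial variables `0, 1, 2` are `q, M₁, M₂`. -/
abbrev K : Type := FractionRing (MvPolynomial (Fin 3) ℚ)

/-- The element `q` of `ℚ(q, M₁, M₂)`. -/
def q : K := algebraMap (MvPolynomial (Fin 3) ℚ) K (X 0)

/-- The element `M₁` of `ℚ(q, M₁, M₂)`. -/
def M₁ : K := algebraMap (MvPolynomial (Fin 3) ℚ) K (X 1)

/-- The element `M₂` of `ℚ(q, M₁, M₂)`. -/
def M₂ : K := algebraMap (MvPolynomial (Fin 3) ℚ) K (X 2)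

/-- Exponents `(a, b)` of the monomials `L₁ ^ a * L₂ ^ b`. -/
abbrev Expo : Type := Fin 2 →₀ ℕ

/-- The substitution `q ↦ q`, `M₁ ↦ q ^ a * M₁`, `M₂ ↦ q ^ b * M₂` on `ℚ[q, M₁, M₂]`,
where `e = (a, b)`. -/
def shiftPoly (e : Expo) : MvPolynomial (Fin 3) ℚ →ₐ[ℚ] MvPolynomial (Fin 3) ℚ :=
  aeval ![X 0, X 0 ^ e 0 * X 1, X 0 ^ e 1 * X 2]

theorem q_ne_zero : q ≠ 0 := by
  unfold q
  rw [Ne, IsFractionRing.to_map_eq_zero_iff]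
  exact X_ne_zero 0

theorem shiftPoly_injective (e : Expo) : Function.Injective (shiftPoly e) := by
  have hq := q_ne_zero
  let ψ : MvPolynomial (Fin 3) ℚ →ₐ[ℚ] K :=
    aeval ![q, (q ^ e 0)⁻¹ * M₁, (q ^ e 1)⁻¹ * M₂]
  have h : ψ.comp (shiftPoly e) = IsScalarTower.toAlgHom ℚ (MvPolynomial (Fin 3) ℚ) K := by
    apply MvPolynomial.algHom_ext
    intro i
    fin_cases i
    · simp [ψ, shiftPoly, q]
    · simp [ψ, shiftPoly, M₁, hq]
    · simp [ψ, shiftPoly, M₂, hq]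
  intro x y hxy
  have h2 : ψ.comp (shiftPoly e) x = ψ.comp (shiftPoly e) y := by
    simp [hxy]
  rw [h] at h2
  exact IsFractionRing.injective (MvPolynomial (Fin 3) ℚ) K h2

/-- The substitution `R(q, M₁, M₂) ↦ R(q, q ^ a * M₁, q ^ b * M₂)` on `ℚ(q, M₁, M₂)`,
where `e = (a, b)`. -/
def shift (e : Expo) : K →+* K :=
  IsFractionRing.map (j := (shiftPoly e).toRingHom) (shiftPoly_injective e)

theorem shift_algebraMap (e : Expo) (x : MvPolynomial (Fin 3) ℚ) :
    shift e (algebraMap _ K x) = algebraMap _ K (shiftPoly e x) :=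
  IsLocalization.map_eq (nonZeroDivisors_le_comap_nonZeroDivisors_of_injective _
    (shiftPoly_injective e)) x

theorem shift_q (e : Expo) : shift e q = q := by
  simp [q, shift_algebraMap, shiftPoly]

theorem shift_M₁ (e : Expo) : shift e M₁ = q ^ e 0 * M₁ := by
  simp [q, M₁, shift_algebraMap, shiftPoly]

theorem shift_M₂ (e : Expo) : shift e M₂ = q ^ e 1 * M₂ := by
  simp [q, M₂, shift_algebraMap, shiftPoly]

/-- Ring homomorphisms out of `ℚ(q, M₁, M₂)` are determined on `q, M₁, M₂`. -/
theorem hom_ext {f g : K →+* K} (h0 : f q = g q) (h1 : f M₁ = g M₁) (h2 : f M₂ = g M₂) :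
    f = g := by
  apply IsLocalization.ringHom_ext (nonZeroDivisors (MvPolynomial (Fin 3) ℚ))
  apply MvPolynomial.ringHom_ext
  · intro r
    exact DFunLike.congr_fun (Subsingleton.elim
      ((f.comp (algebraMap (MvPolynomial (Fin 3) ℚ) K)).comp C)
      ((g.comp (algebraMap (MvPolynomial (Fin 3) ℚ) K)).comp C)) r
  · intro i
    fin_cases i
    · exact h0
    · exact h1
    · exact h2

theorem shift_zero : shift 0 = RingHom.id K := by
  apply hom_ext <;> simp [shift_q, shift_M₁, shift_M₂]

theorem shift_add (d e : Expo) : shift (d + e) = (shift d).comp (shift e) := by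
  apply hom_ext
  · simp [shift_q]
  · simp [shift_q, shift_M₁, pow_add]; ring
  · simp [shift_q, shift_M₂, pow_add]; ring

/-- The monomial `L₁ ^ a * L₂ ^ b` acts on `ℚ(q, M₁, M₂)` by
`R(q, M₁, M₂) ↦ R(q, q ^ a * M₁, q ^ b * M₂)`. -/
instance shiftAction : MulSemiringAction (Multiplicative Expo) K where
  smul e x := shift e.toAdd x
  one_smul x := by
    change shift 0 x = x
    rw [shift_zero]; rfl
  mul_smul d e x := by
    change shift (d.toAdd + e.toAdd) x = shift d.toAdd (shift e.toAdd x)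
    rw [shift_add]; rfl
  smul_zero e := map_zero (shift e.toAdd)
  smul_add e := map_add (shift e.toAdd)
  smul_one e := map_one (shift e.toAdd)
  smul_mul e := map_mul (shift e.toAdd)

theorem smul_eq_shift (e : Multiplicative Expo) (x : K) : e • x = shift e.toAdd x := rfl

/-! ### The localized `q`-Weyl algebra -/

/-- The localized `q`-Weyl algebra `ℚ(q, M₁, M₂)⟨L₁, L₂⟩`: the finite sums
`∑ R_{a,b}(q, M₁, M₂) * L₁ ^ a * L₂ ^ b`, with the multiplication determined by `L₁ L₂ = L₂ L₁`,
`L₁ R(q, M₁, M₂) = R(q, q M₁, M₂) L₁` and `L₂ R(q, M₁, M₂) = R(q, M₁, q M₂) L₂`. -/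
abbrev W : Type := SkewMonoidAlgebra K (Multiplicative Expo)

/-- The exponent `(a, b)`. -/
def expo (a b : ℕ) : Expo := Finsupp.single 0 a + Finsupp.single 1 b

/-- The operator `L₁`. -/
def L₁ : W := SkewMonoidAlgebra.single (.ofAdd (expo 1 0)) 1

/-- The operator `L₂`. -/
def L₂ : W := SkewMonoidAlgebra.single (.ofAdd (expo 0 1)) 1

/-- The inclusion of the coefficient field. -/
def coef : K →+* W := SkewMonoidAlgebra.singleOneRingHom

theorem coef_apply (R : K) : coef R = SkewMonoidAlgebra.single 1 R := rfl

theorem coef_mul (R : K) (P : W) : coef R * P = R • P := by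
  induction P using SkewMonoidAlgebra.induction_on' with
  | single g a => simp [coef_apply, SkewMonoidAlgebra.single_mul_single, SkewMonoidAlgebra.smul_single]
  | add f g hf hg => rw [mul_add, smul_add, hf, hg]

theorem L₁_mul_L₂ : L₁ * L₂ = L₂ * L₁ := by
  simp [L₁, L₂, SkewMonoidAlgebra.single_mul_single, mul_comm]

theorem L₁_mul_coef (R : K) : L₁ * coef R = coef (shift (expo 1 0) R) * L₁ := by
  simp [L₁, coef_apply, SkewMonoidAlgebra.single_mul_single, smul_eq_shift]

theorem L₂_mul_coef (R : K) : L₂ * coef R = coef (shift (expo 0 1) R) * L₂ := by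
  simp [L₂, coef_apply, SkewMonoidAlgebra.single_mul_single, smul_eq_shift]

/-! ### The symmetry `τ` -/

/-- The automorphism `R(q, M₁, M₂) ↦ R(q, M₂, M₁)` of `ℚ(q, M₁, M₂)`. -/
def tauK : K ≃+* K :=
  IsFractionRing.ringEquivOfRingEquiv
    (renameEquiv ℚ (Equiv.swap (1 : Fin 3) 2)).toRingEquiv

theorem tauK_algebraMap (x : MvPolynomial (Fin 3) ℚ) :
    tauK (algebraMap _ K x) = algebraMap _ K (rename (Equiv.swap (1 : Fin 3) 2) x) :=
  IsFractionRing.ringEquivOfRingEquiv_algebraMap _ x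

theorem tauK_q : tauK q = q := by
  simp [q, tauK_algebraMap, Equiv.swap_apply_of_ne_of_ne]

theorem tauK_M₁ : tauK M₁ = M₂ := by
  simp [M₁, M₂, tauK_algebraMap]

theorem tauK_M₂ : tauK M₂ = M₁ := by
  simp [M₁, M₂, tauK_algebraMap]

/-- The swap `(a, b) ↦ (b, a)` of exponents. -/
def swapExpo : Expo ≃+ Expo := Finsupp.domCongr (Equiv.swap (0 : Fin 2) 1)

theorem swapExpo_zero (e : Expo) : swapExpo e 0 = e 1 := by
  simp [swapExpo, Finsupp.domCongr_apply, Finsupp.equivMapDomain_apply]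

theorem swapExpo_one (e : Expo) : swapExpo e 1 = e 0 := by
  simp [swapExpo, Finsupp.domCongr_apply, Finsupp.equivMapDomain_apply]

theorem tauK_shift (e : Expo) (R : K) : tauK (shift e R) = shift (swapExpo e) (tauK R) := by
  have h : (tauK : K →+* K).comp (shift e) = (shift (swapExpo e)).comp (tauK : K →+* K) := by
    apply hom_ext <;>
      simp [shift_q, shift_M₁, shift_M₂, tauK_q, tauK_M₁, tauK_M₂, swapExpo_zero, swapExpo_one]
  exact DFunLike.congr_fun h R

/-- The symmetry `τ(P(M₁, M₂, L₁, L₂)) = P(M₂, M₁, L₂, L₁)` of the `q`-Weyl algebra. -/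
def tau : W →+* W :=
  SkewMonoidAlgebra.liftNCRingHom (coef.comp (tauK : K →+* K))
    ((SkewMonoidAlgebra.of K (Multiplicative Expo)).comp swapExpo.toAddMonoidHom.toMultiplicative)
    (by
      intro x y
      simp [coef_apply, SkewMonoidAlgebra.single_mul_single, smul_eq_shift, tauK_shift])

theorem tau_single (e : Expo) (R : K) :
    tau (SkewMonoidAlgebra.single (.ofAdd e) R) =
      SkewMonoidAlgebra.single (.ofAdd (swapExpo e)) (tauK R) := by
  simp [tau, SkewMonoidAlgebra.liftNCRingHom, coef_apply, SkewMonoidAlgebra.single_mul_single]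

/-! ### Gröbner bases -/

/-- The exponent of the leading monomial of `P` with respect to the monomial order `m`
(it is `0` for `P = 0`). In Mathlib's orders on `Fin 2` the variable `0`, here `L₁`, is larger
than the variable `1`, here `L₂`. -/
def leadExp (m : MonomialOrder (Fin 2)) (P : W) : Expo :=
  m.toSyn.symm (P.support.sup fun e => m.toSyn e.toAdd)

/-- `G` is a Gröbner basis of the left ideal `J`: it is contained in `J`, and the leading monomial
of every nonzero element of `J` is divisible by the leading monomial of a nonzero element
of `G`. -/
def IsGroebnerBasis (m : MonomialOrder (Fin 2)) (G : Set W) (J : Ideal W) : Prop :=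
  G ⊆ J ∧ ∀ P ∈ J, P ≠ 0 → ∃ g ∈ G, g ≠ 0 ∧ leadExp m g ≤ leadExp m P

/-- The exponents of the monomials below the staircase of `J`: those that are not divisible by
the leading monomial of any nonzero element of `J`. -/
def belowStaircase (m : MonomialOrder (Fin 2)) (J : Ideal W) : Set Expo :=
  {e | ∀ P ∈ J, P ≠ 0 → ¬ leadExp m P ≤ e}

/-! ### The Gröbner fan -/

/-- The degree `w₁ a + w₂ b` of the exponent `(a, b)` for the weight vector `w`. -/
def weightDeg (w : Fin 2 → ℝ) (e : Expo) : ℝ := ∑ i, w i * e i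

/-- The initial form of `P` with respect to `w`: the sum of its terms of maximal `w`-degree. -/
def initialForm (w : Fin 2 → ℝ) (P : W) : W :=
  open scoped Classical in
  .ofCoeff (P.coeff.filter fun e => ∀ d ∈ P.support, weightDeg w d.toAdd ≤ weightDeg w e.toAdd)

/-- The initial ideal of `J` with respect to `w`, the left ideal generated by the initial forms of
the elements of `J`. The relations of the `q`-Weyl algebra are homogeneous for every weight on
`L₁, L₂`, so that its associated graded ring is the `q`-Weyl algebra itself. -/
def initialIdeal (w : Fin 2 → ℝ) (J : Ideal W) : Ideal W :=
  Ideal.span (initialForm w '' (J : Set W))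

/-- The closed Gröbner cone of a positive weight vector `w`: the closure of the set of the positive
weight vectors that have the same initial ideal as `w`. -/
def groebnerCone (J : Ideal W) (w : Fin 2 → ℝ) : Set (Fin 2 → ℝ) :=
  closure {v | (∀ i, 0 < v i) ∧ initialIdeal v J = initialIdeal w J}

/-- The Gröbner fan of `J`: the closed Gröbner cones of all positive weight vectors together with
their nonempty faces. -/
def groebnerFan (J : Ideal W) : Set (Set (Fin 2 → ℝ)) :=
  {C | C.Nonempty ∧ ∃ w : Fin 2 → ℝ, (∀ i, 0 < w i) ∧ IsExposed ℝ (groebnerCone J w) C}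

/-- The closed half-line generated by `v`. -/
def ray (v : Fin 2 → ℝ) : Set (Fin 2 → ℝ) := {x | ∃ t : ℝ, 0 ≤ t ∧ x = t • v}

/-- A fan in the plane: a finite set of finitely generated pointed convex cones containing no line,
closed under taking nonempty faces, such that any two of them meet in a common face. -/
structure IsFan (Φ : Set (Set (Fin 2 → ℝ))) : Prop where
  finite : Φ.Finite
  polyhedral : ∀ C ∈ Φ, ∃ s : Finset (Fin 2 → ℝ), C = PointedCone.hull ℝ (s : Set (Fin 2 → ℝ))
  salient : ∀ C ∈ Φ, ∀ x ∈ C, -x ∈ C → x = 0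
  face_mem : ∀ C ∈ Φ, ∀ D : Set (Fin 2 → ℝ), D.Nonempty → IsExposed ℝ C D → D ∈ Φ
  inter : ∀ C ∈ Φ, ∀ D ∈ Φ, (C ∩ D).Nonempty ∧ IsExposed ℝ C (C ∩ D) ∧ IsExposed ℝ D (C ∩ D)

/-- The rays of a fan, that is, its one-dimensional cones. -/
def fanRays (Φ : Set (Set (Fin 2 → ℝ))) : Set (Set (Fin 2 → ℝ)) :=
  {C ∈ Φ | Module.finrank ℝ (Submodule.span ℝ C) = 1}

/-! ### The polynomials `F₁, …, F₂₄` -/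

/-- A term `c * q ^ i * M₁ ^ j * M₂ ^ k`, written `⟨c, i, j, k⟩`. -/
structure Mono where
  c : ℤ
  i : ℕ
  j : ℕ
  k : ℕ

/-- The element `c * q ^ i * M₁ ^ j * M₂ ^ k` of `ℚ(q, M₁, M₂)`. -/
def Mono.val (t : Mono) : K := t.c * q ^ t.i * M₁ ^ t.j * M₂ ^ t.k

/-- The sum of a list of terms. -/
def ofTerms (l : List Mono) : K := (l.map Mono.val).sum

def F₁ : K := ofTerms
  [⟨1, 18, 6, 6⟩, ⟨-1, 15, 6, 4⟩, ⟨-1, 15, 4, 6⟩, ⟨1, 14, 5, 4⟩, ⟨-1, 14, 4, 5⟩, ⟨1, 13, 5, 4⟩,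
   ⟨-1, 12, 5, 4⟩, ⟨-1, 11, 3, 4⟩, ⟨1, 11, 2, 5⟩, ⟨-1, 10, 5, 2⟩, ⟨1, 10, 4, 3⟩, ⟨1, 9, 4, 2⟩,
   ⟨-1, 9, 3, 3⟩, ⟨1, 8, 4, 2⟩, ⟨2, 8, 3, 3⟩, ⟨1, 8, 2, 4⟩, ⟨-1, 7, 4, 2⟩, ⟨-1, 7, 3, 3⟩,
   ⟨-1, 6, 2, 2⟩, ⟨-1, 4, 2, 1⟩, ⟨-1, 4, 0, 3⟩, ⟨1, 3, 3, 0⟩, ⟨1, 3, 1, 2⟩, ⟨1, 1, 0, 1⟩,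
   ⟨-1, 0, 1, 0⟩]

def F₂ : K := ofTerms
  [⟨1, 19, 6, 6⟩, ⟨-1, 16, 6, 4⟩, ⟨-1, 16, 4, 6⟩, ⟨-1, 13, 5, 4⟩, ⟨-1, 13, 4, 5⟩, ⟨1, 11, 4, 3⟩,
   ⟨1, 11, 3, 4⟩, ⟨1, 10, 5, 2⟩, ⟨1, 10, 2, 5⟩, ⟨1, 9, 4, 2⟩, ⟨1, 9, 3, 3⟩, ⟨1, 9, 2, 4⟩,
   ⟨-2, 8, 3, 3⟩, ⟨1, 7, 3, 3⟩, ⟨-1, 5, 2, 2⟩, ⟨-1, 4, 2, 1⟩, ⟨-1, 4, 1, 2⟩, ⟨-1, 3, 3, 0⟩,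
   ⟨-1, 3, 2, 1⟩, ⟨-1, 3, 1, 2⟩, ⟨-1, 3, 0, 3⟩, ⟨1, 2, 2, 1⟩, ⟨1, 2, 1, 2⟩, ⟨1, 0, 1, 0⟩,
   ⟨1, 0, 0, 1⟩]

def F₃ : K := ofTerms
  [⟨1, 20, 6, 6⟩, ⟨-1, 18, 6, 6⟩, ⟨-1, 16, 4, 5⟩, ⟨-1, 15, 6, 5⟩, ⟨-1, 14, 5, 5⟩, ⟨1, 14, 5, 4⟩,
   ⟨1, 14, 3, 5⟩, ⟨1, 13, 4, 5⟩, ⟨-1, 13, 4, 4⟩, ⟨1, 13, 2, 5⟩, ⟨-1, 12, 5, 4⟩, ⟨-1, 12, 3, 4⟩,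
   ⟨1, 11, 2, 4⟩, ⟨1, 10, 6, 3⟩, ⟨1, 10, 4, 4⟩, ⟨-2, 10, 3, 3⟩, ⟨1, 9, 5, 3⟩, ⟨1, 9, 3, 4⟩,
   ⟨-1, 9, 2, 4⟩, ⟨1, 8, 4, 3⟩, ⟨1, 8, 4, 2⟩, ⟨1, 8, 2, 3⟩, ⟨2, 7, 3, 3⟩, ⟨-1, 7, 3, 2⟩,
   ⟨1, 7, 1, 3⟩, ⟨-1, 6, 4, 2⟩, ⟨-2, 6, 2, 3⟩, ⟨-1, 6, 2, 2⟩, ⟨-2, 5, 1, 3⟩, ⟨1, 5, 1, 2⟩,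
   ⟨1, 4, 3, 2⟩, ⟨-1, 4, 2, 1⟩, ⟨-1, 4, 0, 3⟩, ⟨-1, 3, 4, 1⟩, ⟨1, 3, 2, 2⟩, ⟨-1, 3, 1, 2⟩,
   ⟨-1, 2, 3, 1⟩, ⟨1, 2, 3, 0⟩, ⟨1, 2, 1, 1⟩, ⟨1, 1, 2, 1⟩, ⟨1, 1, 0, 1⟩, ⟨-1, 0, 3, 0⟩]

def F₄ : K := ofTerms
  [⟨1, 21, 6, 5⟩, ⟨-1, 21, 5, 6⟩, ⟨-1, 18, 4, 5⟩, ⟨1, 18, 3, 6⟩, ⟨-1, 16, 6, 3⟩, ⟨1, 16, 5, 4⟩,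
   ⟨-1, 16, 4, 4⟩, ⟨1, 13, 2, 4⟩, ⟨-1, 12, 3, 3⟩, ⟨1, 12, 2, 4⟩, ⟨2, 11, 3, 3⟩, ⟨-1, 11, 2, 4⟩,
   ⟨-1, 11, 1, 4⟩, ⟨1, 10, 4, 2⟩, ⟨-1, 10, 3, 3⟩, ⟨-1, 10, 3, 2⟩, ⟨1, 10, 2, 3⟩, ⟨1, 9, 4, 1⟩,
   ⟨1, 7, 1, 2⟩, ⟨-1, 6, 2, 1⟩, ⟨1, 6, 1, 2⟩, ⟨-1, 5, 1, 2⟩, ⟨-1, 5, 0, 2⟩, ⟨-1, 3, 2, 0⟩,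
   ⟨1, 0, 0, 0⟩]

def F₅ : K := ofTerms
  [⟨1, 22, 3, 6⟩, ⟨1, 21, 3, 6⟩, ⟨1, 19, 3, 5⟩, ⟨1, 18, 3, 5⟩, ⟨1, 18, 2, 5⟩, ⟨1, 17, 3, 5⟩,
   ⟨1, 17, 2, 5⟩, ⟨1, 16, 2, 5⟩, ⟨1, 16, 2, 4⟩, ⟨2, 15, 2, 4⟩, ⟨2, 14, 2, 4⟩, ⟨1, 13, 2, 4⟩,
   ⟨1, 12, 2, 3⟩, ⟨2, 11, 2, 3⟩, ⟨1, 11, 1, 3⟩, ⟨-1, 10, 3, 3⟩, ⟨1, 10, 2, 3⟩, ⟨2, 10, 1, 3⟩,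
   ⟨-1, 9, 2, 3⟩, ⟨1, 9, 1, 3⟩, ⟨1, 9, 1, 2⟩, ⟨-1, 8, 1, 3⟩, ⟨2, 8, 1, 2⟩, ⟨2, 7, 1, 2⟩,
   ⟨-1, 7, 0, 3⟩, ⟨1, 6, 1, 2⟩, ⟨1, 5, 1, 1⟩, ⟨1, 4, 1, 1⟩, ⟨1, 4, 0, 1⟩, ⟨1, 3, 1, 1⟩,
   ⟨1, 3, 0, 1⟩, ⟨1, 2, 0, 1⟩, ⟨1, 1, 0, 0⟩, ⟨1, 0, 0, 0⟩]

def F₆ : K := ofTerms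
  [⟨1, 22, 7, 7⟩, ⟨-1, 20, 7, 7⟩, ⟨-1, 18, 7, 6⟩, ⟨-1, 18, 6, 7⟩, ⟨1, 15, 7, 4⟩, ⟨1, 15, 6, 5⟩,
   ⟨1, 15, 5, 6⟩, ⟨-2, 15, 5, 5⟩, ⟨1, 15, 4, 7⟩, ⟨1, 14, 6, 4⟩, ⟨1, 14, 4, 6⟩, ⟨1, 13, 5, 5⟩,
   ⟨1, 12, 5, 5⟩, ⟨-1, 12, 4, 4⟩, ⟨-1, 11, 6, 2⟩, ⟨-1, 11, 2, 6⟩, ⟨-1, 10, 4, 4⟩, ⟨1, 9, 4, 3⟩,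
   ⟨1, 9, 3, 4⟩, ⟨-1, 8, 5, 2⟩, ⟨-3, 8, 4, 3⟩, ⟨-3, 8, 3, 4⟩, ⟨-1, 8, 2, 5⟩, ⟨1, 7, 4, 3⟩,
   ⟨1, 7, 3, 4⟩, ⟨1, 6, 3, 2⟩, ⟨1, 6, 2, 3⟩, ⟨1, 4, 4, 0⟩, ⟨1, 4, 3, 1⟩, ⟨2, 4, 2, 2⟩, ⟨1, 4, 1, 3⟩,
   ⟨1, 4, 0, 4⟩, ⟨-1, 3, 3, 1⟩, ⟨-1, 3, 1, 3⟩, ⟨-1, 1, 2, 0⟩, ⟨-1, 1, 1, 1⟩, ⟨-1, 1, 0, 2⟩,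
   ⟨1, 0, 1, 1⟩]

def F₇ : K := ofTerms
  [⟨1, 24, 8, 7⟩, ⟨-1, 21, 8, 5⟩, ⟨-1, 21, 6, 7⟩, ⟨1, 19, 6, 6⟩, ⟨-1, 18, 7, 5⟩, ⟨-1, 18, 6, 6⟩,
   ⟨1, 16, 5, 5⟩, ⟨-1, 16, 4, 6⟩, ⟨1, 15, 7, 3⟩, ⟨1, 15, 4, 6⟩, ⟨1, 14, 6, 3⟩, ⟨1, 14, 5, 4⟩,
   ⟨2, 14, 4, 5⟩, ⟨-3, 13, 5, 4⟩, ⟨1, 12, 5, 4⟩, ⟨-1, 12, 4, 3⟩, ⟨1, 11, 3, 4⟩, ⟨-1, 11, 2, 5⟩,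
   ⟨1, 10, 5, 2⟩, ⟨-1, 10, 4, 3⟩, ⟨-2, 10, 4, 2⟩, ⟨1, 9, 3, 3⟩, ⟨1, 9, 2, 4⟩, ⟨-1, 8, 5, 1⟩,
   ⟨1, 8, 4, 2⟩, ⟨-3, 8, 3, 3⟩, ⟨-1, 8, 2, 4⟩, ⟨1, 7, 4, 2⟩, ⟨1, 7, 4, 0⟩, ⟨1, 7, 3, 3⟩,
   ⟨-1, 5, 4, 0⟩, ⟨1, 5, 3, 1⟩, ⟨1, 4, 2, 1⟩, ⟨1, 4, 0, 3⟩, ⟨-1, 3, 3, 0⟩, ⟨-1, 3, 1, 2⟩,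
   ⟨-1, 1, 0, 1⟩, ⟨1, 0, 1, 0⟩]

def F₈ : K := ofTerms
  [⟨1, 25, 6, 8⟩, ⟨-1, 23, 6, 8⟩, ⟨1, 23, 6, 7⟩, ⟨1, 22, 5, 7⟩, ⟨1, 21, 5, 6⟩, ⟨-1, 21, 4, 7⟩,
   ⟨-1, 20, 6, 7⟩, ⟨-1, 20, 6, 5⟩, ⟨-1, 19, 5, 7⟩, ⟨1, 19, 4, 7⟩, ⟨-1, 19, 4, 6⟩, ⟨-1, 18, 3, 6⟩,
   ⟨-1, 17, 5, 6⟩, ⟨1, 17, 5, 5⟩, ⟨-1, 16, 5, 5⟩, ⟨1, 16, 4, 6⟩, ⟨1, 16, 4, 5⟩, ⟨1, 15, 6, 5⟩,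
   ⟨-1, 15, 5, 5⟩, ⟨-1, 15, 4, 5⟩, ⟨1, 15, 4, 4⟩, ⟨1, 15, 3, 6⟩, ⟨-1, 15, 3, 5⟩, ⟨1, 14, 5, 5⟩,
   ⟨-1, 14, 5, 3⟩, ⟨-1, 14, 4, 5⟩, ⟨1, 13, 6, 4⟩, ⟨1, 13, 4, 5⟩, ⟨-1, 13, 3, 4⟩, ⟨1, 12, 5, 4⟩,
   ⟨1, 12, 3, 5⟩, ⟨-1, 12, 2, 4⟩, ⟨1, 11, 5, 3⟩, ⟨-1, 11, 4, 4⟩, ⟨1, 11, 4, 3⟩, ⟨1, 11, 3, 4⟩,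
   ⟨-1, 10, 6, 2⟩, ⟨1, 10, 4, 3⟩, ⟨-1, 10, 3, 4⟩, ⟨1, 10, 3, 3⟩, ⟨1, 10, 2, 4⟩, ⟨-1, 9, 5, 2⟩,
   ⟨-2, 9, 4, 3⟩, ⟨1, 9, 3, 3⟩, ⟨1, 9, 3, 2⟩, ⟨-1, 9, 2, 4⟩, ⟨1, 9, 1, 4⟩, ⟨-1, 8, 4, 2⟩,
   ⟨-2, 8, 3, 3⟩, ⟨-1, 8, 3, 2⟩, ⟨1, 8, 2, 3⟩, ⟨-1, 8, 1, 4⟩, ⟨-1, 7, 2, 3⟩, ⟨-1, 7, 2, 2⟩,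
   ⟨1, 6, 2, 2⟩, ⟨-1, 6, 1, 2⟩, ⟨1, 5, 4, 0⟩, ⟨1, 5, 2, 2⟩, ⟨1, 5, 1, 2⟩, ⟨1, 4, 3, 0⟩,
   ⟨1, 4, 1, 2⟩, ⟨1, 3, 2, 0⟩, ⟨1, 3, 0, 2⟩, ⟨-1, 2, 2, 0⟩, ⟨-1, 1, 1, 0⟩, ⟨-1, 0, 0, 0⟩]

def F₉ : K := ofTerms
  [⟨-1, 26, 7, 7⟩, ⟨1, 26, 6, 8⟩, ⟨1, 25, 6, 7⟩, ⟨1, 24, 7, 7⟩, ⟨-1, 24, 6, 8⟩, ⟨-1, 23, 6, 7⟩,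
   ⟨1, 23, 5, 8⟩, ⟨-1, 22, 4, 7⟩, ⟨-1, 22, 3, 8⟩, ⟨1, 21, 7, 6⟩, ⟨-1, 21, 6, 7⟩, ⟨1, 21, 4, 7⟩,
   ⟨-1, 20, 4, 6⟩, ⟨-2, 19, 5, 6⟩, ⟨1, 19, 5, 5⟩, ⟨1, 19, 4, 7⟩, ⟨1, 18, 4, 6⟩, ⟨-1, 17, 4, 6⟩,
   ⟨1, 17, 2, 6⟩, ⟨-1, 16, 7, 4⟩, ⟨1, 16, 6, 5⟩, ⟨-1, 16, 5, 5⟩, ⟨-1, 16, 3, 5⟩, ⟨-1, 15, 6, 4⟩,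
   ⟨1, 15, 5, 5⟩, ⟨1, 14, 3, 5⟩, ⟨1, 13, 4, 4⟩, ⟨-1, 13, 3, 5⟩, ⟨1, 13, 2, 5⟩, ⟨1, 13, 1, 6⟩,
   ⟨2, 12, 3, 4⟩, ⟨-1, 12, 2, 5⟩, ⟨1, 11, 4, 4⟩, ⟨-1, 11, 4, 3⟩, ⟨-1, 11, 3, 4⟩, ⟨-1, 11, 2, 5⟩,
   ⟨1, 10, 6, 2⟩, ⟨-1, 10, 5, 3⟩, ⟨1, 10, 3, 4⟩, ⟨1, 9, 5, 2⟩, ⟨-1, 8, 1, 4⟩, ⟨-1, 8, 0, 4⟩,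
   ⟨1, 6, 2, 3⟩, ⟨-1, 6, 2, 2⟩, ⟨1, 6, 1, 3⟩, ⟨-1, 5, 3, 2⟩, ⟨-1, 5, 2, 2⟩, ⟨1, 4, 3, 1⟩,
   ⟨-1, 3, 4, 0⟩, ⟨1, 3, 0, 2⟩, ⟨-1, 1, 1, 1⟩, ⟨1, 0, 2, 0⟩]

def F₁₀ : K := ofTerms
  [⟨1, 28, 3, 6⟩, ⟨1, 27, 3, 6⟩, ⟨1, 24, 3, 5⟩, ⟨1, 23, 3, 5⟩, ⟨1, 23, 2, 5⟩, ⟨1, 22, 3, 5⟩,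
   ⟨1, 22, 2, 5⟩, ⟨1, 21, 2, 5⟩, ⟨1, 20, 2, 4⟩, ⟨2, 19, 2, 4⟩, ⟨2, 18, 2, 4⟩, ⟨1, 17, 2, 4⟩,
   ⟨1, 15, 2, 3⟩, ⟨2, 14, 2, 3⟩, ⟨1, 14, 1, 3⟩, ⟨-1, 13, 3, 3⟩, ⟨1, 13, 2, 3⟩, ⟨2, 13, 1, 3⟩,
   ⟨-1, 12, 2, 3⟩, ⟨1, 12, 1, 3⟩, ⟨-1, 11, 1, 3⟩, ⟨1, 11, 1, 2⟩, ⟨2, 10, 1, 2⟩, ⟨-1, 10, 0, 3⟩,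
   ⟨2, 9, 1, 2⟩, ⟨1, 8, 1, 2⟩, ⟨1, 6, 1, 1⟩, ⟨1, 5, 1, 1⟩, ⟨1, 5, 0, 1⟩, ⟨1, 4, 1, 1⟩, ⟨1, 4, 0, 1⟩,
   ⟨1, 3, 0, 1⟩, ⟨1, 1, 0, 0⟩, ⟨1, 0, 0, 0⟩]

def F₁₁ : K := ofTerms
  [⟨1, 29, 9, 8⟩, ⟨-1, 26, 7, 8⟩, ⟨-1, 24, 9, 6⟩, ⟨-1, 24, 7, 7⟩, ⟨-1, 23, 8, 6⟩, ⟨1, 21, 5, 7⟩,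
   ⟨1, 20, 5, 6⟩, ⟨1, 19, 6, 6⟩, ⟨1, 19, 6, 5⟩, ⟨1, 19, 5, 6⟩, ⟨1, 18, 8, 4⟩, ⟨1, 18, 7, 5⟩,
   ⟨1, 17, 7, 4⟩, ⟨-1, 17, 3, 6⟩, ⟨-1, 15, 5, 4⟩, ⟨-1, 15, 5, 3⟩, ⟨-1, 14, 4, 5⟩, ⟨-2, 14, 4, 4⟩,
   ⟨-1, 14, 3, 5⟩, ⟨-1, 13, 5, 4⟩, ⟨1, 13, 4, 4⟩, ⟨-1, 12, 6, 3⟩, ⟨1, 12, 5, 3⟩, ⟨-1, 12, 4, 4⟩,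
   ⟨1, 12, 3, 3⟩, ⟨-1, 11, 6, 2⟩, ⟨-1, 11, 5, 3⟩, ⟨1, 10, 5, 1⟩, ⟨-1, 10, 3, 3⟩, ⟨1, 10, 3, 2⟩,
   ⟨1, 10, 2, 4⟩, ⟨1, 10, 1, 4⟩, ⟨2, 9, 4, 2⟩, ⟨-1, 9, 4, 1⟩, ⟨1, 9, 3, 3⟩, ⟨-1, 9, 2, 3⟩,
   ⟨-1, 8, 5, 1⟩, ⟨-1, 8, 3, 2⟩, ⟨1, 8, 2, 3⟩, ⟨1, 7, 4, 1⟩, ⟨1, 7, 3, 2⟩, ⟨1, 7, 2, 3⟩,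
   ⟨-1, 7, 1, 2⟩, ⟨1, 6, 2, 1⟩, ⟨1, 5, 4, 1⟩, ⟨-1, 5, 2, 1⟩, ⟨-1, 4, 3, 0⟩, ⟨-1, 3, 2, 1⟩,
   ⟨-1, 3, 0, 2⟩, ⟨1, 2, 3, 0⟩, ⟨-1, 1, 2, 0⟩, ⟨1, 0, 0, 0⟩]

def F₁₂ : K := ofTerms
  [⟨1, 29, 8, 9⟩, ⟨-1, 26, 6, 9⟩, ⟨1, 25, 7, 7⟩, ⟨-1, 25, 6, 8⟩, ⟨-1, 24, 8, 7⟩, ⟨-1, 22, 8, 6⟩,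
   ⟨-1, 22, 5, 7⟩, ⟨1, 22, 4, 8⟩, ⟨-1, 20, 7, 5⟩, ⟨1, 20, 6, 6⟩, ⟨-1, 20, 5, 7⟩, ⟨1, 19, 8, 4⟩,
   ⟨1, 19, 5, 7⟩, ⟨1, 19, 5, 6⟩, ⟨1, 19, 4, 7⟩, ⟨1, 18, 6, 6⟩, ⟨1, 18, 6, 5⟩, ⟨-1, 18, 5, 6⟩,
   ⟨1, 16, 6, 5⟩, ⟨-1, 16, 4, 5⟩, ⟨1, 16, 3, 6⟩, ⟨1, 15, 4, 5⟩, ⟨-1, 15, 4, 4⟩, ⟨-1, 15, 3, 6⟩,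
   ⟨-1, 15, 2, 6⟩, ⟨-1, 14, 6, 2⟩, ⟨1, 14, 5, 3⟩, ⟨-2, 14, 4, 5⟩, ⟨-1, 14, 4, 4⟩, ⟨1, 14, 3, 5⟩,
   ⟨-1, 13, 6, 3⟩, ⟨1, 13, 4, 4⟩, ⟨1, 13, 3, 5⟩, ⟨-2, 12, 4, 4⟩, ⟨-1, 12, 3, 5⟩, ⟨1, 12, 2, 4⟩,
   ⟨1, 11, 4, 2⟩, ⟨-1, 11, 3, 3⟩, ⟨1, 10, 4, 2⟩, ⟨1, 10, 2, 4⟩, ⟨-1, 9, 3, 2⟩, ⟨-1, 9, 1, 4⟩,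
   ⟨1, 8, 4, 1⟩, ⟨1, 8, 1, 4⟩, ⟨1, 7, 3, 2⟩, ⟨1, 7, 2, 3⟩, ⟨1, 6, 1, 2⟩, ⟨-1, 5, 2, 1⟩,
   ⟨-1, 5, 1, 2⟩, ⟨-1, 3, 2, 0⟩, ⟨-1, 3, 0, 2⟩, ⟨1, 0, 0, 0⟩]

def F₁₃ : K := ofTerms
  [⟨1, 30, 9, 8⟩, ⟨-1, 26, 8, 6⟩, ⟨1, 26, 7, 7⟩, ⟨-1, 25, 9, 6⟩, ⟨-1, 25, 7, 8⟩, ⟨-1, 25, 7, 7⟩,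
   ⟨-1, 25, 6, 8⟩, ⟨-1, 23, 7, 7⟩, ⟨1, 23, 6, 8⟩, ⟨1, 23, 6, 6⟩, ⟨-1, 23, 5, 7⟩, ⟨1, 21, 8, 4⟩,
   ⟨-1, 21, 7, 5⟩, ⟨-1, 21, 6, 6⟩, ⟨1, 21, 6, 5⟩, ⟨1, 21, 5, 7⟩, ⟨1, 21, 4, 7⟩, ⟨1, 20, 7, 5⟩,
   ⟨1, 20, 6, 6⟩, ⟨1, 19, 7, 5⟩, ⟨-1, 19, 6, 5⟩, ⟨1, 19, 5, 7⟩, ⟨2, 19, 5, 6⟩, ⟨-1, 19, 4, 7⟩,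
   ⟨1, 18, 7, 4⟩, ⟨1, 18, 6, 5⟩, ⟨-1, 18, 4, 5⟩, ⟨-2, 16, 5, 4⟩, ⟨-1, 15, 6, 3⟩, ⟨1, 15, 5, 4⟩,
   ⟨1, 15, 4, 5⟩, ⟨-1, 15, 3, 6⟩, ⟨-1, 14, 6, 2⟩, ⟨-1, 14, 5, 4⟩, ⟨-1, 14, 4, 5⟩, ⟨-1, 14, 4, 4⟩,
   ⟨-1, 12, 5, 3⟩, ⟨-1, 12, 4, 4⟩, ⟨-1, 12, 3, 5⟩, ⟨1, 11, 4, 2⟩, ⟨1, 11, 3, 3⟩, ⟨1, 10, 4, 2⟩,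
   ⟨1, 10, 2, 4⟩, ⟨1, 8, 4, 1⟩, ⟨1, 8, 1, 4⟩, ⟨1, 7, 3, 2⟩, ⟨1, 7, 2, 3⟩, ⟨-1, 5, 2, 1⟩,
   ⟨-1, 5, 1, 2⟩, ⟨-1, 3, 2, 0⟩, ⟨-1, 3, 0, 2⟩, ⟨1, 0, 0, 0⟩]

def F₁₄ : K := ofTerms
  [⟨-1, 30, 8, 9⟩, ⟨1, 29, 7, 9⟩, ⟨1, 29, 6, 10⟩, ⟨1, 28, 8, 9⟩, ⟨-1, 28, 7, 9⟩, ⟨-1, 27, 7, 9⟩,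
   ⟨-1, 26, 4, 10⟩, ⟨1, 25, 8, 8⟩, ⟨1, 25, 5, 9⟩, ⟨-1, 25, 4, 9⟩, ⟨1, 24, 5, 8⟩, ⟨1, 23, 7, 7⟩,
   ⟨-2, 23, 6, 8⟩, ⟨-1, 22, 6, 7⟩, ⟨1, 22, 5, 8⟩, ⟨1, 22, 2, 9⟩, ⟨-1, 21, 5, 8⟩, ⟨-1, 21, 3, 8⟩,
   ⟨-1, 20, 8, 6⟩, ⟨1, 20, 7, 6⟩, ⟨-1, 19, 7, 6⟩, ⟨1, 19, 4, 7⟩, ⟨1, 18, 6, 5⟩, ⟨-2, 18, 5, 6⟩,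
   ⟨1, 18, 4, 7⟩, ⟨-1, 18, 3, 7⟩, ⟨1, 17, 5, 6⟩, ⟨-1, 17, 5, 5⟩, ⟨1, 17, 4, 6⟩, ⟨1, 17, 3, 7⟩,
   ⟨1, 17, 2, 8⟩, ⟨1, 16, 4, 6⟩, ⟨-1, 15, 7, 4⟩, ⟨1, 15, 6, 4⟩, ⟨-1, 15, 5, 5⟩, ⟨-1, 15, 3, 7⟩,
   ⟨1, 14, 7, 4⟩, ⟨1, 14, 4, 6⟩, ⟨-1, 14, 2, 6⟩, ⟨1, 13, 6, 4⟩, ⟨-1, 13, 4, 4⟩, ⟨1, 13, 3, 5⟩,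
   ⟨-1, 13, 0, 7⟩, ⟨-1, 12, 2, 6⟩, ⟨-1, 11, 4, 4⟩, ⟨1, 11, 3, 4⟩, ⟨1, 11, 1, 6⟩, ⟨-1, 10, 6, 2⟩,
   ⟨1, 10, 5, 3⟩, ⟨1, 10, 3, 5⟩, ⟨-1, 10, 3, 4⟩, ⟨-2, 10, 2, 5⟩, ⟨-1, 9, 4, 4⟩, ⟨-1, 9, 4, 3⟩,
   ⟨1, 8, 5, 2⟩, ⟨1, 8, 4, 3⟩, ⟨1, 8, 3, 4⟩, ⟨1, 8, 0, 5⟩, ⟨-1, 7, 5, 2⟩, ⟨-1, 7, 4, 3⟩,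
   ⟨1, 6, 2, 2⟩, ⟨-1, 6, 1, 4⟩, ⟨1, 6, 0, 4⟩, ⟨1, 5, 2, 3⟩, ⟨-1, 4, 3, 1⟩, ⟨-1, 4, 1, 3⟩,
   ⟨1, 3, 4, 0⟩, ⟨1, 3, 2, 2⟩, ⟨-1, 3, 0, 2⟩, ⟨1, 1, 1, 1⟩, ⟨-1, 0, 2, 0⟩]

def F₁₅ : K := ofTerms
  [⟨1, 31, 8, 9⟩, ⟨-1, 28, 6, 9⟩, ⟨-1, 26, 8, 7⟩, ⟨1, 26, 7, 7⟩, ⟨-1, 26, 6, 8⟩, ⟨-1, 25, 7, 7⟩,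
   ⟨-1, 23, 5, 7⟩, ⟨1, 23, 4, 8⟩, ⟨1, 22, 4, 7⟩, ⟨-1, 21, 7, 5⟩, ⟨1, 21, 6, 5⟩, ⟨1, 21, 5, 7⟩,
   ⟨-1, 21, 5, 6⟩, ⟨1, 21, 4, 7⟩, ⟨1, 20, 7, 5⟩, ⟨1, 20, 6, 6⟩, ⟨1, 19, 6, 5⟩, ⟨-1, 19, 2, 7⟩,
   ⟨-1, 18, 4, 5⟩, ⟨1, 18, 3, 6⟩, ⟨-1, 17, 4, 5⟩, ⟨-1, 16, 6, 3⟩, ⟨1, 16, 5, 4⟩, ⟨1, 16, 4, 5⟩,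
   ⟨1, 15, 5, 4⟩, ⟨-2, 15, 4, 5⟩, ⟨-1, 15, 4, 4⟩, ⟨-1, 14, 5, 4⟩, ⟨1, 14, 5, 3⟩, ⟨1, 14, 4, 4⟩,
   ⟨-1, 14, 2, 6⟩, ⟨-1, 13, 5, 3⟩, ⟨-2, 13, 4, 4⟩, ⟨1, 11, 3, 3⟩, ⟨1, 11, 2, 4⟩, ⟨1, 10, 4, 2⟩,
   ⟨-1, 10, 3, 3⟩, ⟨-1, 10, 3, 2⟩, ⟨-1, 10, 1, 4⟩, ⟨1, 10, 0, 5⟩, ⟨1, 9, 4, 1⟩, ⟨1, 9, 2, 4⟩,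
   ⟨1, 9, 2, 3⟩, ⟨-1, 8, 3, 2⟩, ⟨1, 7, 3, 2⟩, ⟨1, 7, 2, 3⟩, ⟨1, 7, 1, 2⟩, ⟨-1, 6, 2, 1⟩,
   ⟨-1, 5, 0, 3⟩, ⟨-1, 3, 2, 0⟩, ⟨-1, 3, 0, 2⟩, ⟨1, 0, 0, 0⟩]

def F₁₆ : K := ofTerms
  [⟨1, 38, 10, 12⟩, ⟨-1, 35, 10, 10⟩, ⟨-1, 35, 8, 12⟩, ⟨1, 34, 9, 10⟩, ⟨-1, 34, 8, 11⟩,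
   ⟨-1, 31, 7, 10⟩, ⟨1, 31, 6, 11⟩, ⟨-1, 30, 9, 10⟩, ⟨1, 30, 8, 9⟩, ⟨1, 30, 7, 10⟩, ⟨1, 26, 7, 9⟩,
   ⟨1, 26, 6, 10⟩, ⟨-1, 26, 5, 9⟩, ⟨-1, 24, 9, 7⟩, ⟨-1, 24, 7, 9⟩, ⟨1, 23, 8, 8⟩, ⟨1, 23, 8, 6⟩,
   ⟨-1, 23, 7, 7⟩, ⟨1, 22, 7, 7⟩, ⟨-1, 22, 7, 6⟩, ⟨1, 22, 6, 7⟩, ⟨1, 22, 5, 9⟩, ⟨1, 22, 5, 8⟩,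
   ⟨-1, 22, 4, 9⟩, ⟨-1, 21, 6, 7⟩, ⟨-1, 21, 5, 8⟩, ⟨-1, 20, 8, 6⟩, ⟨1, 20, 8, 5⟩, ⟨-1, 20, 7, 6⟩,
   ⟨-1, 20, 6, 8⟩, ⟨-1, 20, 6, 7⟩, ⟨1, 20, 5, 8⟩, ⟨1, 19, 9, 5⟩, ⟨1, 19, 7, 7⟩, ⟨2, 19, 7, 6⟩,
   ⟨-2, 18, 6, 5⟩, ⟨1, 18, 5, 6⟩, ⟨1, 18, 4, 7⟩, ⟨-1, 18, 3, 8⟩, ⟨-1, 17, 5, 6⟩, ⟨1, 17, 5, 5⟩,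
   ⟨-1, 17, 4, 7⟩, ⟨1, 17, 3, 7⟩, ⟨-1, 16, 5, 6⟩, ⟨1, 16, 4, 7⟩, ⟨-1, 15, 8, 3⟩, ⟨1, 15, 7, 4⟩,
   ⟨2, 15, 6, 5⟩, ⟨-1, 15, 6, 4⟩, ⟨-1, 15, 5, 5⟩, ⟨-2, 15, 4, 6⟩, ⟨-1, 15, 3, 7⟩, ⟨-1, 14, 7, 4⟩,
   ⟨-1, 14, 6, 5⟩, ⟨1, 13, 6, 4⟩, ⟨1, 13, 5, 5⟩, ⟨1, 13, 4, 6⟩, ⟨1, 13, 4, 4⟩, ⟨1, 13, 2, 6⟩,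
   ⟨-1, 12, 7, 3⟩, ⟨-1, 12, 6, 4⟩, ⟨-1, 12, 5, 5⟩, ⟨1, 11, 4, 3⟩, ⟨-1, 11, 3, 5⟩, ⟨1, 11, 1, 6⟩,
   ⟨1, 10, 6, 2⟩, ⟨1, 10, 4, 4⟩, ⟨1, 10, 3, 4⟩, ⟨1, 10, 2, 5⟩, ⟨-1, 9, 5, 2⟩, ⟨-1, 9, 2, 5⟩,
   ⟨1, 8, 6, 1⟩, ⟨-1, 8, 4, 3⟩, ⟨-1, 8, 2, 3⟩, ⟨-1, 8, 1, 4⟩, ⟨1, 7, 5, 2⟩, ⟨1, 7, 4, 3⟩,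
   ⟨1, 6, 3, 2⟩, ⟨1, 6, 2, 3⟩, ⟨-1, 6, 2, 2⟩, ⟨-1, 6, 0, 4⟩, ⟨-1, 5, 4, 1⟩, ⟨-1, 5, 3, 2⟩,
   ⟨1, 4, 3, 1⟩, ⟨1, 4, 1, 3⟩, ⟨-1, 3, 4, 0⟩, ⟨-1, 3, 2, 2⟩, ⟨1, 3, 0, 2⟩, ⟨-1, 1, 1, 1⟩,
   ⟨1, 0, 2, 0⟩]

def F₁₇ : K := ofTerms
  [⟨1, 39, 6, 11⟩, ⟨1, 38, 8, 9⟩, ⟨-1, 38, 7, 10⟩, ⟨-1, 37, 6, 11⟩, ⟨-1, 36, 8, 9⟩, ⟨1, 36, 7, 10⟩,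
   ⟨1, 36, 6, 10⟩, ⟨1, 35, 8, 8⟩, ⟨-1, 35, 7, 9⟩, ⟨1, 35, 5, 10⟩, ⟨1, 34, 7, 8⟩, ⟨-1, 34, 6, 9⟩,
   ⟨-1, 33, 6, 10⟩, ⟨-1, 32, 8, 8⟩, ⟨1, 32, 7, 9⟩, ⟨-1, 32, 5, 10⟩, ⟨-1, 31, 7, 8⟩, ⟨1, 31, 6, 9⟩,
   ⟨-1, 31, 6, 8⟩, ⟨1, 31, 5, 9⟩, ⟨1, 30, 7, 7⟩, ⟨-1, 30, 6, 8⟩, ⟨-1, 30, 5, 8⟩, ⟨-1, 29, 7, 6⟩,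
   ⟨-1, 29, 5, 9⟩, ⟨-1, 29, 4, 8⟩, ⟨-1, 28, 7, 7⟩, ⟨1, 28, 6, 8⟩, ⟨-1, 28, 6, 6⟩, ⟨1, 28, 5, 8⟩,
   ⟨1, 27, 7, 6⟩, ⟨-1, 27, 6, 7⟩, ⟨-1, 27, 5, 6⟩, ⟨1, 27, 4, 8⟩, ⟨-1, 26, 8, 6⟩, ⟨1, 26, 7, 7⟩,
   ⟨1, 26, 6, 8⟩, ⟨1, 26, 6, 6⟩, ⟨-1, 26, 5, 8⟩, ⟨-1, 26, 5, 7⟩, ⟨1, 26, 5, 6⟩, ⟨1, 25, 8, 6⟩,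
   ⟨-1, 25, 7, 7⟩, ⟨-1, 25, 7, 6⟩, ⟨1, 25, 6, 7⟩, ⟨1, 25, 5, 8⟩, ⟨-1, 25, 4, 8⟩, ⟨1, 25, 4, 6⟩,
   ⟨1, 24, 7, 6⟩, ⟨-1, 24, 6, 7⟩, ⟨-1, 24, 6, 6⟩, ⟨1, 24, 5, 7⟩, ⟨1, 24, 4, 8⟩, ⟨-1, 24, 3, 8⟩,
   ⟨1, 24, 3, 6⟩, ⟨1, 23, 6, 7⟩, ⟨1, 23, 6, 6⟩, ⟨-1, 23, 5, 7⟩, ⟨-1, 23, 5, 6⟩, ⟨1, 23, 4, 7⟩,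
   ⟨1, 23, 3, 8⟩, ⟨1, 22, 6, 5⟩, ⟨1, 22, 5, 7⟩, ⟨-1, 22, 4, 7⟩, ⟨-1, 22, 4, 6⟩, ⟨-1, 21, 6, 4⟩,
   ⟨1, 21, 5, 6⟩, ⟨-1, 21, 3, 6⟩, ⟨1, 20, 7, 4⟩, ⟨-1, 20, 6, 5⟩, ⟨-1, 20, 5, 4⟩, ⟨2, 20, 4, 6⟩,
   ⟨2, 19, 6, 4⟩, ⟨-1, 19, 4, 6⟩, ⟨-1, 19, 4, 4⟩, ⟨2, 19, 3, 6⟩, ⟨-1, 18, 7, 4⟩, ⟨2, 18, 5, 4⟩,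
   ⟨-1, 18, 4, 6⟩, ⟨1, 18, 4, 4⟩, ⟨-1, 18, 3, 6⟩, ⟨1, 18, 2, 6⟩, ⟨-1, 17, 6, 4⟩, ⟨1, 17, 4, 4⟩,
   ⟨-1, 17, 3, 6⟩, ⟨1, 17, 3, 4⟩, ⟨-1, 16, 6, 4⟩, ⟨-1, 16, 5, 4⟩, ⟨-1, 16, 2, 6⟩, ⟨1, 16, 2, 4⟩,
   ⟨-1, 15, 5, 4⟩, ⟨-1, 15, 4, 4⟩, ⟨-1, 15, 3, 4⟩, ⟨-1, 14, 4, 4⟩, ⟨-1, 14, 3, 4⟩, ⟨-1, 14, 2, 4⟩,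
   ⟨1, 13, 5, 3⟩, ⟨-1, 13, 5, 2⟩, ⟨1, 13, 4, 4⟩, ⟨-1, 13, 4, 3⟩, ⟨-1, 13, 2, 4⟩, ⟨-1, 13, 1, 4⟩,
   ⟨1, 12, 6, 2⟩, ⟨-1, 12, 5, 3⟩, ⟨2, 12, 4, 3⟩, ⟨-1, 12, 4, 2⟩, ⟨2, 12, 3, 4⟩, ⟨-1, 12, 3, 3⟩,
   ⟨2, 11, 5, 2⟩, ⟨-1, 11, 4, 3⟩, ⟨2, 11, 3, 3⟩, ⟨-1, 11, 3, 2⟩, ⟨2, 11, 2, 4⟩, ⟨-1, 11, 2, 3⟩,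
   ⟨2, 10, 4, 2⟩, ⟨-1, 10, 3, 3⟩, ⟨1, 10, 3, 2⟩, ⟨1, 10, 2, 3⟩, ⟨1, 10, 1, 4⟩, ⟨1, 9, 3, 2⟩,
   ⟨1, 9, 2, 2⟩, ⟨1, 8, 1, 2⟩, ⟨-1, 7, 3, 2⟩, ⟨-1, 7, 2, 2⟩, ⟨-1, 6, 2, 2⟩, ⟨-1, 6, 1, 2⟩,
   ⟨-1, 5, 4, 0⟩, ⟨-1, 5, 1, 2⟩, ⟨-1, 5, 0, 2⟩, ⟨-1, 4, 3, 0⟩, ⟨-1, 3, 2, 0⟩, ⟨1, 2, 2, 0⟩,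
   ⟨1, 1, 1, 0⟩, ⟨1, 0, 0, 0⟩]

def F₁₈ : K := ofTerms
  [⟨1, 48, 6, 12⟩, ⟨-1, 47, 7, 11⟩, ⟨1, 47, 6, 12⟩, ⟨-1, 46, 7, 11⟩, ⟨1, 44, 6, 11⟩,
   ⟨-1, 44, 4, 11⟩, ⟨-1, 43, 7, 10⟩, ⟨1, 43, 6, 11⟩, ⟨1, 43, 5, 11⟩, ⟨-1, 43, 4, 11⟩,
   ⟨-1, 42, 7, 10⟩, ⟨1, 42, 6, 11⟩, ⟨-1, 42, 6, 10⟩, ⟨1, 42, 5, 11⟩, ⟨-1, 41, 7, 10⟩,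
   ⟨-1, 41, 6, 10⟩, ⟨1, 41, 5, 11⟩, ⟨-1, 40, 6, 10⟩, ⟨1, 40, 5, 10⟩, ⟨-1, 40, 4, 10⟩,
   ⟨-1, 39, 6, 9⟩, ⟨1, 39, 5, 10⟩, ⟨-1, 39, 4, 10⟩, ⟨-1, 39, 3, 10⟩, ⟨-1, 38, 6, 9⟩, ⟨1, 38, 5, 10⟩,
   ⟨-1, 38, 4, 10⟩, ⟨-1, 38, 3, 10⟩, ⟨-1, 37, 6, 9⟩, ⟨1, 37, 5, 10⟩, ⟨-1, 37, 3, 10⟩,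
   ⟨-1, 36, 6, 9⟩, ⟨-1, 36, 3, 9⟩, ⟨-1, 35, 3, 9⟩, ⟨1, 34, 5, 9⟩, ⟨-1, 34, 3, 9⟩, ⟨-1, 33, 6, 9⟩,
   ⟨-1, 33, 6, 8⟩, ⟨1, 33, 4, 9⟩, ⟨1, 33, 4, 8⟩, ⟨-1, 33, 3, 9⟩, ⟨1, 32, 7, 8⟩, ⟨-1, 32, 5, 9⟩,
   ⟨-1, 32, 5, 8⟩, ⟨1, 32, 4, 8⟩, ⟨1, 31, 6, 8⟩, ⟨-1, 31, 4, 9⟩, ⟨1, 31, 4, 8⟩, ⟨1, 30, 5, 8⟩,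
   ⟨1, 30, 4, 8⟩, ⟨1, 30, 4, 7⟩, ⟨-1, 30, 3, 9⟩, ⟨-1, 30, 3, 8⟩, ⟨2, 29, 4, 8⟩, ⟨1, 29, 4, 7⟩,
   ⟨1, 29, 3, 7⟩, ⟨-1, 29, 2, 8⟩, ⟨1, 28, 4, 7⟩, ⟨1, 28, 3, 8⟩, ⟨1, 28, 3, 7⟩, ⟨1, 27, 4, 7⟩,
   ⟨1, 27, 3, 7⟩, ⟨1, 27, 2, 8⟩, ⟨1, 26, 4, 7⟩, ⟨1, 26, 3, 7⟩, ⟨1, 26, 1, 8⟩, ⟨1, 25, 3, 7⟩,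
   ⟨1, 25, 3, 6⟩, ⟨1, 24, 5, 7⟩, ⟨1, 24, 5, 6⟩, ⟨1, 24, 3, 6⟩, ⟨-1, 24, 3, 5⟩, ⟨-1, 23, 6, 6⟩,
   ⟨1, 23, 4, 7⟩, ⟨1, 23, 4, 6⟩, ⟨2, 23, 3, 6⟩, ⟨-1, 23, 3, 5⟩, ⟨-1, 23, 2, 5⟩, ⟨-1, 22, 5, 6⟩,
   ⟨1, 22, 3, 7⟩, ⟨1, 22, 3, 6⟩, ⟨-1, 22, 2, 5⟩, ⟨-1, 21, 4, 6⟩, ⟨1, 21, 4, 5⟩, ⟨1, 21, 2, 7⟩,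
   ⟨1, 21, 2, 6⟩, ⟨-1, 21, 2, 4⟩, ⟨1, 20, 4, 5⟩, ⟨-2, 20, 3, 6⟩, ⟨1, 20, 3, 5⟩, ⟨-1, 20, 2, 4⟩,
   ⟨1, 20, 1, 6⟩, ⟨-1, 19, 3, 6⟩, ⟨1, 19, 3, 5⟩, ⟨-1, 19, 2, 6⟩, ⟨1, 19, 2, 5⟩, ⟨-1, 19, 2, 4⟩,
   ⟨1, 18, 2, 5⟩, ⟨-1, 18, 2, 4⟩, ⟨-1, 18, 1, 6⟩, ⟨1, 18, 1, 5⟩, ⟨-1, 17, 3, 5⟩, ⟨1, 17, 1, 5⟩,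
   ⟨-1, 17, 0, 6⟩, ⟨1, 16, 4, 4⟩, ⟨-1, 16, 3, 5⟩, ⟨-1, 16, 2, 5⟩, ⟨-1, 16, 2, 3⟩, ⟨1, 15, 4, 4⟩,
   ⟨-1, 15, 3, 5⟩, ⟨1, 15, 3, 4⟩, ⟨-1, 15, 2, 5⟩, ⟨1, 15, 2, 4⟩, ⟨-1, 15, 2, 3⟩, ⟨-1, 15, 1, 3⟩,
   ⟨1, 14, 4, 4⟩, ⟨1, 14, 3, 4⟩, ⟨-1, 14, 2, 5⟩, ⟨1, 14, 2, 4⟩, ⟨-1, 14, 2, 3⟩, ⟨-1, 14, 1, 3⟩,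
   ⟨1, 13, 3, 4⟩, ⟨1, 13, 3, 3⟩, ⟨1, 13, 2, 4⟩, ⟨-1, 13, 2, 3⟩, ⟨1, 13, 1, 4⟩, ⟨-1, 13, 1, 3⟩,
   ⟨-1, 13, 1, 2⟩, ⟨1, 12, 3, 3⟩, ⟨1, 12, 2, 3⟩, ⟨1, 12, 1, 4⟩, ⟨-1, 12, 1, 3⟩, ⟨-1, 12, 1, 2⟩,
   ⟨1, 12, 0, 4⟩, ⟨1, 11, 3, 3⟩, ⟨-1, 11, 2, 4⟩, ⟨1, 11, 2, 3⟩, ⟨1, 11, 1, 4⟩, ⟨1, 11, 1, 3⟩,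
   ⟨-2, 11, 1, 2⟩, ⟨1, 11, 0, 4⟩, ⟨1, 10, 3, 3⟩, ⟨1, 10, 2, 3⟩, ⟨1, 10, 1, 3⟩, ⟨-2, 10, 1, 2⟩,
   ⟨1, 10, 0, 4⟩, ⟨1, 10, 0, 3⟩, ⟨1, 9, 2, 3⟩, ⟨1, 9, 1, 3⟩, ⟨-1, 9, 1, 2⟩, ⟨1, 9, 0, 3⟩,
   ⟨1, 8, 1, 3⟩, ⟨-1, 8, 1, 2⟩, ⟨-1, 8, 1, 1⟩, ⟨1, 8, 0, 3⟩, ⟨-1, 7, 1, 1⟩, ⟨1, 7, 0, 3⟩,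
   ⟨-1, 7, 0, 1⟩, ⟨-1, 6, 1, 1⟩, ⟨-1, 6, 0, 1⟩, ⟨-1, 5, 1, 1⟩, ⟨-1, 5, 0, 1⟩, ⟨-1, 4, 1, 1⟩,
   ⟨-1, 4, 0, 1⟩, ⟨-1, 3, 1, 1⟩, ⟨-1, 3, 0, 1⟩, ⟨-1, 3, 0, 0⟩, ⟨-1, 2, 0, 1⟩, ⟨-1, 2, 0, 0⟩,
   ⟨-1, 1, 0, 0⟩, ⟨-1, 0, 0, 0⟩]

def F₁₉ : K := ofTerms
  [⟨1, 50, 10, 14⟩, ⟨1, 48, 10, 13⟩, ⟨1, 47, 9, 13⟩, ⟨-1, 46, 10, 14⟩, ⟨1, 46, 9, 12⟩,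
   ⟨-1, 46, 8, 13⟩, ⟨-1, 45, 10, 11⟩, ⟨-1, 44, 8, 12⟩, ⟨-1, 43, 7, 12⟩, ⟨-1, 42, 10, 13⟩,
   ⟨-1, 42, 9, 12⟩, ⟨1, 42, 8, 13⟩, ⟨-1, 41, 9, 13⟩, ⟨-2, 38, 9, 11⟩, ⟨1, 38, 8, 12⟩,
   ⟨-2, 37, 8, 11⟩, ⟨1, 37, 7, 12⟩, ⟨1, 36, 9, 11⟩, ⟨-1, 36, 7, 11⟩, ⟨1, 35, 10, 11⟩,
   ⟨1, 35, 8, 11⟩, ⟨1, 34, 9, 11⟩, ⟨1, 34, 7, 10⟩, ⟨1, 33, 8, 11⟩, ⟨1, 33, 6, 10⟩, ⟨1, 32, 10, 10⟩,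
   ⟨1, 32, 8, 9⟩, ⟨1, 32, 7, 11⟩, ⟨-2, 32, 7, 10⟩, ⟨1, 32, 6, 9⟩, ⟨1, 32, 5, 10⟩, ⟨1, 31, 9, 10⟩,
   ⟨1, 31, 9, 9⟩, ⟨-1, 31, 9, 8⟩, ⟨1, 31, 8, 7⟩, ⟨1, 31, 7, 9⟩, ⟨-1, 31, 7, 8⟩, ⟨-2, 31, 6, 10⟩,
   ⟨1, 30, 8, 10⟩, ⟨1, 30, 8, 9⟩, ⟨-1, 30, 8, 8⟩, ⟨-1, 30, 7, 10⟩, ⟨-1, 29, 9, 9⟩, ⟨-1, 29, 8, 10⟩,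
   ⟨1, 29, 8, 9⟩, ⟨1, 29, 7, 10⟩, ⟨1, 29, 7, 9⟩, ⟨-1, 29, 6, 10⟩, ⟨1, 28, 9, 8⟩, ⟨-2, 28, 8, 9⟩,
   ⟨1, 28, 7, 9⟩, ⟨1, 28, 6, 10⟩, ⟨1, 28, 6, 9⟩, ⟨1, 28, 6, 8⟩, ⟨-1, 28, 5, 10⟩, ⟨1, 28, 5, 9⟩,
   ⟨-1, 27, 10, 8⟩, ⟨1, 27, 8, 8⟩, ⟨1, 27, 8, 6⟩, ⟨-2, 27, 7, 9⟩, ⟨1, 27, 7, 8⟩, ⟨-1, 27, 7, 7⟩,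
   ⟨-1, 27, 6, 9⟩, ⟨1, 27, 5, 8⟩, ⟨1, 27, 4, 9⟩, ⟨-2, 26, 9, 8⟩, ⟨-1, 26, 8, 9⟩, ⟨-1, 26, 8, 7⟩,
   ⟨1, 26, 7, 8⟩, ⟨1, 26, 7, 6⟩, ⟨-2, 26, 6, 9⟩, ⟨-1, 26, 6, 7⟩, ⟨-1, 25, 10, 7⟩, ⟨-2, 25, 8, 8⟩,
   ⟨-1, 25, 8, 7⟩, ⟨-1, 25, 7, 9⟩, ⟨1, 25, 7, 8⟩, ⟨1, 25, 6, 9⟩, ⟨-1, 25, 5, 9⟩, ⟨-1, 24, 9, 7⟩,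
   ⟨1, 24, 9, 6⟩, ⟨-2, 24, 7, 8⟩, ⟨-1, 24, 7, 7⟩, ⟨2, 24, 6, 8⟩, ⟨-1, 24, 4, 9⟩, ⟨-1, 23, 9, 6⟩,
   ⟨1, 23, 8, 6⟩, ⟨-2, 23, 6, 8⟩, ⟨-1, 23, 6, 7⟩, ⟨2, 23, 5, 8⟩, ⟨1, 22, 10, 5⟩, ⟨-2, 22, 8, 6⟩,
   ⟨1, 22, 7, 7⟩, ⟨1, 22, 7, 6⟩, ⟨1, 22, 6, 8⟩, ⟨-2, 22, 5, 8⟩, ⟨-1, 22, 5, 7⟩, ⟨2, 22, 4, 8⟩,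
   ⟨1, 21, 9, 6⟩, ⟨1, 21, 9, 5⟩, ⟨1, 21, 8, 7⟩, ⟨1, 21, 8, 6⟩, ⟨-1, 21, 7, 7⟩, ⟨-2, 21, 7, 6⟩,
   ⟨1, 21, 6, 7⟩, ⟨1, 21, 5, 8⟩, ⟨-1, 21, 5, 7⟩, ⟨-1, 21, 4, 8⟩, ⟨1, 20, 8, 6⟩, ⟨1, 20, 8, 5⟩,
   ⟨-1, 20, 8, 4⟩, ⟨2, 20, 7, 7⟩, ⟨1, 20, 7, 6⟩, ⟨1, 20, 7, 5⟩, ⟨-1, 20, 6, 7⟩, ⟨-2, 20, 6, 6⟩,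
   ⟨2, 20, 5, 7⟩, ⟨-1, 20, 5, 6⟩, ⟨-1, 20, 4, 7⟩, ⟨1, 19, 9, 5⟩, ⟨1, 19, 8, 6⟩, ⟨1, 19, 7, 6⟩,
   ⟨1, 19, 7, 5⟩, ⟨-1, 19, 7, 4⟩, ⟨2, 19, 6, 7⟩, ⟨1, 19, 6, 6⟩, ⟨1, 19, 6, 5⟩, ⟨-1, 19, 5, 7⟩,
   ⟨-2, 19, 5, 6⟩, ⟨2, 19, 4, 7⟩, ⟨-1, 19, 4, 6⟩, ⟨-1, 19, 3, 7⟩, ⟨1, 18, 8, 5⟩, ⟨1, 18, 7, 6⟩,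
   ⟨1, 18, 6, 6⟩, ⟨-1, 18, 6, 4⟩, ⟨1, 18, 5, 7⟩, ⟨1, 18, 5, 5⟩, ⟨-2, 18, 4, 6⟩, ⟨2, 18, 3, 7⟩,
   ⟨-1, 18, 3, 6⟩, ⟨-1, 18, 2, 7⟩, ⟨1, 17, 8, 4⟩, ⟨-1, 17, 8, 3⟩, ⟨1, 17, 7, 4⟩, ⟨2, 17, 5, 6⟩,
   ⟨-1, 17, 5, 4⟩, ⟨1, 17, 4, 5⟩, ⟨-1, 17, 3, 6⟩, ⟨1, 17, 2, 7⟩, ⟨-1, 16, 9, 3⟩, ⟨-1, 16, 8, 4⟩,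
   ⟨1, 16, 7, 4⟩, ⟨-1, 16, 7, 3⟩, ⟨1, 16, 6, 5⟩, ⟨1, 16, 6, 4⟩, ⟨-2, 16, 5, 6⟩, ⟨2, 16, 4, 6⟩,
   ⟨-1, 16, 4, 5⟩, ⟨-1, 15, 8, 3⟩, ⟨-1, 15, 7, 5⟩, ⟨-3, 15, 7, 4⟩, ⟨-1, 15, 6, 5⟩, ⟨1, 15, 6, 4⟩,
   ⟨-1, 15, 6, 3⟩, ⟨1, 15, 5, 5⟩, ⟨1, 15, 5, 4⟩, ⟨-2, 15, 4, 6⟩, ⟨1, 15, 4, 5⟩, ⟨2, 15, 3, 6⟩,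
   ⟨-1, 15, 3, 5⟩, ⟨-1, 14, 7, 3⟩, ⟨-1, 14, 6, 5⟩, ⟨-3, 14, 6, 4⟩, ⟨1, 14, 6, 3⟩, ⟨-1, 14, 5, 5⟩,
   ⟨-1, 14, 5, 3⟩, ⟨1, 14, 4, 4⟩, ⟨-1, 14, 3, 6⟩, ⟨-1, 14, 2, 5⟩, ⟨-1, 13, 7, 4⟩, ⟨-1, 13, 5, 5⟩,
   ⟨-1, 13, 5, 4⟩, ⟨-1, 13, 4, 5⟩, ⟨1, 13, 4, 4⟩, ⟨-1, 13, 4, 3⟩, ⟨-1, 13, 3, 5⟩, ⟨1, 13, 3, 4⟩,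
   ⟨-1, 12, 6, 4⟩, ⟨-1, 12, 4, 5⟩, ⟨1, 12, 3, 4⟩, ⟨-1, 12, 2, 5⟩, ⟨1, 11, 7, 1⟩, ⟨-1, 11, 6, 3⟩,
   ⟨1, 11, 6, 2⟩, ⟨1, 11, 5, 4⟩, ⟨1, 11, 2, 4⟩, ⟨-1, 11, 1, 5⟩, ⟨1, 10, 7, 2⟩, ⟨1, 10, 6, 1⟩,
   ⟨-1, 10, 5, 3⟩, ⟨1, 10, 5, 2⟩, ⟨1, 10, 4, 4⟩, ⟨-1, 10, 2, 4⟩, ⟨1, 9, 6, 2⟩, ⟨2, 9, 5, 3⟩,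
   ⟨1, 9, 5, 1⟩, ⟨-1, 9, 4, 3⟩, ⟨1, 9, 3, 4⟩, ⟨1, 9, 3, 3⟩, ⟨1, 9, 2, 3⟩, ⟨1, 8, 5, 2⟩,
   ⟨-1, 8, 5, 1⟩, ⟨2, 8, 4, 3⟩, ⟨1, 8, 4, 1⟩, ⟨-1, 8, 3, 3⟩, ⟨1, 8, 2, 4⟩, ⟨1, 8, 2, 3⟩,
   ⟨1, 8, 1, 3⟩, ⟨-1, 7, 4, 1⟩, ⟨1, 7, 3, 3⟩, ⟨1, 7, 3, 1⟩, ⟨1, 7, 1, 3⟩, ⟨-1, 6, 3, 2⟩,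
   ⟨-1, 6, 3, 1⟩, ⟨1, 6, 2, 1⟩, ⟨1, 6, 0, 3⟩, ⟨-1, 5, 5, 0⟩, ⟨-1, 5, 3, 2⟩, ⟨-1, 5, 2, 2⟩,
   ⟨-1, 5, 2, 1⟩, ⟨-1, 4, 4, 0⟩, ⟨-1, 4, 2, 2⟩, ⟨-1, 4, 1, 1⟩, ⟨-1, 3, 3, 0⟩, ⟨-1, 3, 1, 2⟩,
   ⟨-1, 3, 0, 1⟩, ⟨1, 2, 3, 0⟩, ⟨1, 1, 2, 0⟩, ⟨1, 0, 1, 0⟩]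

def F₂₀ : K := ofTerms
  [⟨1, 52, 7, 12⟩, ⟨1, 51, 7, 12⟩, ⟨1, 50, 7, 12⟩, ⟨1, 49, 7, 12⟩, ⟨1, 49, 7, 11⟩, ⟨1, 48, 7, 11⟩,
   ⟨1, 48, 6, 11⟩, ⟨1, 47, 7, 11⟩, ⟨1, 47, 6, 11⟩, ⟨1, 46, 7, 11⟩, ⟨1, 46, 6, 11⟩, ⟨1, 46, 6, 10⟩,
   ⟨1, 45, 7, 11⟩, ⟨1, 45, 6, 11⟩, ⟨1, 45, 6, 10⟩, ⟨1, 44, 7, 11⟩, ⟨1, 44, 6, 11⟩, ⟨2, 44, 6, 10⟩,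
   ⟨1, 43, 6, 11⟩, ⟨2, 43, 6, 10⟩, ⟨1, 42, 6, 10⟩, ⟨1, 41, 6, 10⟩, ⟨1, 41, 6, 9⟩, ⟨1, 40, 6, 9⟩,
   ⟨1, 40, 5, 9⟩, ⟨1, 39, 6, 9⟩, ⟨1, 39, 5, 9⟩, ⟨-1, 38, 7, 9⟩, ⟨1, 38, 6, 9⟩, ⟨1, 38, 5, 9⟩,
   ⟨1, 38, 5, 8⟩, ⟨-1, 37, 7, 9⟩, ⟨-1, 37, 6, 9⟩, ⟨1, 37, 5, 9⟩, ⟨1, 37, 5, 8⟩, ⟨-1, 36, 7, 9⟩,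
   ⟨-1, 36, 6, 9⟩, ⟨-1, 36, 5, 9⟩, ⟨1, 36, 5, 8⟩, ⟨-1, 35, 7, 9⟩, ⟨-1, 35, 6, 9⟩, ⟨-1, 35, 5, 9⟩,
   ⟨1, 35, 5, 8⟩, ⟨-1, 35, 4, 9⟩, ⟨-1, 34, 6, 9⟩, ⟨-1, 34, 5, 9⟩, ⟨-1, 34, 4, 9⟩, ⟨-1, 33, 7, 8⟩,
   ⟨-1, 33, 5, 9⟩, ⟨1, 33, 5, 7⟩, ⟨-1, 33, 4, 9⟩, ⟨-1, 32, 7, 8⟩, ⟨-1, 32, 6, 8⟩, ⟨-1, 32, 5, 8⟩,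
   ⟨1, 32, 5, 7⟩, ⟨-1, 32, 4, 9⟩, ⟨1, 32, 4, 7⟩, ⟨-1, 31, 7, 8⟩, ⟨-1, 31, 6, 8⟩, ⟨-1, 31, 5, 8⟩,
   ⟨1, 31, 4, 7⟩, ⟨-1, 30, 6, 8⟩, ⟨-1, 30, 6, 7⟩, ⟨-1, 30, 5, 8⟩, ⟨-1, 30, 4, 8⟩, ⟨-1, 29, 6, 7⟩,
   ⟨-1, 29, 5, 7⟩, ⟨-1, 29, 4, 8⟩, ⟨-1, 29, 3, 8⟩, ⟨1, 28, 5, 8⟩, ⟨-1, 28, 5, 7⟩, ⟨-1, 28, 4, 8⟩,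
   ⟨-1, 28, 4, 7⟩, ⟨-1, 28, 3, 8⟩, ⟨-1, 27, 4, 7⟩, ⟨-1, 27, 3, 8⟩, ⟨-1, 27, 3, 7⟩, ⟨1, 26, 5, 7⟩,
   ⟨-1, 26, 4, 6⟩, ⟨-1, 26, 3, 7⟩, ⟨-1, 25, 6, 6⟩, ⟨1, 25, 5, 7⟩, ⟨1, 25, 4, 7⟩, ⟨-1, 25, 4, 6⟩,
   ⟨1, 24, 7, 6⟩, ⟨1, 24, 5, 7⟩, ⟨-1, 24, 5, 6⟩, ⟨1, 24, 4, 7⟩, ⟨-2, 24, 4, 6⟩, ⟨1, 23, 6, 6⟩,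
   ⟨1, 23, 4, 7⟩, ⟨-1, 23, 4, 6⟩, ⟨-1, 23, 4, 5⟩, ⟨1, 22, 5, 6⟩, ⟨-1, 22, 4, 5⟩, ⟨-1, 22, 3, 6⟩,
   ⟨-1, 22, 3, 5⟩, ⟨2, 21, 4, 6⟩, ⟨-1, 21, 4, 5⟩, ⟨-1, 21, 3, 5⟩, ⟨-1, 21, 2, 6⟩, ⟨1, 20, 4, 6⟩,
   ⟨-1, 20, 4, 5⟩, ⟨1, 20, 3, 6⟩, ⟨-1, 20, 3, 5⟩, ⟨-1, 19, 4, 5⟩, ⟨-1, 19, 3, 5⟩, ⟨1, 19, 2, 6⟩,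
   ⟨1, 18, 5, 4⟩, ⟨-1, 18, 3, 5⟩, ⟨-1, 18, 3, 4⟩, ⟨1, 18, 1, 6⟩, ⟨-1, 17, 6, 4⟩, ⟨-1, 17, 5, 5⟩,
   ⟨1, 17, 4, 4⟩, ⟨-1, 17, 3, 4⟩, ⟨-1, 16, 5, 4⟩, ⟨-1, 16, 4, 5⟩, ⟨1, 16, 4, 3⟩, ⟨-1, 16, 3, 4⟩,
   ⟨-1, 15, 4, 4⟩, ⟨1, 15, 4, 3⟩, ⟨-1, 15, 3, 5⟩, ⟨-1, 15, 3, 4⟩, ⟨1, 15, 2, 4⟩, ⟨1, 14, 4, 3⟩,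
   ⟨-2, 14, 3, 4⟩, ⟨-1, 14, 2, 5⟩, ⟨1, 14, 1, 4⟩, ⟨1, 13, 4, 3⟩, ⟨-1, 13, 2, 4⟩, ⟨1, 13, 1, 3⟩,
   ⟨1, 12, 4, 2⟩, ⟨-1, 12, 1, 4⟩, ⟨1, 12, 1, 3⟩, ⟨1, 11, 4, 2⟩, ⟨-1, 11, 3, 3⟩, ⟨1, 11, 3, 2⟩,
   ⟨1, 11, 1, 3⟩, ⟨-1, 11, 0, 4⟩, ⟨1, 10, 4, 3⟩, ⟨1, 10, 4, 2⟩, ⟨1, 10, 3, 2⟩, ⟨-1, 10, 2, 3⟩,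
   ⟨1, 10, 1, 3⟩, ⟨1, 9, 3, 3⟩, ⟨1, 9, 3, 2⟩, ⟨-1, 9, 2, 2⟩, ⟨1, 9, 1, 2⟩, ⟨1, 8, 3, 1⟩,
   ⟨1, 8, 2, 3⟩, ⟨-1, 8, 2, 2⟩, ⟨1, 8, 1, 2⟩, ⟨1, 8, 0, 2⟩, ⟨1, 7, 3, 1⟩, ⟨-1, 7, 2, 2⟩,
   ⟨1, 7, 1, 3⟩, ⟨1, 7, 1, 2⟩, ⟨1, 7, 0, 2⟩, ⟨-1, 6, 2, 2⟩, ⟨1, 6, 0, 2⟩, ⟨-1, 5, 2, 1⟩,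
   ⟨1, 5, 0, 1⟩, ⟨-1, 4, 2, 1⟩, ⟨-1, 4, 1, 1⟩, ⟨1, 4, 0, 1⟩, ⟨-1, 3, 2, 1⟩, ⟨-1, 3, 1, 1⟩,
   ⟨-1, 2, 1, 1⟩, ⟨-1, 1, 1, 0⟩, ⟨-1, 0, 1, 0⟩]

def F₂₁ : K := ofTerms
  [⟨1, 53, 11, 15⟩, ⟨-1, 51, 11, 15⟩, ⟨1, 50, 11, 14⟩, ⟨1, 49, 10, 14⟩, ⟨1, 49, 10, 13⟩,
   ⟨-1, 49, 9, 14⟩, ⟨-1, 47, 11, 14⟩, ⟨-1, 47, 10, 13⟩, ⟨1, 47, 9, 14⟩, ⟨-1, 46, 10, 14⟩,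
   ⟨1, 46, 10, 13⟩, ⟨1, 46, 10, 12⟩, ⟨-1, 46, 9, 13⟩, ⟨-1, 45, 11, 12⟩, ⟨1, 45, 9, 12⟩,
   ⟨-1, 45, 8, 13⟩, ⟨-1, 44, 10, 13⟩, ⟨-1, 44, 10, 12⟩, ⟨-1, 43, 11, 11⟩, ⟨1, 43, 9, 13⟩,
   ⟨-1, 43, 9, 12⟩, ⟨-1, 42, 10, 11⟩, ⟨1, 42, 9, 11⟩, ⟨1, 42, 8, 13⟩, ⟨-2, 42, 8, 12⟩,
   ⟨-1, 41, 10, 10⟩, ⟨1, 40, 11, 12⟩, ⟨1, 40, 11, 9⟩, ⟨-2, 40, 10, 12⟩, ⟨-1, 40, 9, 10⟩,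
   ⟨1, 40, 8, 12⟩, ⟨2, 39, 10, 12⟩, ⟨-2, 39, 9, 12⟩, ⟨1, 39, 9, 11⟩, ⟨2, 39, 9, 10⟩,
   ⟨-1, 39, 8, 11⟩, ⟨-1, 39, 8, 10⟩, ⟨-1, 38, 10, 10⟩, ⟨2, 38, 9, 12⟩, ⟨1, 38, 9, 10⟩,
   ⟨2, 38, 8, 10⟩, ⟨-1, 38, 7, 11⟩, ⟨-1, 38, 7, 10⟩, ⟨1, 38, 6, 11⟩, ⟨1, 37, 11, 11⟩,
   ⟨-1, 37, 9, 11⟩, ⟨-1, 37, 9, 10⟩, ⟨1, 37, 8, 12⟩, ⟨1, 37, 8, 10⟩, ⟨1, 37, 7, 10⟩,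
   ⟨1, 36, 10, 11⟩, ⟨1, 36, 10, 10⟩, ⟨-1, 36, 10, 9⟩, ⟨-2, 36, 9, 11⟩, ⟨-1, 36, 9, 10⟩,
   ⟨2, 36, 8, 11⟩, ⟨-1, 36, 8, 10⟩, ⟨1, 36, 8, 9⟩, ⟨-1, 36, 7, 10⟩, ⟨1, 36, 6, 10⟩, ⟨1, 35, 10, 10⟩,
   ⟨1, 35, 9, 11⟩, ⟨2, 35, 9, 10⟩, ⟨-1, 35, 9, 9⟩, ⟨-1, 35, 9, 8⟩, ⟨-2, 35, 8, 11⟩, ⟨-1, 35, 8, 10⟩,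
   ⟨1, 35, 8, 9⟩, ⟨2, 35, 7, 11⟩, ⟨-2, 35, 7, 10⟩, ⟨1, 35, 5, 10⟩, ⟨1, 34, 9, 10⟩, ⟨-1, 34, 9, 8⟩,
   ⟨1, 34, 8, 11⟩, ⟨2, 34, 8, 10⟩, ⟨-2, 34, 7, 11⟩, ⟨-1, 34, 7, 9⟩, ⟨1, 33, 10, 10⟩, ⟨2, 33, 10, 9⟩,
   ⟨1, 33, 10, 7⟩, ⟨-3, 33, 9, 10⟩, ⟨1, 33, 8, 10⟩, ⟨-1, 33, 8, 8⟩, ⟨1, 33, 7, 11⟩, ⟨2, 33, 7, 10⟩,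
   ⟨-1, 33, 6, 11⟩, ⟨-1, 33, 6, 9⟩, ⟨-1, 32, 11, 9⟩, ⟨-1, 32, 10, 10⟩, ⟨1, 32, 9, 10⟩,
   ⟨2, 32, 9, 9⟩, ⟨-3, 32, 8, 10⟩, ⟨2, 32, 8, 8⟩, ⟨2, 32, 7, 10⟩, ⟨-1, 32, 7, 9⟩, ⟨-1, 32, 7, 8⟩,
   ⟨-1, 31, 10, 9⟩, ⟨-1, 31, 9, 10⟩, ⟨1, 31, 8, 10⟩, ⟨1, 31, 8, 9⟩, ⟨1, 31, 8, 8⟩, ⟨-1, 31, 7, 10⟩,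
   ⟨2, 31, 7, 8⟩, ⟨-1, 31, 6, 9⟩, ⟨-1, 31, 6, 8⟩, ⟨1, 31, 5, 9⟩, ⟨-1, 30, 11, 8⟩, ⟨1, 30, 10, 9⟩,
   ⟨-1, 30, 9, 9⟩, ⟨-1, 30, 8, 10⟩, ⟨-1, 30, 8, 9⟩, ⟨1, 30, 7, 10⟩, ⟨1, 30, 7, 9⟩, ⟨1, 30, 7, 8⟩,
   ⟨-1, 30, 6, 10⟩, ⟨1, 30, 6, 8⟩, ⟨-1, 29, 10, 9⟩, ⟨-1, 29, 10, 8⟩, ⟨1, 29, 9, 9⟩, ⟨1, 29, 9, 8⟩,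
   ⟨-1, 29, 9, 7⟩, ⟨-3, 29, 8, 9⟩, ⟨-2, 29, 8, 8⟩, ⟨-1, 29, 7, 10⟩, ⟨2, 29, 7, 9⟩, ⟨1, 29, 7, 7⟩,
   ⟨1, 29, 6, 9⟩, ⟨-1, 29, 6, 8⟩, ⟨-1, 29, 5, 10⟩, ⟨1, 29, 5, 8⟩, ⟨-1, 28, 10, 7⟩, ⟨-1, 28, 9, 9⟩,
   ⟨2, 28, 8, 9⟩, ⟨-1, 28, 8, 7⟩, ⟨-1, 28, 8, 6⟩, ⟨-2, 28, 7, 9⟩, ⟨-2, 28, 7, 8⟩, ⟨1, 28, 7, 7⟩,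
   ⟨2, 28, 6, 9⟩, ⟨-1, 28, 6, 8⟩, ⟨1, 28, 4, 8⟩, ⟨1, 27, 11, 6⟩, ⟨-1, 27, 9, 7⟩, ⟨-1, 27, 8, 9⟩,
   ⟨-1, 27, 8, 6⟩, ⟨2, 27, 7, 9⟩, ⟨-2, 27, 6, 9⟩, ⟨-1, 27, 6, 8⟩, ⟨-1, 27, 6, 7⟩, ⟨1, 26, 10, 6⟩,
   ⟨1, 26, 9, 8⟩, ⟨3, 26, 9, 7⟩, ⟨-2, 26, 8, 8⟩, ⟨-1, 26, 8, 7⟩, ⟨1, 26, 8, 6⟩, ⟨-1, 26, 7, 9⟩,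
   ⟨-1, 26, 7, 6⟩, ⟨2, 26, 6, 9⟩, ⟨1, 26, 6, 8⟩, ⟨-2, 26, 5, 9⟩, ⟨-1, 26, 5, 8⟩, ⟨-1, 26, 5, 7⟩,
   ⟨-1, 25, 10, 7⟩, ⟨-1, 25, 9, 7⟩, ⟨1, 25, 9, 6⟩, ⟨2, 25, 8, 8⟩, ⟨3, 25, 8, 7⟩, ⟨-2, 25, 7, 8⟩,
   ⟨-1, 25, 7, 7⟩, ⟨2, 25, 7, 6⟩, ⟨-1, 25, 6, 9⟩, ⟨1, 25, 6, 8⟩, ⟨-1, 25, 6, 7⟩, ⟨-1, 25, 6, 6⟩,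
   ⟨1, 25, 5, 9⟩, ⟨-1, 25, 4, 8⟩, ⟨1, 24, 10, 7⟩, ⟨-1, 24, 9, 7⟩, ⟨-1, 24, 8, 7⟩, ⟨2, 24, 7, 8⟩,
   ⟨2, 24, 7, 7⟩, ⟨1, 24, 7, 6⟩, ⟨-1, 24, 6, 8⟩, ⟨2, 24, 6, 6⟩, ⟨1, 24, 5, 8⟩, ⟨-1, 24, 5, 7⟩,
   ⟨-1, 24, 5, 6⟩, ⟨-1, 24, 3, 8⟩, ⟨-1, 23, 10, 6⟩, ⟨2, 23, 9, 7⟩, ⟨-1, 23, 8, 7⟩, ⟨-2, 23, 7, 7⟩,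
   ⟨2, 23, 6, 8⟩, ⟨2, 23, 6, 7⟩, ⟨1, 23, 6, 6⟩, ⟨-1, 23, 5, 8⟩, ⟨1, 23, 5, 6⟩, ⟨1, 23, 4, 8⟩,
   ⟨1, 22, 10, 6⟩, ⟨-1, 22, 9, 6⟩, ⟨-1, 22, 9, 4⟩, ⟨2, 22, 8, 7⟩, ⟨1, 22, 8, 6⟩, ⟨-3, 22, 7, 7⟩,
   ⟨-1, 22, 7, 6⟩, ⟨-1, 22, 6, 7⟩, ⟨1, 22, 6, 5⟩, ⟨1, 22, 5, 8⟩, ⟨2, 22, 5, 7⟩, ⟨-1, 22, 4, 8⟩,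
   ⟨1, 22, 4, 6⟩, ⟨1, 22, 3, 8⟩, ⟨1, 21, 9, 6⟩, ⟨-1, 21, 9, 5⟩, ⟨1, 21, 8, 6⟩, ⟨-1, 21, 8, 5⟩,
   ⟨-1, 21, 8, 4⟩, ⟨2, 21, 7, 7⟩, ⟨-2, 21, 6, 7⟩, ⟨-1, 21, 6, 6⟩, ⟨-1, 21, 5, 7⟩, ⟨-1, 21, 5, 6⟩,
   ⟨1, 21, 4, 8⟩, ⟨1, 21, 4, 7⟩, ⟨1, 21, 3, 6⟩, ⟨1, 20, 10, 4⟩, ⟨1, 20, 9, 5⟩, ⟨-1, 20, 8, 5⟩,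
   ⟨1, 20, 7, 6⟩, ⟨-1, 20, 7, 5⟩, ⟨-1, 20, 7, 4⟩, ⟨2, 20, 6, 7⟩, ⟨-2, 20, 5, 7⟩, ⟨-1, 20, 5, 6⟩,
   ⟨-1, 20, 5, 5⟩, ⟨-1, 20, 4, 6⟩, ⟨-1, 19, 10, 4⟩, ⟨1, 19, 9, 4⟩, ⟨4, 19, 8, 5⟩, ⟨-2, 19, 7, 6⟩,
   ⟨-1, 19, 7, 5⟩, ⟨1, 19, 7, 4⟩, ⟨1, 19, 6, 6⟩, ⟨-1, 19, 6, 4⟩, ⟨2, 19, 5, 7⟩, ⟨1, 19, 5, 6⟩,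
   ⟨-2, 19, 4, 7⟩, ⟨-1, 19, 4, 6⟩, ⟨-1, 19, 4, 5⟩, ⟨-1, 19, 3, 6⟩, ⟨-1, 18, 9, 5⟩, ⟨-1, 18, 9, 4⟩,
   ⟨-1, 18, 8, 5⟩, ⟨1, 18, 8, 4⟩, ⟨4, 18, 7, 5⟩, ⟨-2, 18, 6, 6⟩, ⟨-1, 18, 6, 5⟩, ⟨2, 18, 6, 4⟩,
   ⟨2, 18, 5, 6⟩, ⟨-1, 18, 5, 4⟩, ⟨1, 18, 4, 7⟩, ⟨1, 18, 4, 6⟩, ⟨-1, 18, 3, 6⟩, ⟨-1, 17, 8, 5⟩,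
   ⟨-1, 17, 8, 4⟩, ⟨-1, 17, 7, 5⟩, ⟨1, 17, 7, 3⟩, ⟨3, 17, 6, 5⟩, ⟨-2, 17, 5, 6⟩, ⟨2, 17, 5, 4⟩,
   ⟨1, 17, 4, 6⟩, ⟨-1, 17, 4, 4⟩, ⟨1, 17, 3, 6⟩, ⟨-1, 17, 2, 6⟩, ⟨-1, 16, 9, 4⟩, ⟨-1, 16, 7, 5⟩,
   ⟨-1, 16, 7, 4⟩, ⟨-2, 16, 6, 5⟩, ⟨1, 16, 6, 3⟩, ⟨3, 16, 5, 5⟩, ⟨-2, 16, 4, 6⟩, ⟨1, 16, 4, 4⟩,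
   ⟨1, 16, 3, 6⟩, ⟨-1, 15, 8, 4⟩, ⟨-1, 15, 8, 2⟩, ⟨-1, 15, 6, 5⟩, ⟨-1, 15, 6, 4⟩, ⟨-1, 15, 5, 5⟩,
   ⟨1, 15, 5, 3⟩, ⟨3, 15, 4, 5⟩, ⟨-2, 15, 3, 6⟩, ⟨1, 15, 3, 4⟩, ⟨1, 15, 2, 6⟩, ⟨-1, 14, 8, 3⟩,
   ⟨1, 14, 8, 2⟩, ⟨1, 14, 7, 4⟩, ⟨-2, 14, 7, 3⟩, ⟨-1, 14, 7, 2⟩, ⟨-1, 14, 6, 4⟩, ⟨-1, 14, 5, 5⟩,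
   ⟨-1, 14, 5, 4⟩, ⟨-1, 14, 4, 5⟩, ⟨-1, 14, 4, 4⟩, ⟨2, 14, 3, 5⟩, ⟨-1, 14, 2, 6⟩, ⟨1, 14, 2, 4⟩,
   ⟨1, 13, 9, 2⟩, ⟨-1, 13, 7, 3⟩, ⟨1, 13, 7, 2⟩, ⟨1, 13, 6, 4⟩, ⟨-2, 13, 6, 3⟩, ⟨-1, 13, 6, 2⟩,
   ⟨-1, 13, 5, 4⟩, ⟨-1, 13, 4, 5⟩, ⟨-1, 13, 4, 3⟩, ⟨-1, 13, 3, 4⟩, ⟨1, 12, 8, 2⟩, ⟨2, 12, 7, 3⟩,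
   ⟨-1, 12, 6, 3⟩, ⟨2, 12, 6, 2⟩, ⟨1, 12, 5, 4⟩, ⟨-1, 12, 5, 3⟩, ⟨-1, 12, 5, 2⟩, ⟨-1, 12, 3, 5⟩,
   ⟨-1, 12, 3, 3⟩, ⟨-1, 12, 2, 4⟩, ⟨1, 11, 7, 2⟩, ⟨2, 11, 6, 3⟩, ⟨-1, 11, 5, 3⟩, ⟨2, 11, 5, 2⟩,
   ⟨1, 11, 4, 4⟩, ⟨-1, 11, 4, 2⟩, ⟨1, 11, 3, 4⟩, ⟨1, 10, 6, 1⟩, ⟨1, 10, 5, 3⟩, ⟨2, 10, 4, 2⟩,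
   ⟨1, 10, 3, 4⟩, ⟨-1, 10, 3, 2⟩, ⟨1, 10, 2, 4⟩, ⟨-1, 10, 1, 4⟩, ⟨1, 9, 5, 1⟩, ⟨1, 9, 4, 3⟩,
   ⟨1, 9, 3, 2⟩, ⟨1, 9, 2, 4⟩, ⟨-1, 8, 7, 0⟩, ⟨-1, 8, 5, 2⟩, ⟨1, 8, 4, 1⟩, ⟨1, 8, 3, 3⟩,
   ⟨1, 8, 2, 2⟩, ⟨1, 8, 1, 4⟩, ⟨-1, 7, 6, 0⟩, ⟨-1, 7, 4, 2⟩, ⟨-1, 7, 4, 1⟩, ⟨1, 7, 2, 3⟩,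
   ⟨1, 7, 1, 2⟩, ⟨-1, 6, 5, 0⟩, ⟨-1, 6, 3, 2⟩, ⟨-1, 6, 3, 1⟩, ⟨-1, 6, 2, 2⟩, ⟨1, 5, 5, 0⟩,
   ⟨-1, 5, 4, 0⟩, ⟨-1, 5, 2, 2⟩, ⟨-1, 5, 2, 1⟩, ⟨-1, 5, 1, 2⟩, ⟨1, 4, 4, 0⟩, ⟨-1, 4, 3, 0⟩,
   ⟨-1, 4, 1, 2⟩, ⟨1, 3, 3, 0⟩, ⟨-1, 3, 2, 0⟩, ⟨-1, 3, 0, 2⟩, ⟨1, 2, 2, 0⟩, ⟨1, 1, 1, 0⟩,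
   ⟨1, 0, 0, 0⟩]

def F₂₂ : K := ofTerms
  [⟨1, 56, 9, 17⟩, ⟨1, 55, 11, 15⟩, ⟨-1, 55, 10, 16⟩, ⟨-1, 54, 9, 17⟩, ⟨-1, 53, 11, 15⟩,
   ⟨1, 53, 10, 16⟩, ⟨1, 53, 9, 16⟩, ⟨1, 52, 11, 14⟩, ⟨-1, 52, 10, 15⟩, ⟨1, 52, 8, 16⟩,
   ⟨-1, 52, 7, 16⟩, ⟨1, 51, 10, 14⟩, ⟨-1, 51, 9, 15⟩, ⟨-1, 51, 9, 14⟩, ⟨1, 51, 8, 15⟩,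
   ⟨-1, 50, 9, 16⟩, ⟨1, 50, 7, 16⟩, ⟨-1, 49, 11, 14⟩, ⟨1, 49, 10, 15⟩, ⟨1, 49, 9, 14⟩,
   ⟨-1, 49, 8, 16⟩, ⟨-1, 49, 8, 15⟩, ⟨-1, 49, 7, 15⟩, ⟨-1, 48, 10, 14⟩, ⟨1, 48, 9, 15⟩,
   ⟨-1, 48, 9, 14⟩, ⟨-1, 48, 9, 13⟩, ⟨1, 48, 8, 14⟩, ⟨-1, 48, 6, 15⟩, ⟨1, 47, 10, 13⟩,
   ⟨-1, 47, 8, 14⟩, ⟨-1, 47, 8, 13⟩, ⟨1, 47, 7, 14⟩, ⟨-1, 46, 10, 12⟩, ⟨1, 46, 7, 15⟩,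
   ⟨-1, 46, 7, 14⟩, ⟨1, 45, 10, 12⟩, ⟨1, 45, 9, 13⟩, ⟨-1, 45, 9, 12⟩, ⟨-1, 45, 8, 14⟩,
   ⟨1, 45, 6, 15⟩, ⟨1, 44, 9, 12⟩, ⟨1, 44, 8, 13⟩, ⟨-1, 44, 8, 12⟩, ⟨-1, 44, 7, 14⟩, ⟨1, 44, 7, 13⟩,
   ⟨-1, 43, 11, 12⟩, ⟨1, 43, 9, 14⟩, ⟨1, 43, 9, 11⟩, ⟨-1, 43, 8, 14⟩, ⟨1, 43, 6, 13⟩,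
   ⟨1, 42, 11, 12⟩, ⟨-1, 42, 10, 13⟩, ⟨-1, 42, 10, 12⟩, ⟨-1, 42, 10, 10⟩, ⟨1, 42, 9, 13⟩,
   ⟨2, 42, 8, 14⟩, ⟨1, 42, 8, 11⟩, ⟨-1, 42, 7, 14⟩, ⟨1, 42, 7, 12⟩, ⟨1, 42, 5, 13⟩, ⟨2, 41, 10, 12⟩,
   ⟨-2, 41, 9, 13⟩, ⟨-1, 41, 9, 12⟩, ⟨1, 41, 8, 13⟩, ⟨-1, 41, 8, 11⟩, ⟨2, 41, 7, 14⟩,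
   ⟨1, 41, 7, 11⟩, ⟨-1, 41, 6, 14⟩, ⟨1, 41, 6, 12⟩, ⟨1, 40, 9, 13⟩, ⟨2, 40, 9, 12⟩, ⟨-2, 40, 8, 13⟩,
   ⟨-1, 40, 7, 11⟩, ⟨1, 40, 6, 14⟩, ⟨1, 40, 6, 11⟩, ⟨-1, 39, 10, 12⟩, ⟨1, 39, 8, 13⟩,
   ⟨1, 39, 8, 12⟩, ⟨-2, 39, 7, 13⟩, ⟨1, 39, 6, 13⟩, ⟨-1, 39, 6, 11⟩, ⟨-1, 38, 9, 12⟩,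
   ⟨-1, 38, 9, 11⟩, ⟨2, 38, 8, 12⟩, ⟨1, 38, 8, 11⟩, ⟨1, 38, 7, 13⟩, ⟨-1, 38, 7, 12⟩,
   ⟨-2, 38, 6, 13⟩, ⟨1, 38, 5, 13⟩, ⟨-1, 38, 5, 11⟩, ⟨1, 37, 10, 10⟩, ⟨-1, 37, 8, 12⟩,
   ⟨-2, 37, 8, 11⟩, ⟨3, 37, 7, 12⟩, ⟨1, 37, 7, 11⟩, ⟨-1, 37, 6, 12⟩, ⟨-2, 37, 5, 13⟩,
   ⟨1, 37, 4, 13⟩, ⟨-1, 37, 4, 11⟩, ⟨1, 36, 9, 10⟩, ⟨1, 36, 8, 11⟩, ⟨-2, 36, 7, 12⟩,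
   ⟨-2, 36, 7, 11⟩, ⟨3, 36, 6, 12⟩, ⟨-1, 36, 4, 13⟩, ⟨-1, 35, 9, 11⟩, ⟨-2, 35, 9, 10⟩,
   ⟨-1, 35, 8, 12⟩, ⟨1, 35, 8, 11⟩, ⟨1, 35, 8, 10⟩, ⟨1, 35, 7, 11⟩, ⟨-2, 35, 6, 12⟩,
   ⟨-1, 35, 6, 11⟩, ⟨2, 35, 5, 12⟩, ⟨1, 34, 9, 11⟩, ⟨-1, 34, 8, 11⟩, ⟨-2, 34, 8, 10⟩,
   ⟨-1, 34, 7, 12⟩, ⟨1, 34, 7, 11⟩, ⟨1, 34, 7, 10⟩, ⟨-1, 34, 6, 11⟩, ⟨-1, 34, 5, 12⟩,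
   ⟨-1, 33, 9, 10⟩, ⟨1, 33, 8, 11⟩, ⟨-1, 33, 8, 9⟩, ⟨-1, 33, 7, 11⟩, ⟨-1, 33, 7, 10⟩,
   ⟨-1, 33, 6, 12⟩, ⟨1, 33, 6, 11⟩, ⟨-1, 33, 5, 11⟩, ⟨1, 32, 10, 9⟩, ⟨-1, 32, 8, 11⟩,
   ⟨-1, 32, 8, 10⟩, ⟨1, 32, 7, 11⟩, ⟨-1, 32, 7, 9⟩, ⟨-1, 32, 6, 11⟩, ⟨-2, 32, 6, 10⟩,
   ⟨-1, 32, 5, 12⟩, ⟨1, 32, 5, 11⟩, ⟨-1, 32, 4, 11⟩, ⟨1, 31, 9, 10⟩, ⟨1, 31, 9, 9⟩, ⟨-1, 31, 8, 9⟩,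
   ⟨-1, 31, 7, 11⟩, ⟨1, 31, 7, 9⟩, ⟨2, 31, 6, 11⟩, ⟨-1, 31, 6, 9⟩, ⟨-2, 31, 5, 10⟩, ⟨1, 31, 4, 11⟩,
   ⟨-1, 31, 3, 11⟩, ⟨1, 30, 9, 8⟩, ⟨1, 30, 8, 10⟩, ⟨1, 30, 8, 9⟩, ⟨-1, 30, 7, 10⟩, ⟨-1, 30, 7, 9⟩,
   ⟨1, 30, 6, 10⟩, ⟨1, 30, 6, 9⟩, ⟨1, 30, 5, 11⟩, ⟨-1, 30, 5, 9⟩, ⟨-1, 30, 4, 10⟩, ⟨-1, 29, 10, 7⟩,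
   ⟨1, 29, 8, 8⟩, ⟨1, 29, 7, 10⟩, ⟨2, 29, 7, 9⟩, ⟨-1, 29, 6, 10⟩, ⟨-1, 29, 6, 9⟩, ⟨1, 29, 6, 8⟩,
   ⟨1, 29, 5, 10⟩, ⟨1, 29, 5, 9⟩, ⟨1, 29, 4, 11⟩, ⟨-1, 28, 9, 7⟩, ⟨-1, 28, 8, 8⟩, ⟨1, 28, 8, 6⟩,
   ⟨-1, 28, 7, 9⟩, ⟨1, 28, 7, 8⟩, ⟨-1, 28, 7, 7⟩, ⟨2, 28, 6, 10⟩, ⟨2, 28, 6, 9⟩, ⟨-1, 28, 5, 10⟩,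
   ⟨-1, 28, 5, 9⟩, ⟨1, 28, 4, 10⟩, ⟨1, 28, 4, 9⟩, ⟨1, 28, 3, 11⟩, ⟨1, 27, 9, 8⟩, ⟨1, 27, 8, 9⟩,
   ⟨1, 27, 8, 8⟩, ⟨-1, 27, 8, 7⟩, ⟨-1, 27, 7, 9⟩, ⟨-1, 27, 7, 8⟩, ⟨1, 27, 6, 10⟩, ⟨-1, 27, 6, 9⟩,
   ⟨1, 27, 6, 8⟩, ⟨2, 27, 5, 10⟩, ⟨2, 27, 5, 9⟩, ⟨-1, 27, 4, 10⟩, ⟨1, 27, 3, 9⟩, ⟨-1, 26, 9, 8⟩,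
   ⟨1, 26, 8, 8⟩, ⟨1, 26, 7, 9⟩, ⟨1, 26, 7, 8⟩, ⟨-1, 26, 6, 9⟩, ⟨-1, 26, 6, 8⟩, ⟨1, 26, 5, 10⟩,
   ⟨1, 26, 5, 8⟩, ⟨1, 26, 2, 9⟩, ⟨1, 25, 7, 8⟩, ⟨1, 25, 6, 9⟩, ⟨1, 25, 6, 8⟩, ⟨1, 25, 6, 7⟩,
   ⟨-1, 25, 5, 9⟩, ⟨-1, 25, 5, 8⟩, ⟨1, 25, 4, 10⟩, ⟨1, 25, 4, 8⟩, ⟨-1, 24, 9, 7⟩, ⟨1, 24, 8, 5⟩,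
   ⟨-1, 24, 7, 6⟩, ⟨1, 24, 5, 8⟩, ⟨1, 24, 5, 7⟩, ⟨-1, 24, 4, 9⟩, ⟨-1, 24, 4, 8⟩, ⟨1, 24, 3, 8⟩,
   ⟨-1, 23, 8, 7⟩, ⟨1, 23, 7, 5⟩, ⟨-1, 23, 6, 8⟩, ⟨-1, 23, 6, 6⟩, ⟨-1, 23, 4, 9⟩, ⟨1, 23, 4, 8⟩,
   ⟨-1, 23, 3, 9⟩, ⟨-1, 23, 3, 8⟩, ⟨-1, 22, 8, 6⟩, ⟨-1, 22, 6, 8⟩, ⟨1, 22, 6, 7⟩, ⟨-1, 22, 5, 8⟩,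
   ⟨-1, 22, 3, 9⟩, ⟨1, 21, 9, 5⟩, ⟨-1, 21, 8, 6⟩, ⟨-1, 21, 7, 6⟩, ⟨-1, 21, 6, 7⟩, ⟨-2, 21, 5, 8⟩,
   ⟨1, 21, 5, 7⟩, ⟨-1, 21, 4, 8⟩, ⟨-1, 21, 2, 9⟩, ⟨1, 20, 8, 5⟩, ⟨-1, 20, 7, 6⟩, ⟨-1, 20, 6, 7⟩,
   ⟨-1, 20, 6, 6⟩, ⟨-1, 20, 5, 7⟩, ⟨-2, 20, 4, 8⟩, ⟨1, 20, 4, 7⟩, ⟨1, 19, 7, 5⟩, ⟨-1, 19, 6, 6⟩,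
   ⟨-1, 19, 5, 7⟩, ⟨-1, 19, 5, 6⟩, ⟨-1, 19, 3, 8⟩, ⟨1, 18, 6, 5⟩, ⟨-1, 18, 4, 6⟩, ⟨-1, 17, 5, 5⟩,
   ⟨1, 17, 4, 6⟩, ⟨2, 17, 3, 7⟩, ⟨-1, 17, 3, 6⟩, ⟨1, 16, 7, 4⟩, ⟨-1, 16, 7, 3⟩, ⟨1, 16, 6, 4⟩,
   ⟨1, 16, 5, 6⟩, ⟨2, 16, 4, 6⟩, ⟨-1, 16, 4, 5⟩, ⟨1, 16, 3, 6⟩, ⟨2, 16, 2, 7⟩, ⟨-1, 16, 2, 6⟩,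
   ⟨1, 15, 6, 4⟩, ⟨-1, 15, 6, 3⟩, ⟨1, 15, 5, 4⟩, ⟨1, 15, 4, 6⟩, ⟨2, 15, 3, 6⟩, ⟨-1, 15, 3, 5⟩,
   ⟨1, 15, 1, 7⟩, ⟨1, 14, 6, 4⟩, ⟨1, 14, 5, 5⟩, ⟨1, 14, 5, 4⟩, ⟨-1, 14, 5, 3⟩, ⟨1, 14, 4, 4⟩,
   ⟨1, 14, 3, 6⟩, ⟨2, 14, 2, 6⟩, ⟨1, 13, 5, 4⟩, ⟨1, 13, 4, 5⟩, ⟨-1, 13, 4, 4⟩, ⟨-1, 12, 6, 2⟩,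
   ⟨1, 12, 5, 3⟩, ⟨1, 12, 4, 4⟩, ⟨-1, 12, 3, 4⟩, ⟨-1, 12, 2, 5⟩, ⟨-1, 11, 5, 2⟩, ⟨-1, 11, 4, 4⟩,
   ⟨1, 11, 4, 3⟩, ⟨-1, 11, 2, 5⟩, ⟨-1, 11, 2, 4⟩, ⟨-1, 11, 1, 5⟩, ⟨-1, 10, 4, 2⟩, ⟨-2, 10, 3, 4⟩,
   ⟨1, 10, 3, 3⟩, ⟨-1, 10, 1, 5⟩, ⟨-1, 10, 0, 5⟩, ⟨-1, 9, 5, 2⟩, ⟨-1, 9, 4, 3⟩, ⟨-2, 9, 2, 4⟩,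
   ⟨-1, 8, 4, 2⟩, ⟨-1, 8, 3, 3⟩, ⟨-1, 8, 1, 4⟩, ⟨1, 6, 2, 2⟩, ⟨1, 6, 1, 3⟩, ⟨1, 5, 4, 0⟩,
   ⟨1, 5, 2, 2⟩, ⟨1, 5, 1, 2⟩, ⟨1, 5, 0, 3⟩, ⟨1, 4, 3, 0⟩, ⟨1, 4, 1, 2⟩, ⟨1, 3, 2, 0⟩, ⟨1, 3, 0, 2⟩,
   ⟨-1, 2, 2, 0⟩, ⟨-1, 1, 1, 0⟩, ⟨-1, 0, 0, 0⟩]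

def F₂₃ : K := ofTerms
  [⟨1, 62, 9, 15⟩, ⟨1, 61, 9, 15⟩, ⟨1, 58, 9, 14⟩, ⟨1, 57, 9, 14⟩, ⟨1, 57, 8, 14⟩, ⟨1, 56, 9, 14⟩,
   ⟨1, 56, 8, 14⟩, ⟨1, 55, 8, 14⟩, ⟨1, 54, 8, 13⟩, ⟨2, 53, 8, 13⟩, ⟨1, 52, 8, 13⟩, ⟨-1, 51, 9, 12⟩,
   ⟨-1, 50, 9, 12⟩, ⟨-1, 49, 9, 12⟩, ⟨1, 49, 8, 12⟩, ⟨-1, 48, 9, 12⟩, ⟨-1, 48, 9, 11⟩,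
   ⟨1, 48, 8, 12⟩, ⟨1, 48, 7, 12⟩, ⟨-1, 48, 6, 12⟩, ⟨-1, 47, 9, 12⟩, ⟨-1, 47, 9, 11⟩,
   ⟨-1, 47, 8, 11⟩, ⟨1, 47, 7, 12⟩, ⟨-1, 47, 6, 12⟩, ⟨-1, 46, 9, 11⟩, ⟨-2, 46, 8, 12⟩,
   ⟨-1, 46, 8, 11⟩, ⟨-1, 46, 6, 12⟩, ⟨-1, 45, 9, 11⟩, ⟨-1, 45, 8, 11⟩, ⟨-2, 45, 7, 12⟩,
   ⟨2, 45, 7, 11⟩, ⟨-1, 45, 6, 12⟩, ⟨-1, 45, 6, 11⟩, ⟨-1, 44, 9, 11⟩, ⟨-1, 44, 8, 11⟩,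
   ⟨2, 44, 7, 11⟩, ⟨-1, 44, 6, 12⟩, ⟨-1, 44, 6, 11⟩, ⟨-1, 44, 5, 11⟩, ⟨-1, 43, 9, 11⟩,
   ⟨-1, 43, 8, 11⟩, ⟨-1, 43, 8, 10⟩, ⟨1, 43, 7, 11⟩, ⟨-1, 43, 6, 11⟩, ⟨-1, 43, 5, 11⟩,
   ⟨-1, 42, 8, 11⟩, ⟨-2, 42, 8, 10⟩, ⟨1, 42, 8, 9⟩, ⟨1, 42, 7, 10⟩, ⟨-1, 42, 6, 11⟩,
   ⟨-1, 42, 5, 11⟩, ⟨-2, 41, 8, 10⟩, ⟨1, 41, 8, 9⟩, ⟨-1, 41, 7, 11⟩, ⟨1, 41, 7, 10⟩, ⟨1, 41, 7, 9⟩,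
   ⟨-1, 41, 6, 11⟩, ⟨1, 41, 6, 10⟩, ⟨-1, 41, 5, 11⟩, ⟨-2, 40, 8, 10⟩, ⟨2, 40, 7, 10⟩, ⟨1, 40, 7, 9⟩,
   ⟨-1, 40, 6, 11⟩, ⟨1, 40, 6, 10⟩, ⟨-1, 40, 5, 11⟩, ⟨-1, 40, 5, 10⟩, ⟨-1, 39, 8, 10⟩,
   ⟨-1, 39, 8, 9⟩, ⟨1, 39, 7, 10⟩, ⟨1, 39, 7, 8⟩, ⟨2, 39, 6, 10⟩, ⟨-1, 39, 5, 11⟩, ⟨-2, 39, 5, 10⟩,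
   ⟨1, 39, 5, 9⟩, ⟨-1, 38, 8, 9⟩, ⟨-1, 38, 7, 9⟩, ⟨1, 38, 7, 8⟩, ⟨1, 38, 6, 10⟩, ⟨-2, 38, 5, 10⟩,
   ⟨1, 38, 5, 9⟩, ⟨1, 38, 4, 9⟩, ⟨1, 37, 9, 9⟩, ⟨1, 37, 8, 10⟩, ⟨-1, 37, 8, 9⟩, ⟨-1, 37, 7, 9⟩,
   ⟨1, 37, 7, 8⟩, ⟨1, 37, 6, 9⟩, ⟨-2, 37, 5, 10⟩, ⟨1, 37, 4, 9⟩, ⟨1, 36, 9, 9⟩, ⟨1, 36, 7, 10⟩,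
   ⟨-1, 36, 7, 9⟩, ⟨1, 36, 7, 8⟩, ⟨2, 36, 6, 9⟩, ⟨-1, 36, 6, 8⟩, ⟨-1, 36, 5, 10⟩, ⟨-1, 36, 5, 9⟩,
   ⟨1, 36, 4, 8⟩, ⟨1, 35, 6, 10⟩, ⟨2, 35, 6, 9⟩, ⟨-1, 35, 6, 8⟩, ⟨-1, 35, 5, 9⟩, ⟨-1, 35, 5, 8⟩,
   ⟨-1, 35, 4, 9⟩, ⟨1, 35, 4, 8⟩, ⟨-1, 34, 7, 8⟩, ⟨1, 34, 7, 7⟩, ⟨3, 34, 6, 9⟩, ⟨1, 34, 5, 10⟩,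
   ⟨-1, 34, 5, 9⟩, ⟨-1, 34, 5, 8⟩, ⟨-1, 34, 4, 9⟩, ⟨1, 34, 4, 8⟩, ⟨1, 33, 8, 9⟩, ⟨-2, 33, 7, 8⟩,
   ⟨2, 33, 7, 7⟩, ⟨1, 33, 6, 9⟩, ⟨1, 33, 6, 8⟩, ⟨1, 33, 6, 7⟩, ⟨-1, 33, 5, 7⟩, ⟨-1, 33, 4, 9⟩,
   ⟨1, 33, 4, 8⟩, ⟨1, 32, 7, 9⟩, ⟨-2, 32, 7, 8⟩, ⟨1, 32, 7, 7⟩, ⟨1, 32, 6, 8⟩, ⟨2, 32, 6, 7⟩,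
   ⟨1, 32, 5, 8⟩, ⟨-1, 32, 5, 7⟩, ⟨-1, 31, 8, 7⟩, ⟨-2, 31, 7, 8⟩, ⟨1, 31, 6, 9⟩, ⟨1, 31, 6, 8⟩,
   ⟨1, 31, 6, 7⟩, ⟨1, 31, 6, 6⟩, ⟨1, 31, 5, 8⟩, ⟨-1, 31, 5, 7⟩, ⟨-1, 31, 4, 8⟩, ⟨1, 31, 4, 7⟩,
   ⟨1, 31, 3, 9⟩, ⟨-1, 30, 8, 7⟩, ⟨-1, 30, 7, 8⟩, ⟨-2, 30, 7, 7⟩, ⟨-1, 30, 6, 8⟩, ⟨2, 30, 6, 6⟩,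
   ⟨1, 30, 5, 9⟩, ⟨1, 30, 5, 8⟩, ⟨-1, 30, 5, 7⟩, ⟨-2, 30, 4, 8⟩, ⟨2, 30, 4, 7⟩, ⟨1, 30, 3, 9⟩,
   ⟨1, 30, 3, 7⟩, ⟨-2, 29, 7, 7⟩, ⟨-2, 29, 6, 7⟩, ⟨2, 29, 6, 6⟩, ⟨-1, 29, 5, 8⟩, ⟨1, 29, 4, 9⟩,
   ⟨-2, 29, 4, 8⟩, ⟨1, 29, 4, 7⟩, ⟨2, 29, 3, 7⟩, ⟨1, 28, 8, 7⟩, ⟨-1, 28, 7, 7⟩, ⟨-2, 28, 6, 7⟩,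
   ⟨2, 28, 6, 6⟩, ⟨-1, 28, 5, 7⟩, ⟨-1, 28, 5, 6⟩, ⟨-2, 28, 4, 8⟩, ⟨1, 28, 3, 7⟩, ⟨1, 28, 3, 6⟩,
   ⟨-1, 27, 6, 7⟩, ⟨1, 27, 6, 6⟩, ⟨-2, 27, 5, 6⟩, ⟨-1, 27, 4, 8⟩, ⟨-2, 27, 4, 7⟩, ⟨-1, 27, 4, 6⟩,
   ⟨2, 27, 3, 6⟩, ⟨-1, 26, 8, 7⟩, ⟨-1, 26, 7, 7⟩, ⟨1, 26, 6, 5⟩, ⟨2, 26, 5, 7⟩, ⟨-1, 26, 5, 6⟩,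
   ⟨-2, 26, 4, 7⟩, ⟨-2, 26, 4, 6⟩, ⟨-2, 26, 3, 7⟩, ⟨2, 26, 3, 6⟩, ⟨-1, 25, 7, 7⟩, ⟨-1, 25, 6, 7⟩,
   ⟨2, 25, 6, 5⟩, ⟨2, 25, 5, 7⟩, ⟨1, 25, 5, 5⟩, ⟨-1, 25, 4, 7⟩, ⟨-1, 25, 4, 6⟩, ⟨-1, 25, 4, 5⟩,
   ⟨-2, 25, 3, 7⟩, ⟨2, 25, 3, 6⟩, ⟨-1, 25, 2, 7⟩, ⟨-1, 24, 6, 7⟩, ⟨-1, 24, 6, 6⟩, ⟨2, 24, 6, 5⟩,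
   ⟨2, 24, 5, 6⟩, ⟨2, 24, 5, 5⟩, ⟨-2, 24, 4, 5⟩, ⟨-1, 24, 3, 7⟩, ⟨1, 24, 3, 6⟩, ⟨-1, 24, 2, 7⟩,
   ⟨-1, 23, 6, 6⟩, ⟨1, 23, 6, 5⟩, ⟨-1, 23, 5, 7⟩, ⟨1, 23, 5, 6⟩, ⟨2, 23, 5, 5⟩, ⟨-1, 23, 4, 7⟩,
   ⟨2, 23, 4, 6⟩, ⟨-2, 23, 4, 5⟩, ⟨1, 23, 3, 5⟩, ⟨-1, 22, 7, 5⟩, ⟨-1, 22, 6, 6⟩, ⟨1, 22, 5, 5⟩,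
   ⟨1, 22, 5, 4⟩, ⟨-1, 22, 4, 7⟩, ⟨1, 22, 4, 6⟩, ⟨-2, 22, 4, 5⟩, ⟨-1, 22, 3, 7⟩, ⟨2, 22, 3, 5⟩,
   ⟨1, 22, 2, 7⟩, ⟨1, 22, 2, 5⟩, ⟨-2, 21, 6, 5⟩, ⟨2, 21, 5, 4⟩, ⟨-1, 21, 4, 5⟩, ⟨-1, 21, 3, 7⟩,
   ⟨-1, 21, 3, 6⟩, ⟨2, 21, 3, 5⟩, ⟨2, 21, 2, 5⟩, ⟨1, 20, 7, 5⟩, ⟨1, 20, 5, 6⟩, ⟨-2, 20, 5, 5⟩,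
   ⟨2, 20, 5, 4⟩, ⟨-1, 20, 4, 5⟩, ⟨-1, 20, 4, 4⟩, ⟨-1, 20, 3, 6⟩, ⟨1, 20, 3, 5⟩, ⟨-1, 20, 2, 7⟩,
   ⟨2, 20, 2, 5⟩, ⟨1, 19, 7, 5⟩, ⟨1, 19, 6, 5⟩, ⟨1, 19, 5, 4⟩, ⟨1, 19, 4, 6⟩, ⟨-2, 19, 4, 5⟩,
   ⟨-2, 19, 4, 4⟩, ⟨-1, 19, 3, 6⟩, ⟨-1, 19, 3, 4⟩, ⟨1, 19, 2, 5⟩, ⟨1, 19, 2, 4⟩, ⟨1, 18, 6, 5⟩,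
   ⟨1, 18, 5, 5⟩, ⟨1, 18, 4, 5⟩, ⟨-2, 18, 4, 4⟩, ⟨-2, 18, 3, 5⟩, ⟨-2, 18, 3, 4⟩, ⟨2, 18, 2, 4⟩,
   ⟨1, 17, 5, 5⟩, ⟨1, 17, 5, 3⟩, ⟨2, 17, 4, 5⟩, ⟨-1, 17, 4, 4⟩, ⟨-2, 17, 3, 4⟩, ⟨-2, 17, 2, 5⟩,
   ⟨2, 17, 2, 4⟩, ⟨1, 16, 5, 3⟩, ⟨2, 16, 4, 5⟩, ⟨1, 16, 4, 3⟩, ⟨1, 16, 3, 5⟩, ⟨-1, 16, 3, 4⟩,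
   ⟨-1, 16, 3, 3⟩, ⟨1, 16, 2, 4⟩, ⟨-1, 16, 1, 5⟩, ⟨-1, 15, 5, 4⟩, ⟨1, 15, 5, 3⟩, ⟨1, 15, 4, 4⟩,
   ⟨1, 15, 4, 3⟩, ⟨1, 15, 3, 5⟩, ⟨-2, 15, 3, 3⟩, ⟨1, 15, 2, 5⟩, ⟨-1, 14, 4, 4⟩, ⟨1, 14, 4, 3⟩,
   ⟨1, 14, 3, 4⟩, ⟨-2, 14, 3, 3⟩, ⟨1, 14, 2, 5⟩, ⟨1, 14, 2, 3⟩, ⟨1, 14, 1, 5⟩, ⟨-1, 13, 6, 3⟩,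
   ⟨-1, 13, 5, 3⟩, ⟨1, 13, 4, 2⟩, ⟨-1, 13, 3, 4⟩, ⟨-1, 13, 3, 3⟩, ⟨1, 13, 2, 3⟩, ⟨1, 13, 1, 5⟩,
   ⟨1, 13, 1, 3⟩, ⟨-2, 12, 5, 3⟩, ⟨-1, 12, 4, 3⟩, ⟨2, 12, 4, 2⟩, ⟨-1, 12, 3, 3⟩, ⟨-1, 12, 2, 4⟩,
   ⟨1, 12, 2, 3⟩, ⟨1, 12, 1, 3⟩, ⟨-2, 11, 4, 3⟩, ⟨1, 11, 4, 2⟩, ⟨-1, 11, 3, 3⟩, ⟨-1, 11, 3, 2⟩,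
   ⟨1, 11, 1, 3⟩, ⟨-2, 10, 3, 3⟩, ⟨-1, 10, 3, 2⟩, ⟨-1, 10, 2, 3⟩, ⟨-1, 10, 2, 2⟩, ⟨1, 10, 1, 2⟩,
   ⟨-1, 9, 3, 2⟩, ⟨-2, 9, 2, 3⟩, ⟨-1, 9, 2, 2⟩, ⟨-1, 9, 1, 3⟩, ⟨2, 9, 1, 2⟩, ⟨1, 8, 4, 1⟩,
   ⟨-1, 8, 2, 2⟩, ⟨-2, 8, 1, 3⟩, ⟨1, 8, 1, 2⟩, ⟨1, 7, 4, 1⟩, ⟨1, 7, 3, 1⟩, ⟨-1, 7, 2, 1⟩,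
   ⟨-1, 7, 0, 3⟩, ⟨1, 6, 4, 1⟩, ⟨1, 6, 3, 1⟩, ⟨-1, 6, 2, 1⟩, ⟨1, 5, 3, 1⟩, ⟨1, 5, 1, 1⟩,
   ⟨1, 4, 3, 0⟩, ⟨1, 4, 1, 1⟩, ⟨1, 4, 0, 1⟩, ⟨1, 3, 3, 0⟩, ⟨1, 3, 1, 1⟩, ⟨1, 3, 0, 1⟩, ⟨1, 2, 0, 1⟩,
   ⟨1, 1, 0, 0⟩, ⟨1, 0, 0, 0⟩]

def F₂₄ : K := ofTerms
  [⟨1, 63, 9, 15⟩, ⟨1, 62, 9, 15⟩, ⟨1, 60, 6, 15⟩, ⟨1, 59, 9, 14⟩, ⟨1, 59, 6, 15⟩, ⟨1, 58, 9, 14⟩,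
   ⟨1, 58, 8, 14⟩, ⟨-1, 58, 7, 14⟩, ⟨1, 57, 9, 14⟩, ⟨1, 57, 8, 14⟩, ⟨-1, 57, 7, 14⟩, ⟨1, 56, 8, 14⟩,
   ⟨1, 56, 8, 13⟩, ⟨1, 56, 6, 14⟩, ⟨2, 55, 8, 13⟩, ⟨1, 55, 6, 14⟩, ⟨1, 55, 5, 14⟩, ⟨1, 54, 8, 13⟩,
   ⟨-1, 54, 7, 13⟩, ⟨1, 54, 6, 14⟩, ⟨1, 54, 5, 14⟩, ⟨-1, 53, 7, 13⟩, ⟨-1, 53, 6, 13⟩,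
   ⟨1, 53, 5, 14⟩, ⟨1, 53, 5, 13⟩, ⟨1, 52, 8, 12⟩, ⟨-1, 52, 7, 13⟩, ⟨-1, 52, 6, 13⟩, ⟨2, 52, 5, 13⟩,
   ⟨1, 51, 8, 12⟩, ⟨1, 51, 7, 12⟩, ⟨-1, 51, 6, 13⟩, ⟨-1, 51, 6, 12⟩, ⟨1, 51, 5, 13⟩, ⟨1, 50, 8, 12⟩,
   ⟨1, 50, 7, 12⟩, ⟨-2, 50, 6, 12⟩, ⟨1, 49, 7, 12⟩, ⟨1, 49, 7, 11⟩, ⟨-2, 49, 6, 12⟩, ⟨1, 49, 5, 12⟩,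
   ⟨-1, 48, 9, 12⟩, ⟨-1, 48, 8, 12⟩, ⟨2, 48, 7, 11⟩, ⟨-1, 48, 6, 12⟩, ⟨1, 48, 5, 12⟩,
   ⟨1, 48, 4, 12⟩, ⟨-2, 47, 8, 12⟩, ⟨-1, 47, 7, 12⟩, ⟨2, 47, 7, 11⟩, ⟨-1, 47, 6, 12⟩,
   ⟨-1, 47, 6, 11⟩, ⟨1, 47, 5, 12⟩, ⟨1, 47, 4, 12⟩, ⟨-2, 46, 7, 12⟩, ⟨1, 46, 7, 11⟩,
   ⟨-1, 46, 6, 12⟩, ⟨-2, 46, 6, 11⟩, ⟨-1, 46, 5, 11⟩, ⟨1, 46, 4, 12⟩, ⟨1, 46, 4, 11⟩,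
   ⟨1, 45, 7, 10⟩, ⟨-2, 45, 6, 12⟩, ⟨-2, 45, 6, 11⟩, ⟨-1, 45, 5, 12⟩, ⟨-2, 45, 5, 11⟩,
   ⟨2, 45, 4, 11⟩, ⟨2, 44, 7, 10⟩, ⟨-1, 44, 6, 11⟩, ⟨1, 44, 6, 10⟩, ⟨-2, 44, 5, 12⟩,
   ⟨-2, 44, 5, 11⟩, ⟨-1, 44, 5, 10⟩, ⟨-1, 44, 4, 12⟩, ⟨2, 44, 4, 11⟩, ⟨2, 43, 7, 10⟩,
   ⟨2, 43, 6, 10⟩, ⟨-1, 43, 5, 11⟩, ⟨-2, 43, 5, 10⟩, ⟨-2, 43, 4, 12⟩, ⟨1, 43, 4, 11⟩,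
   ⟨-1, 42, 7, 11⟩, ⟨1, 42, 7, 10⟩, ⟨1, 42, 6, 11⟩, ⟨2, 42, 6, 10⟩, ⟨1, 42, 6, 9⟩, ⟨-2, 42, 5, 10⟩,
   ⟨1, 42, 4, 10⟩, ⟨-1, 42, 3, 12⟩, ⟨-1, 41, 8, 10⟩, ⟨-1, 41, 6, 11⟩, ⟨1, 41, 6, 10⟩, ⟨2, 41, 6, 9⟩,
   ⟨1, 41, 5, 11⟩, ⟨-2, 41, 5, 10⟩, ⟨2, 41, 4, 10⟩, ⟨1, 41, 3, 10⟩, ⟨-2, 40, 7, 10⟩, ⟨2, 40, 6, 9⟩,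
   ⟨-1, 40, 5, 11⟩, ⟨-1, 40, 5, 10⟩, ⟨2, 40, 4, 10⟩, ⟨2, 40, 3, 10⟩, ⟨1, 39, 8, 10⟩,
   ⟨-2, 39, 6, 10⟩, ⟨2, 39, 6, 9⟩, ⟨-1, 39, 5, 10⟩, ⟨-1, 39, 5, 9⟩, ⟨-1, 39, 4, 11⟩, ⟨1, 39, 4, 10⟩,
   ⟨2, 39, 3, 10⟩, ⟨1, 39, 3, 9⟩, ⟨1, 38, 8, 10⟩, ⟨1, 38, 7, 10⟩, ⟨1, 38, 6, 9⟩, ⟨-2, 38, 5, 10⟩,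
   ⟨-2, 38, 5, 9⟩, ⟨-1, 38, 4, 9⟩, ⟨1, 38, 3, 10⟩, ⟨2, 38, 3, 9⟩, ⟨1, 37, 7, 10⟩, ⟨1, 37, 6, 10⟩,
   ⟨1, 37, 6, 8⟩, ⟨1, 37, 5, 10⟩, ⟨-1, 37, 5, 9⟩, ⟨-2, 37, 4, 10⟩, ⟨-2, 37, 4, 9⟩, ⟨2, 37, 3, 9⟩,
   ⟨1, 36, 6, 10⟩, ⟨2, 36, 6, 8⟩, ⟨2, 36, 5, 10⟩, ⟨1, 36, 5, 8⟩, ⟨-1, 36, 4, 9⟩, ⟨-1, 36, 4, 8⟩,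
   ⟨-2, 36, 3, 10⟩, ⟨2, 36, 3, 9⟩, ⟨-1, 35, 6, 9⟩, ⟨1, 35, 6, 8⟩, ⟨2, 35, 5, 10⟩, ⟨2, 35, 5, 9⟩,
   ⟨2, 35, 5, 8⟩, ⟨1, 35, 4, 10⟩, ⟨-1, 35, 4, 8⟩, ⟨1, 35, 3, 9⟩, ⟨-1, 35, 2, 10⟩, ⟨-1, 34, 7, 8⟩,
   ⟨-1, 34, 6, 9⟩, ⟨1, 34, 5, 9⟩, ⟨1, 34, 5, 8⟩, ⟨1, 34, 5, 7⟩, ⟨1, 34, 4, 10⟩, ⟨2, 34, 4, 9⟩,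
   ⟨-1, 34, 4, 8⟩, ⟨1, 34, 3, 10⟩, ⟨1, 34, 3, 8⟩, ⟨-1, 33, 7, 8⟩, ⟨-1, 33, 6, 9⟩, ⟨-2, 33, 6, 8⟩,
   ⟨1, 33, 5, 7⟩, ⟨1, 33, 4, 9⟩, ⟨-1, 33, 4, 8⟩, ⟨1, 33, 3, 10⟩, ⟨2, 33, 3, 8⟩, ⟨1, 33, 2, 10⟩,
   ⟨1, 33, 2, 8⟩, ⟨-2, 32, 6, 8⟩, ⟨-2, 32, 5, 8⟩, ⟨1, 32, 5, 7⟩, ⟨-1, 32, 3, 9⟩, ⟨1, 32, 3, 8⟩,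
   ⟨1, 32, 2, 10⟩, ⟨2, 32, 2, 8⟩, ⟨1, 31, 7, 8⟩, ⟨-1, 31, 6, 8⟩, ⟨1, 31, 5, 9⟩, ⟨-2, 31, 5, 8⟩,
   ⟨1, 31, 5, 7⟩, ⟨-1, 31, 4, 8⟩, ⟨-1, 31, 4, 7⟩, ⟨-1, 31, 3, 9⟩, ⟨1, 31, 2, 8⟩, ⟨1, 31, 2, 7⟩,
   ⟨-1, 30, 5, 8⟩, ⟨1, 30, 4, 9⟩, ⟨-1, 30, 4, 7⟩, ⟨-1, 30, 3, 9⟩, ⟨-2, 30, 3, 8⟩, ⟨-1, 30, 3, 7⟩,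
   ⟨1, 30, 2, 7⟩, ⟨-1, 29, 7, 8⟩, ⟨-1, 29, 6, 8⟩, ⟨-1, 29, 5, 7⟩, ⟨1, 29, 5, 6⟩, ⟨2, 29, 4, 8⟩,
   ⟨-2, 29, 3, 8⟩, ⟨-1, 29, 3, 7⟩, ⟨-2, 29, 2, 8⟩, ⟨1, 29, 2, 7⟩, ⟨-1, 28, 6, 8⟩, ⟨-1, 28, 5, 8⟩,
   ⟨-2, 28, 5, 7⟩, ⟨1, 28, 5, 6⟩, ⟨2, 28, 4, 8⟩, ⟨1, 28, 4, 7⟩, ⟨1, 28, 4, 6⟩, ⟨-1, 28, 3, 8⟩,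
   ⟨-2, 28, 2, 8⟩, ⟨1, 28, 2, 7⟩, ⟨-1, 28, 1, 8⟩, ⟨-1, 27, 5, 8⟩, ⟨-2, 27, 5, 7⟩, ⟨1, 27, 4, 7⟩,
   ⟨1, 27, 4, 6⟩, ⟨1, 27, 3, 7⟩, ⟨-1, 27, 2, 8⟩, ⟨-1, 27, 1, 8⟩, ⟨-2, 26, 5, 7⟩, ⟨-1, 26, 5, 6⟩,
   ⟨-1, 26, 4, 8⟩, ⟨1, 26, 4, 7⟩, ⟨-1, 26, 3, 8⟩, ⟨1, 26, 3, 7⟩, ⟨-1, 26, 2, 7⟩, ⟨1, 26, 2, 6⟩,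
   ⟨-1, 25, 5, 7⟩, ⟨-1, 25, 5, 6⟩, ⟨-1, 25, 4, 7⟩, ⟨-1, 25, 4, 6⟩, ⟨-1, 25, 3, 8⟩, ⟨1, 25, 3, 7⟩,
   ⟨-1, 25, 2, 8⟩, ⟨-2, 25, 2, 7⟩, ⟨1, 25, 2, 6⟩, ⟨1, 25, 1, 8⟩, ⟨1, 25, 1, 6⟩, ⟨1, 24, 6, 6⟩,
   ⟨-1, 24, 5, 6⟩, ⟨-1, 24, 4, 6⟩, ⟨-1, 24, 3, 7⟩, ⟨1, 24, 3, 6⟩, ⟨-1, 24, 2, 8⟩, ⟨-2, 24, 2, 7⟩,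
   ⟨1, 24, 1, 6⟩, ⟨1, 23, 6, 6⟩, ⟨-1, 23, 4, 6⟩, ⟨2, 23, 3, 6⟩, ⟨-2, 23, 2, 7⟩, ⟨-1, 23, 2, 6⟩,
   ⟨-1, 23, 1, 8⟩, ⟨-1, 22, 4, 5⟩, ⟨2, 22, 3, 6⟩, ⟨-1, 22, 2, 7⟩, ⟨-1, 22, 2, 6⟩, ⟨-1, 22, 1, 6⟩,
   ⟨-2, 21, 4, 5⟩, ⟨3, 21, 3, 6⟩, ⟨1, 21, 3, 5⟩, ⟨-1, 21, 2, 6⟩, ⟨-1, 21, 1, 6⟩, ⟨1, 20, 5, 6⟩,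
   ⟨-2, 20, 4, 5⟩, ⟨1, 20, 3, 6⟩, ⟨1, 20, 3, 5⟩, ⟨1, 20, 2, 5⟩, ⟨-1, 20, 1, 6⟩, ⟨1, 19, 4, 6⟩,
   ⟨-2, 19, 4, 5⟩, ⟨-1, 19, 4, 4⟩, ⟨2, 19, 3, 5⟩, ⟨1, 19, 2, 5⟩, ⟨-1, 19, 1, 5⟩, ⟨-1, 18, 4, 5⟩,
   ⟨-1, 18, 4, 4⟩, ⟨1, 18, 3, 6⟩, ⟨1, 18, 3, 5⟩, ⟨-1, 18, 3, 4⟩, ⟨2, 18, 2, 5⟩, ⟨-2, 18, 1, 5⟩,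
   ⟨1, 18, 0, 6⟩, ⟨-1, 17, 4, 4⟩, ⟨-1, 17, 3, 4⟩, ⟨1, 17, 2, 6⟩, ⟨1, 17, 2, 5⟩, ⟨-2, 17, 1, 5⟩,
   ⟨1, 17, 0, 6⟩, ⟨1, 16, 4, 5⟩, ⟨-1, 16, 4, 4⟩, ⟨-1, 16, 3, 4⟩, ⟨2, 16, 2, 4⟩, ⟨1, 16, 1, 6⟩,
   ⟨-2, 16, 1, 5⟩, ⟨-1, 16, 1, 4⟩, ⟨-1, 15, 4, 4⟩, ⟨1, 15, 3, 5⟩, ⟨-1, 15, 3, 4⟩, ⟨2, 15, 2, 4⟩,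
   ⟨-1, 15, 1, 5⟩, ⟨-1, 15, 1, 4⟩, ⟨-1, 15, 0, 4⟩, ⟨-1, 14, 4, 4⟩, ⟨-1, 14, 3, 4⟩, ⟨-1, 14, 3, 3⟩,
   ⟨1, 14, 2, 5⟩, ⟨1, 14, 2, 4⟩, ⟨-1, 14, 1, 4⟩, ⟨-1, 14, 0, 4⟩, ⟨-1, 13, 3, 4⟩, ⟨-1, 13, 3, 3⟩,
   ⟨1, 13, 1, 5⟩, ⟨-1, 13, 1, 4⟩, ⟨-1, 13, 0, 4⟩, ⟨-1, 12, 3, 3⟩, ⟨-1, 12, 2, 4⟩, ⟨1, 12, 2, 3⟩,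
   ⟨-1, 12, 1, 4⟩, ⟨-1, 12, 0, 4⟩, ⟨-1, 11, 3, 3⟩, ⟨1, 11, 2, 3⟩, ⟨-1, 11, 1, 4⟩, ⟨1, 11, 1, 3⟩,
   ⟨-1, 11, 0, 4⟩, ⟨-1, 11, 0, 3⟩, ⟨-1, 10, 3, 3⟩, ⟨1, 10, 1, 3⟩, ⟨-1, 10, 0, 4⟩, ⟨-1, 10, 0, 3⟩,
   ⟨-2, 9, 2, 3⟩, ⟨1, 9, 1, 2⟩, ⟨-1, 9, 0, 3⟩, ⟨-2, 8, 1, 3⟩, ⟨2, 8, 1, 2⟩, ⟨-1, 8, 0, 3⟩,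
   ⟨1, 7, 1, 2⟩, ⟨-1, 7, 0, 3⟩, ⟨1, 5, 1, 1⟩, ⟨1, 4, 1, 1⟩, ⟨1, 4, 0, 1⟩, ⟨1, 3, 1, 1⟩,
   ⟨1, 3, 0, 1⟩, ⟨1, 2, 0, 1⟩, ⟨1, 1, 0, 0⟩, ⟨1, 0, 0, 0⟩]

/-! ### The operators -/

def P₁ : W :=
  (-q ^ 6 * M₁ ^ 3 * M₂ * (q ^ 3 * M₁ - 1) * (q * M₂ - 1) * (q ^ 4 * M₁ * M₂ - 1)
      * (q ^ 5 * M₁ * M₂ ^ 2 - 1) * F₁) • L₁ ^ 2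
  - (q ^ 4 * M₁ * M₂ * (q ^ 2 * M₁ - 1) * (q ^ 2 * M₂ - 1) * (M₁ - M₂)
      * (q ^ 4 * M₁ * M₂ - 1) * F₆) • (L₁ * L₂)
  + (q ^ 6 * M₁ * M₂ ^ 3 * (q * M₁ - 1) * (q ^ 3 * M₂ - 1) * (q ^ 4 * M₁ * M₂ - 1)
      * (q ^ 5 * M₁ ^ 2 * M₂ - 1) * tauK F₁) • L₂ ^ 2
  + (M₂ * (q ^ 2 * M₁ - 1) * (q * M₂ - 1) * (q ^ 3 * M₁ * M₂ - 1)
      * (q ^ 5 * M₁ ^ 2 * M₂ - 1) * F₇) • L₁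
  + (-M₁ * (q * M₁ - 1) * (q ^ 2 * M₂ - 1) * (q ^ 3 * M₁ * M₂ - 1)
      * (q ^ 5 * M₁ * M₂ ^ 2 - 1) * tauK F₇) • L₂
  + (q ^ 3 * (q * M₁ - 1) * (q * M₂ - 1) * (M₁ - M₂) * (q ^ 2 * M₁ * M₂ - 1) * F₂) • (1 : W)

def P₂ : W :=
  (-q ^ 21 * M₁ ^ 3 * M₂ ^ 7 * (q ^ 4 * M₂ - 1) * (q ^ 5 * M₁ * M₂ - 1)
      * (q ^ 5 * M₁ * M₂ ^ 2 - 1) * F₁) • L₂ ^ 3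
  + (q ^ 7 * M₁ ^ 2 * M₂ ^ 3 * (q ^ 2 * M₁ - 1) * (q ^ 2 * M₂ - 1) * (q ^ 4 * M₁ * M₂ - 1)
      * (q ^ 6 * M₁ * M₂ ^ 2 - 1) * F₈) • (L₁ * L₂)
  + (q ^ 6 * M₂ ^ 3 * (q ^ 3 * M₂ - 1) * (q ^ 4 * M₁ * M₂ - 1) * F₁₆) • L₂ ^ 2
  + (q ^ 8 * M₁ ^ 2 * M₂ ^ 2 * (q ^ 2 * M₁ - 1) * (q * M₂ - 1) * (q ^ 3 * M₁ * M₂ - 1)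
      * (q ^ 6 * M₁ * M₂ ^ 2 - 1) * F₃) • L₁
  + ((q ^ 2 * M₂ - 1) * (q ^ 3 * M₁ * M₂ - 1) * (q ^ 5 * M₁ * M₂ ^ 2 - 1) * F₁₄) • L₂
  - (q ^ 2 * (q * M₂ - 1) * (q ^ 2 * M₁ * M₂ - 1) * F₉) • (1 : W)

def P₃ : W :=
  (-q ^ 17 * M₁ ^ 3 * M₂ ^ 5 * (q ^ 2 * M₁ - 1) * (q ^ 3 * M₂ - 1) * (q ^ 5 * M₁ * M₂ - 1)
      * (q ^ 5 * M₁ * M₂ ^ 2 - 1) * F₁) • (L₁ * L₂ ^ 2)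
  + (q ^ 5 * M₁ * M₂ ^ 2 * (q ^ 2 * M₁ - 1) * (q ^ 2 * M₂ - 1) * (q ^ 4 * M₁ * M₂ - 1)
      * (q ^ 6 * M₁ * M₂ ^ 2 - 1) * F₁₂) • (L₁ * L₂)
  + (q ^ 6 * M₂ ^ 3 * (q * M₁ - 1) * (q ^ 3 * M₂ - 1) * (q ^ 4 * M₁ * M₂ - 1) * F₁₃) • L₂ ^ 2
  + (q ^ 7 * M₁ * M₂ ^ 2 * (q ^ 2 * M₁ - 1) * (q * M₂ - 1) * (q ^ 3 * M₁ * M₂ - 1)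
      * F₁₁) • L₁
  - ((q * M₁ - 1) * (q ^ 2 * M₂ - 1) * (q ^ 3 * M₁ * M₂ - 1) * (q ^ 5 * M₁ * M₂ ^ 2 - 1)
      * F₁₅) • L₂
  + (q ^ 2 * (q * M₁ - 1) * (q * M₂ - 1) * (q ^ 2 * M₁ * M₂ - 1) * (q ^ 6 * M₁ * M₂ ^ 2 - 1)
      * F₄) • (1 : W)

def Q₁ : W :=
  (q ^ 47 * M₁ ^ 5 * M₂ ^ 10 * (q ^ 6 * M₂ - 1) * (q ^ 7 * M₁ * M₂ - 1)
      * (q ^ 6 * M₁ * M₂ ^ 2 - 1) * (q ^ 7 * M₁ * M₂ ^ 2 - 1) * F₅) • L₂ ^ 5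
  - (q ^ 24 * M₁ ^ 2 * M₂ ^ 6 * (q ^ 5 * M₂ - 1) * (q ^ 6 * M₁ * M₂ - 1)
      * (q ^ 6 * M₁ * M₂ ^ 2 - 1) * F₂₀) • L₂ ^ 4
  + (q ^ 9 * M₂ ^ 3 * (q ^ 4 * M₂ - 1) * (q ^ 5 * M₁ * M₂ - 1) * (q ^ 9 * M₁ * M₂ ^ 2 - 1)
      * F₂₃) • L₂ ^ 3
  + ((q ^ 3 * M₂ - 1) * (q ^ 4 * M₁ * M₂ - 1) * (q ^ 7 * M₁ * M₂ ^ 2 - 1) * F₂₄) • L₂ ^ 2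
  + (q ^ 2 * (q ^ 2 * M₂ - 1) * (q ^ 3 * M₁ * M₂ - 1) * (q ^ 10 * M₁ * M₂ ^ 2 - 1)
      * F₁₈) • L₂
  - (q ^ 6 * (q * M₂ - 1) * (q ^ 2 * M₁ * M₂ - 1) * (q ^ 9 * M₁ * M₂ ^ 2 - 1)
      * (q ^ 10 * M₁ * M₂ ^ 2 - 1) * F₁₀) • (1 : W)

def Q₂ : W :=
  (q ^ 8 * M₁ ^ 3 * M₂ ^ 2 * (q - 1) * (q ^ 2 * M₁ - 1) * (q ^ 2 * M₁ ^ 2 + q * M₁ + 1)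
      * (q * M₂ - 1) * (q ^ 3 * M₁ * M₂ - 1) * (q ^ 6 * M₁ * M₂ ^ 2 - 1)
      * (q ^ 7 * M₁ * M₂ ^ 2 - 1) * (q ^ 8 * M₁ * M₂ ^ 2 - 1) * F₅) • L₁
  - (q ^ 37 * M₁ ^ 5 * M₂ ^ 10 * (q ^ 5 * M₂ - 1) * (q ^ 6 * M₁ * M₂ - 1)
      * (q ^ 6 * M₁ * M₂ ^ 2 - 1) * F₈) • L₂ ^ 4
  + (q ^ 18 * M₁ ^ 2 * M₂ ^ 6 * (q ^ 4 * M₂ - 1) * (q ^ 5 * M₁ * M₂ - 1) * F₁₉) • L₂ ^ 3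
  - (q ^ 6 * M₂ ^ 3 * (q ^ 3 * M₂ - 1) * (q ^ 4 * M₁ * M₂ - 1) * (q ^ 7 * M₁ * M₂ ^ 2 - 1)
      * F₂₁) • L₂ ^ 2
  - ((q ^ 2 * M₂ - 1) * (q ^ 3 * M₁ * M₂ - 1) * F₂₂) • L₂
  + (q ^ 2 * (q * M₂ - 1) * (q ^ 2 * M₁ * M₂ - 1) * (q ^ 8 * M₁ * M₂ ^ 2 - 1) * F₁₇) • (1 : W)

/-- The left ideal generated by `P₁, P₂, P₃`. -/
def J : Ideal W := Ideal.span {P₁, P₂, P₃}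

end QWeyl

end

open MvPolynomial

noncomputable section

namespace QWeyl

/-! ### Identity testing for integer polynomials by evaluation at large powers of two -/

/-! The quotient by `J` is compared with an explicit module. The matrices `matL₁` and `matL₂`,
combined with the shifts of M₁ and M₂, give two commuting semilinear operators on K⁵
(`actL_commute`). Every operator P can therefore be applied to the vector v = D⁻¹e₀, where D =
(qM₁-1)(qM₂-1)(q²M₁M₂-1); the map P ↦ Pv is `rho`, and its kernel `annihilator` is a left ideal.
That P₁, P₂, P₃, Q₁, Q₂ kill v is a finite list of Laurent polynomial identities. Each of these is
decided by a single integer evaluation at powers of two so large that nothing can cancel by accident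
(Kronecker substitution, `eq_zero_of_eval_eq_zero`).

The images of 1, L₂, L₁, L₂², L₁L₂ are linearly independent (`vec_linearIndependent`, a determinant
that is a unit modulo 101), so `rho` is onto and the annihilator has codimension 5. Conversely, let
I be a left ideal inside the annihilator such that five monomials span W modulo I. Their images span
K⁵, hence are independent, and a dimension count forces I to be the whole annihilator
(`eq_annihilator_of_reducible_eq_top`). Spanning only needs some coefficients of the generators to
be nonzero. Applied to P₁, P₂, P₃ and to Q₁, Q₂ this shows that both ideals equal the annihilator,
without any division of one set of generators by the other. Exchanging two coordinates of K⁵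
realizes τ and fixes v, so τ preserves the annihilator, hence `J`.

The same count shows that each of six staircases `stair` is a basis of the quotient by `J`; three
come from the P's and Q's, three from the symmetry. If a staircase is an initial segment for a
monomial order, no nonzero element of `J` can have its leading monomial there (`leadExp_notMem`),
which gives the Gröbner bases and the monomials below the staircases.

For the fan, each staircase has a chamber of weights for which all outside monomials are heavier
than all inside ones. In the chamber the initial ideal is the monomial ideal of the complement
(`initialIdeal_eq_span`), and different staircases give different ideals. Neighbouring staircases
differ by one exchange, and the wall is where the exchanged monomials have equal weight: L₁ and L₂⁴
on (4,1), L₁L₂ and L₂³ on (2,1), L₁² and L₂² on (1,1), and the mirror images of the first two. On a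
wall the initial ideal excludes certain monomials of both staircases, which distinguishes it from
the initial ideal of every weight not proportional to the given one
(`initialIdeal_ne_of_dominated`). So the classes of weights are exactly the open chambers and the
open rays between them, and plane geometry finishes the proof. -/

/-- A polynomial expression in `q, M₁, M₂` over `ℤ`. -/
inductive PExpr where
  | terms (l : List Mono)
  | add (a b : PExpr)
  | mul (a b : PExpr)

namespace PExpr

/-- The polynomial denoted by an expression. -/
def poly : PExpr → MvPolynomial (Fin 3) ℤ
  | terms l => (l.map fun t => C t.c * X 0 ^ t.i * X 1 ^ t.j * X 2 ^ t.k).sum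
  | add a b => poly a + poly b
  | mul a b => poly a * poly b

/-- The element of `ℚ(q, M₁, M₂)` denoted by an expression. -/
def value : PExpr → K
  | terms l => ofTerms l
  | add a b => value a + value b
  | mul a b => value a * value b

/-- The value of an expression at `q = 2 ^ a`, `M₁ = 2 ^ b`, `M₂ = 2 ^ c`. -/
def intValue (a b c : ℕ) : PExpr → ℤ
  | terms l => l.foldr (fun t s => t.c * ((2 ^ (a * t.i + b * t.j + c * t.k) : ℕ) : ℤ) + s) 0
  | add u v => intValue a b c u + intValue a b c v
  | mul u v => intValue a b c u * intValue a b c v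

/-- Upper bounds for the degrees in the three variables. -/
def deg (n : Fin 3) : PExpr → ℕ
  | terms l => l.foldr (fun t s => max (![t.i, t.j, t.k] n) s) 0
  | add a b => max (deg n a) (deg n b)
  | mul a b => deg n a + deg n b

/-- An upper bound for the sum of the absolute values of the coefficients. -/
def norm : PExpr → ℕ
  | terms l => l.foldr (fun t s => t.c.natAbs + s) 0
  | add a b => norm a + norm b
  | mul a b => norm a * norm b

/-- The test whether an expression denotes zero. -/
def isZero (e : PExpr) : Bool :=
  let a := Nat.log2 (norm e) + 1
  let b := a * (deg 0 e + 1)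
  let c := b * (deg 1 e + 1)
  decide (intValue a b c e = 0)

/-- The element of `K` and the integer of `intValue_eq` are images of one polynomial over ℤ; integer
arithmetic thereby decides questions in `K`. -/
theorem value_eq (e : PExpr) :
    e.value = eval₂Hom (Int.castRingHom K) ![q, M₁, M₂] e.poly := by
  induction e with
  | terms l =>
    simp only [value, ofTerms, poly, map_list_sum, List.map_map]
    congr 1
    apply List.map_congr_left
    intro t _
    simp only [Function.comp_apply, Mono.val, map_mul, map_pow, eval₂Hom_C, eval₂Hom_X']
    simp
  | add a b ha hb => simp [value, poly, ha, hb]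
  | mul a b ha hb => simp only [value, poly, ha, hb, map_mul]

theorem intValue_eq (a b c : ℕ) (e : PExpr) :
    e.intValue a b c = eval ![2 ^ a, 2 ^ b, 2 ^ c] e.poly := by
  induction e with
  | terms l =>
    induction l with
    | nil => simp [intValue, poly]
    | cons t l ih =>
      simp only [intValue, poly, List.foldr_cons, List.map_cons, List.sum_cons, map_add] at ih ⊢
      rw [ih]
      simp [pow_add, pow_mul]
      ring
  | add a b ha hb => simp [intValue, poly, ha, hb]
  | mul a b ha hb => simp [intValue, poly, ha, hb]

theorem degreeOf_poly_le (n : Fin 3) (e : PExpr) : degreeOf n e.poly ≤ e.deg n := by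
  induction e with
  | terms l =>
    induction l with
    | nil => simp [poly]
    | cons t l ih =>
      simp only [poly, deg, List.foldr_cons, List.map_cons, List.sum_cons] at ih ⊢
      refine (degreeOf_add_le _ _ _).trans (max_le_max ?_ ih)
      have h : C t.c * X 0 ^ t.i * X 1 ^ t.j * X 2 ^ t.k =
          (monomial (Finsupp.equivFunOnFinite.symm ![t.i, t.j, t.k]) t.c :
            MvPolynomial (Fin 3) ℤ) := by
        rw [monomial_eq, Finsupp.prod_fintype _ _ (by simp)]
        simp [Fin.prod_univ_three, mul_assoc]
      rw [h]
      by_cases hc : t.c = 0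
      · simp [hc]
      · rw [degreeOf_monomial_eq _ _ hc]; rfl
  | add a b ha hb =>
    exact (degreeOf_add_le _ _ _).trans (max_le_max ha hb)
  | mul a b ha hb =>
    exact (degreeOf_mul_le _ _ _).trans (add_le_add ha hb)

/-- The sum of absolute values of coefficients is submultiplicative. Carrying a coefficientwise
majorant along makes the product case immediate: multiply the majorants, and evaluate at (1, 1, 1)
to sum coefficients. -/
theorem exists_majorant (e : PExpr) : ∃ P : MvPolynomial (Fin 3) ℤ,
    (∀ m, |coeff m e.poly| ≤ coeff m P) ∧ eval 1 P = e.norm := by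
  induction e with
  | terms l =>
    induction l with
    | nil => exact ⟨0, by simp [poly], by simp [norm]⟩
    | cons t l ih =>
      obtain ⟨P, h1, h2⟩ := ih
      refine ⟨monomial (Finsupp.equivFunOnFinite.symm ![t.i, t.j, t.k]) |t.c| + P, ?_, ?_⟩
      · intro m
        have h : C t.c * X 0 ^ t.i * X 1 ^ t.j * X 2 ^ t.k =
            (monomial (Finsupp.equivFunOnFinite.symm ![t.i, t.j, t.k]) t.c :
              MvPolynomial (Fin 3) ℤ) := by
          rw [monomial_eq, Finsupp.prod_fintype _ _ (by simp)]
          simp [Fin.prod_univ_three, mul_assoc]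
        simp only [poly, List.map_cons, List.sum_cons, coeff_add, h] at h1 ⊢
        refine (abs_add_le _ _).trans (add_le_add ?_ (h1 m))
        simp only [coeff_monomial]
        split_ifs <;> simp
      · simp only [norm, List.foldr_cons, map_add, eval_monomial] at h2 ⊢
        rw [h2]
        simp
  | add a b ha hb =>
    obtain ⟨P, h1, h2⟩ := ha
    obtain ⟨Q, h3, h4⟩ := hb
    refine ⟨P + Q, fun m => ?_, by simp [norm, h2, h4]⟩
    simp only [poly, coeff_add]
    exact (abs_add_le _ _).trans (add_le_add (h1 m) (h3 m))
  | mul a b ha hb =>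
    obtain ⟨P, h1, h2⟩ := ha
    obtain ⟨Q, h3, h4⟩ := hb
    refine ⟨P * Q, fun m => ?_, by simp [norm, h2, h4]⟩
    simp only [poly, coeff_mul]
    refine (Finset.abs_sum_le_sum_abs _ _).trans (Finset.sum_le_sum fun i _ => ?_)
    rw [abs_mul]
    exact mul_le_mul (h1 _) (h3 _) (abs_nonneg _) ((abs_nonneg _).trans (h1 _))

theorem abs_coeff_poly_le (e : PExpr) (m : Fin 3 →₀ ℕ) : |coeff m e.poly| ≤ e.norm := by
  obtain ⟨P, h1, h2⟩ := exists_majorant e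
  have h0 : ∀ m, 0 ≤ coeff m P := fun m => (abs_nonneg _).trans (h1 m)
  refine (h1 m).trans ?_
  rw [← h2, eval_eq']
  simp only [Pi.one_apply, one_pow, Finset.prod_const_one, mul_one]
  by_cases hm : m ∈ P.support
  · exact Finset.single_le_sum (f := fun d => coeff d P) (fun d _ => h0 d) hm
  · rw [notMem_support_iff.mp hm]
    exact Finset.sum_nonneg fun d _ => h0 d

end PExpr

/-- An integer polynomial with small degrees and coefficients is determined to be zero by one
evaluation (Kronecker substitution). -/
theorem eq_zero_of_eval_eq_zero (p : MvPolynomial (Fin 3) ℤ) (B d₀ d₁ : ℕ)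
    (h₀ : degreeOf 0 p ≤ d₀) (h₁ : degreeOf 1 p ≤ d₁) (hB : ∀ m, |coeff m p| < B)
    (h : eval ![(B : ℤ), B ^ (d₀ + 1), B ^ ((d₀ + 1) * (d₁ + 1))] p = 0) : p = 0 := by
  by_contra hp
  -- The substitution turns a monomial into the power of B whose exponent has mixed-radix digits m
  -- 0, m 1, m 2. Only the two lower digits need a bound; the degree in the last variable is
  -- unrestricted.
  set φ : (Fin 3 →₀ ℕ) → ℕ := fun m => m 0 + (d₀ + 1) * (m 1 + (d₁ + 1) * m 2) with hφ
  have hinj : ∀ m ∈ p.support, ∀ n ∈ p.support, φ m = φ n → m = n := by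
    intro m hm n hn hmn
    have a0 := Nat.lt_succ_of_le ((monomial_le_degreeOf 0 hm).trans h₀)
    have b0 := Nat.lt_succ_of_le ((monomial_le_degreeOf 0 hn).trans h₀)
    have a1 := Nat.lt_succ_of_le ((monomial_le_degreeOf 1 hm).trans h₁)
    have b1 := Nat.lt_succ_of_le ((monomial_le_degreeOf 1 hn).trans h₁)
    have e0 : m 0 = n 0 := by
      have := congrArg (· % (d₀ + 1)) hmn
      simpa [hφ, Nat.add_mul_mod_self_left, Nat.mod_eq_of_lt a0, Nat.mod_eq_of_lt b0] using this
    have e12 : m 1 + (d₁ + 1) * m 2 = n 1 + (d₁ + 1) * n 2 := by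
      have : (d₀ + 1) * (m 1 + (d₁ + 1) * m 2) = (d₀ + 1) * (n 1 + (d₁ + 1) * n 2) := by
        simp only [hφ] at hmn; omega
      exact Nat.eq_of_mul_eq_mul_left (Nat.succ_pos _) this
    have e1 : m 1 = n 1 := by
      have := congrArg (· % (d₁ + 1)) e12
      simpa [Nat.add_mul_mod_self_left, Nat.mod_eq_of_lt a1, Nat.mod_eq_of_lt b1] using this
    have e2 : m 2 = n 2 := by
      have : (d₁ + 1) * m 2 = (d₁ + 1) * n 2 := by omega
      exact Nat.eq_of_mul_eq_mul_left (Nat.succ_pos _) this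
    ext i
    fin_cases i <;> assumption
  -- In the term with the least power of B nothing can cancel: all other terms are divisible by the
  -- next power, so B divides this coefficient, which is smaller than B in absolute value.
  obtain ⟨m, hm, hmin⟩ := Finset.exists_min_image p.support φ (support_nonempty.mpr hp)
  rw [eval_eq', ← Finset.add_sum_erase _ _ hm] at h
  have hprod : ∀ n : Fin 3 →₀ ℕ,
      ∏ i, ![(B : ℤ), B ^ (d₀ + 1), B ^ ((d₀ + 1) * (d₁ + 1))] i ^ n i = B ^ φ n := by
    intro n
    simp [Fin.prod_univ_three, hφ, ← pow_mul, ← pow_add]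
    ring
  simp only [hprod] at h
  have hBpos : (B : ℤ) ≠ 0 := by
    intro h0
    have := hB 0
    rw [h0] at this
    exact absurd this (not_lt.mpr (abs_nonneg _))
  have hdvd : (B : ℤ) ^ (φ m + 1) ∣
      ∑ n ∈ p.support.erase m, coeff n p * (B : ℤ) ^ φ n := by
    refine Finset.dvd_sum fun n hn => Dvd.dvd.mul_left (pow_dvd_pow _ ?_) _
    have hn' := Finset.mem_erase.mp hn
    have := hmin n hn'.2
    rcases this.lt_or_eq with hlt | heq
    · exact hlt
    · exact absurd (hinj m hm n hn'.2 heq).symm hn'.1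
  have hdvd2 : (B : ℤ) ^ (φ m + 1) ∣ coeff m p * (B : ℤ) ^ φ m := by
    rw [eq_neg_of_add_eq_zero_left h]
    exact hdvd.neg_right
  rw [pow_succ', mul_dvd_mul_iff_right (pow_ne_zero _ hBpos)] at hdvd2
  exact (mem_support_iff.mp hm) (Int.eq_zero_of_abs_lt_dvd hdvd2 (hB m))

namespace PExpr

theorem value_eq_zero {e : PExpr} (h : e.isZero = true) : e.value = 0 := by
  rw [value_eq, eq_zero_of_eval_eq_zero e.poly (2 ^ (Nat.log2 e.norm + 1)) (e.deg 0) (e.deg 1)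
    (degreeOf_poly_le 0 e) (degreeOf_poly_le 1 e), map_zero]
  · intro m
    refine (abs_coeff_poly_le e m).trans_lt ?_
    exact_mod_cast Nat.lt_log2_self
  · have h' := of_decide_eq_true h
    rw [intValue_eq] at h'
    rw [← h']
    congr 2
    simp [← pow_mul, mul_assoc]

/-- This is the algebraic independence of q, M₁, M₂ over ℤ. It makes one nonzero integer value a
certificate of nonvanishing in `K`, with no bound on degrees or coefficients. -/
theorem eval₂Hom_injective :
    Function.Injective (eval₂Hom (Int.castRingHom K) ![q, M₁, M₂]) := by
  have h : eval₂Hom (Int.castRingHom K) ![q, M₁, M₂] = (algebraMap (MvPolynomial (Fin 3) ℚ) K).comp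
      (MvPolynomial.map (Int.castRingHom ℚ)) := by
    apply MvPolynomial.ringHom_ext
    · intro r; simp
    · intro i
      fin_cases i <;> simp [q, M₁, M₂]
  rw [h, RingHom.coe_comp]
  exact (IsFractionRing.injective _ K).comp (map_injective _ Int.cast_injective)

theorem value_ne_zero {e : PExpr} (a b c : ℕ) (h : e.intValue a b c ≠ 0) : e.value ≠ 0 := by
  rw [intValue_eq] at h
  rw [value_eq]
  exact fun h0 => h (by rw [eval₂Hom_injective (h0.trans (map_zero _).symm), map_zero])

end PExpr

/-! ### Laurent polynomials as lists of terms -/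

/-- A term `c * q ^ i * M₁ ^ j * M₂ ^ k` with integer exponents. -/
structure LTerm where
  c : ℤ
  i : ℤ
  j : ℤ
  k : ℤ

namespace LTerm

/-- The element of `K` denoted by a term. -/
def value (t : LTerm) : K := t.c * q ^ t.i * M₁ ^ t.j * M₂ ^ t.k

/-- The product of two terms. -/
def mul (s t : LTerm) : LTerm := ⟨s.c * t.c, s.i + t.i, s.j + t.j, s.k + t.k⟩

/-- The effect of `L₁ ^ a * L₂ ^ b` on a term. -/
def shift (a b : ℤ) (t : LTerm) : LTerm := ⟨t.c, t.i + a * t.j + b * t.k, t.j, t.k⟩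

/-- The effect of `τ` on a term. -/
def swap (t : LTerm) : LTerm := ⟨t.c, t.i, t.k, t.j⟩

/-- The opposite term. -/
def neg (t : LTerm) : LTerm := ⟨-t.c, t.i, t.j, t.k⟩

end LTerm

/-- The Laurent polynomial denoted by a list of terms. -/
def laurent (l : List LTerm) : K := (l.map LTerm.value).sum

/-- The product of two lists of terms. -/
def mulTerms (l l' : List LTerm) : List LTerm := l.flatMap fun t => l'.map t.mul

theorem M₁_ne_zero : M₁ ≠ 0 := by
  unfold M₁
  rw [Ne, IsFractionRing.to_map_eq_zero_iff]
  exact X_ne_zero 1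

theorem M₂_ne_zero : M₂ ≠ 0 := by
  unfold M₂
  rw [Ne, IsFractionRing.to_map_eq_zero_iff]
  exact X_ne_zero 2

theorem LTerm.value_mul (s t : LTerm) : (s.mul t).value = s.value * t.value := by
  simp only [value, mul, zpow_add₀ q_ne_zero, zpow_add₀ M₁_ne_zero, zpow_add₀ M₂_ne_zero]
  push_cast
  ring

/-- A shift sends a Laurent monomial to another one, changing only the exponent of q. Hence the
whole action on Laurent vectors can be computed on lists of terms. -/
theorem LTerm.value_shift (e : Expo) (t : LTerm) :
    (t.shift (e 0) (e 1)).value = QWeyl.shift e t.value := by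
  simp only [value, shift, map_mul, map_zpow₀, shift_q, shift_M₁, shift_M₂, map_intCast,
    mul_zpow, zpow_add₀ q_ne_zero, zpow_mul, zpow_natCast]
  ring

theorem LTerm.value_swap (t : LTerm) : t.swap.value = tauK t.value := by
  simp only [value, swap, map_mul, map_zpow₀, tauK_q, tauK_M₁, tauK_M₂, map_intCast]
  ring

@[simp] theorem laurent_nil : laurent [] = 0 := rfl

theorem laurent_append (l l' : List LTerm) : laurent (l ++ l') = laurent l + laurent l' := by
  simp [laurent]

theorem laurent_mulTerms (l l' : List LTerm) :
    laurent (mulTerms l l') = laurent l * laurent l' := by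
  induction l with
  | nil => simp [mulTerms]
  | cons t l ih =>
    have h : laurent (l'.map t.mul) = t.value * laurent l' := by
      simp only [laurent, List.map_map, ← List.sum_map_mul_left]
      congr 1
      exact List.map_congr_left fun s _ => LTerm.value_mul t s
    simp only [mulTerms, List.flatMap_cons, laurent_append] at ih ⊢
    rw [ih, h]
    simp only [laurent, List.map_cons, List.sum_cons]
    ring

theorem laurent_shift (e : Expo) (l : List LTerm) :
    laurent (l.map (LTerm.shift (e 0) (e 1))) = shift e (laurent l) := by
  simp only [laurent, map_list_sum, List.map_map]
  congr 1
  exact List.map_congr_left fun t _ => LTerm.value_shift e t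

theorem laurent_swap (l : List LTerm) : laurent (l.map LTerm.swap) = tauK (laurent l) := by
  simp only [laurent, map_list_sum, List.map_map]
  congr 1
  exact List.map_congr_left fun t _ => LTerm.value_swap t

theorem laurent_neg (l : List LTerm) : laurent (l.map LTerm.neg) = -laurent l := by
  induction l with
  | nil => simp [laurent]
  | cons t l ih =>
    simp only [laurent, List.map_cons, List.sum_cons, neg_add] at ih ⊢
    rw [ih]
    simp [LTerm.neg, LTerm.value]

/-- The product of a Laurent polynomial with `q ^ a * M₁ ^ b * M₂ ^ c`. -/
def clear (a b c : ℕ) (l : List LTerm) : List Mono :=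
  l.map fun t => ⟨t.c, (t.i + (a : ℤ)).toNat, (t.j + (b : ℤ)).toNat, (t.k + (c : ℤ)).toNat⟩

/-- The test whether multiplication by `q ^ a * M₁ ^ b * M₂ ^ c` clears all denominators. -/
def clears (a b c : ℕ) (l : List LTerm) : Bool :=
  l.all fun t => decide (0 ≤ t.i + a) && decide (0 ≤ t.j + b) && decide (0 ≤ t.k + c)

theorem ofTerms_clear {a b c : ℕ} {l : List LTerm} (h : clears a b c l = true) :
    ofTerms (clear a b c l) = q ^ a * M₁ ^ b * M₂ ^ c * laurent l := by
  simp only [ofTerms, clear, laurent, ← List.sum_map_mul_left, List.map_map]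
  congr 1
  apply List.map_congr_left
  intro t ht
  have h' := List.all_eq_true.mp h t ht
  simp only [Bool.and_eq_true, decide_eq_true_eq] at h'
  obtain ⟨⟨hi, hj⟩, hk⟩ := h'
  -- The nonnegativity checked by `clears` is what keeps `Int.toNat` from truncating an exponent.
  simp only [Function.comp_apply, Mono.val, LTerm.value, ← zpow_natCast, Int.toNat_of_nonneg hi,
    Int.toNat_of_nonneg hj, Int.toNat_of_nonneg hk, zpow_add₀ q_ne_zero, zpow_add₀ M₁_ne_zero,
    zpow_add₀ M₂_ne_zero]
  ring

/-- The test whether a list of terms denotes zero, after clearing denominators. -/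
def laurentIsZero (a b c : ℕ) (l : List LTerm) : Bool :=
  clears a b c l && (PExpr.terms (clear a b c l)).isZero

theorem laurent_eq_zero {a b c : ℕ} {l : List LTerm} (h : laurentIsZero a b c l = true) :
    laurent l = 0 := by
  simp only [laurentIsZero, Bool.and_eq_true] at h
  have h1 : ofTerms (clear a b c l) = 0 := PExpr.value_eq_zero h.2
  rw [ofTerms_clear h.1] at h1
  have h2 : q ^ a * M₁ ^ b * M₂ ^ c ≠ 0 :=
    mul_ne_zero (mul_ne_zero (pow_ne_zero _ q_ne_zero) (pow_ne_zero _ M₁_ne_zero))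
      (pow_ne_zero _ M₂_ne_zero)
  exact (mul_eq_zero.mp h1).resolve_left h2

/-! ### A representation of the `q`-Weyl algebra on `K ^ 5` -/

/-- The entries of the matrix of `L₁` in the representation. -/
def matL₁ : Fin 5 → Fin 5 → List LTerm :=
  -- The matrix is lower triangular with Laurent monomials, up to sign, on the diagonal; the same
  -- holds for `matL₂`. The module is a successive extension of rank-one modules.
  ![![[⟨1, -7, -4, -2⟩], [], [], [], []],
    ![[⟨1, 6, -7, 0⟩], [⟨-1, 0, -3, 0⟩], [], [], []],
    ![[⟨-1, 10, 0, -4⟩, ⟨1, 6, -2, -5⟩], [], [⟨1, 0, 0, 0⟩], [], []],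
    ![[⟨1, 0, -10, -9⟩], [], [], [⟨-1, 0, -3, -3⟩], []],
    ![[⟨1, 0, -8, -7⟩, ⟨-1, 1, -6, -5⟩, ⟨-1, 2, -5, -4⟩, ⟨1, 6, -5, 0⟩, ⟨1, 5, -3, -2⟩,
        ⟨-1, 7, -3, 0⟩, ⟨1, 6, -2, -3⟩, ⟨-1, 8, -2, 0⟩, ⟨-1, 10, 0, -2⟩, ⟨1, 11, 0, 0⟩],
      [⟨1, 1, 1, 0⟩, ⟨-1, 0, -1, 0⟩], [], [⟨1, 1, 1, 1⟩, ⟨-1, 0, -1, -1⟩], [⟨1, 0, 0, 0⟩]]]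

/-- The permutation of the coordinates corresponding to `τ`. -/
def swapIdx : Fin 5 → Fin 5 := ![0, 2, 1, 3, 4]

/-- The entries of the matrix of `L₂` in the representation. -/
def matL₂ (i j : Fin 5) : List LTerm := (matL₁ (swapIdx i) (swapIdx j)).map LTerm.swap

/-- The image of a vector of Laurent polynomials under the semilinear map with the given matrix
and the shift `(a, b)`. -/
def stepTerms (A : Fin 5 → Fin 5 → List LTerm) (a b : ℤ) (v : Fin 5 → List LTerm) (i : Fin 5) :
    List LTerm :=
  mulTerms (A i 0) ((v 0).map (LTerm.shift a b)) ++ (mulTerms (A i 1) ((v 1).map (LTerm.shift a b))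
    ++ (mulTerms (A i 2) ((v 2).map (LTerm.shift a b)) ++
      (mulTerms (A i 3) ((v 3).map (LTerm.shift a b)) ++
        mulTerms (A i 4) ((v 4).map (LTerm.shift a b)))))

/-- The semilinear map on `K ^ 5` given by a matrix. -/
def semilinear (A : Fin 5 → Fin 5 → List LTerm) (e : Expo) : AddMonoid.End (Fin 5 → K) where
  toFun v i := ∑ j, laurent (A i j) * shift e (v j)
  map_zero' := by ext i; simp
  map_add' v w := by ext i; simp [mul_add, Finset.sum_add_distrib]

theorem semilinear_apply (A : Fin 5 → Fin 5 → List LTerm) (e : Expo) (v : Fin 5 → K) (i : Fin 5) :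
    semilinear A e v i = ∑ j, laurent (A i j) * shift e (v j) := rfl

theorem semilinear_smul (A : Fin 5 → Fin 5 → List LTerm) (e : Expo) (c : K) (v : Fin 5 → K) :
    semilinear A e (c • v) = shift e c • semilinear A e v := by
  ext i
  simp only [semilinear_apply, Pi.smul_apply, smul_eq_mul, map_mul, Finset.mul_sum]
  exact Finset.sum_congr rfl fun j _ => by ring

theorem semilinear_laurent (A : Fin 5 → Fin 5 → List LTerm) (e : Expo)
    (v : Fin 5 → List LTerm) :
    semilinear A e (fun i => laurent (v i)) =
      fun i => laurent (stepTerms A (e 0) (e 1) v i) := by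
  ext i
  simp only [semilinear_apply, stepTerms, laurent_append, laurent_mulTerms, laurent_shift,
    Fin.sum_univ_five]
  ring

/-- The action of `L₁` on `K ^ 5`. -/
def actL₁ : AddMonoid.End (Fin 5 → K) := semilinear matL₁ (expo 1 0)

/-- The action of `L₂` on `K ^ 5`. -/
def actL₂ : AddMonoid.End (Fin 5 → K) := semilinear matL₂ (expo 0 1)

@[simp] theorem expo_zero' (a b : ℕ) : expo a b 0 = a := by simp [expo]
@[simp] theorem expo_one' (a b : ℕ) : expo a b 1 = b := by simp [expo]

theorem expo_eq (e : Expo) : expo (e 0) (e 1) = e := by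
  ext i; fin_cases i <;> simp

theorem expo_add (a b c d : ℕ) : expo a b + expo c d = expo (a + c) (b + d) := by
  ext i; fin_cases i <;> simp

/-- The `j`-th unit vector. -/
def unitTerms (j i : Fin 5) : List LTerm := if i = j then [⟨1, 0, 0, 0⟩] else []

theorem laurent_unitTerms (j : Fin 5) : (fun i => laurent (unitTerms j i)) = Pi.single j 1 := by
  ext i
  by_cases h : i = j <;> simp [unitTerms, laurent, LTerm.value, h]

/-- This is the compatibility A₁σ₁(A₂) = A₂σ₂(A₁) of the two matrices, read off column by column: it
is what makes K⁵ a representation, since L₁ and L₂ must commute. -/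
theorem mat_commute_check : ∀ i j : Fin 5, laurentIsZero 30 20 20
    (stepTerms matL₁ 1 0 (stepTerms matL₂ 0 1 (unitTerms j)) i ++
      (stepTerms matL₂ 0 1 (stepTerms matL₁ 1 0 (unitTerms j)) i).map LTerm.neg) = true := by
  decide +kernel

theorem end_mul_apply {M : Type*} [AddCommMonoid M] (f g : AddMonoid.End M) (x : M) :
    (f * g) x = f (g x) := rfl

theorem end_commute {M : Type*} [AddCommMonoid M] {f g : AddMonoid.End M}
    (h : ∀ x, f (g x) = g (f x)) : Commute f g :=
  AddMonoidHom.ext h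

theorem end_pow_succ_apply {M : Type*} [AddCommMonoid M] (f : AddMonoid.End M) (n : ℕ) (x : M) :
    (f ^ (n + 1)) x = f ((f ^ n) x) := by
  rw [pow_succ', end_mul_apply]

theorem end_pow_apply_comm {M : Type*} [AddCommMonoid M] {f g : AddMonoid.End M}
    (h : Commute f g) (n : ℕ) (x : M) : g ((f ^ n) x) = (f ^ n) (g x) := by
  rw [← end_mul_apply, ← end_mul_apply, (h.pow_left n).eq]

theorem semilinear_laurent_comm {A B : Fin 5 → Fin 5 → List LTerm} {d e : Expo} {a b c : ℕ}
    {v : Fin 5 → List LTerm}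
    (h : ∀ i, laurentIsZero a b c (stepTerms A (d 0) (d 1) (stepTerms B (e 0) (e 1) v) i ++
      (stepTerms B (e 0) (e 1) (stepTerms A (d 0) (d 1) v) i).map LTerm.neg) = true) :
    semilinear A d (semilinear B e fun i => laurent (v i)) =
      semilinear B e (semilinear A d fun i => laurent (v i)) := by
  rw [semilinear_laurent, semilinear_laurent, semilinear_laurent, semilinear_laurent]
  ext i
  have hi := laurent_eq_zero (h i)
  rw [laurent_append, laurent_neg] at hi
  exact add_neg_eq_zero.mp hi

theorem shift_shift (d e : Expo) (x : K) : shift (d + e) x = shift d (shift e x) := by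
  rw [shift_add, RingHom.comp_apply]

theorem eq_sum_smul_single (v : Fin 5 → K) : v = ∑ j, v j • (Pi.single j 1 : Fin 5 → K) := by
  ext i
  simp [Finset.sum_apply, Pi.single_apply]

/-- The two composites are semilinear for the same shift d + e, so they agree as soon as they agree
on unit vectors. -/
theorem semilinear_commute {A B : Fin 5 → Fin 5 → List LTerm} {d e : Expo}
    (h : ∀ j, semilinear A d (semilinear B e (Pi.single j 1)) =
      semilinear B e (semilinear A d (Pi.single j 1))) :
    Commute (semilinear A d) (semilinear B e) := by
  have hs : ∀ (j : Fin 5) (c : K), semilinear A d (semilinear B e (c • Pi.single j 1)) =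
      semilinear B e (semilinear A d (c • Pi.single j 1)) := by
    intro j c
    rw [semilinear_smul, semilinear_smul, semilinear_smul, semilinear_smul, h, ← shift_shift,
      ← shift_shift, add_comm]
  have hv : ∀ v, semilinear A d (semilinear B e v) = semilinear B e (semilinear A d v) := by
    intro v
    rw [eq_sum_smul_single v, map_sum, map_sum, map_sum, map_sum]
    exact Finset.sum_congr rfl fun j _ => hs j (v j)
  exact end_commute hv

theorem actL_commute : Commute actL₁ actL₂ := by
  refine semilinear_commute fun j => ?_
  rw [← laurent_unitTerms]
  refine semilinear_laurent_comm (a := 30) (b := 20) (c := 20) fun i => ?_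
  rw [expo_zero', expo_one', expo_zero', expo_one', Nat.cast_one, Nat.cast_zero]
  exact mat_commute_check i j

/-! ### The cyclic vector and its images under monomials -/

/-- The factor `(q M₁ - 1) (q M₂ - 1) (q² M₁ M₂ - 1)`, shifted by `L₁ ^ a * L₂ ^ b`. -/
def dimFactor (a b : ℕ) : K :=
  (q ^ (a + 1) * M₁ - 1) * (q ^ (b + 1) * M₂ - 1) * (q ^ (a + b + 2) * M₁ * M₂ - 1)

/-- The expression `q ^ a * M₁ ^ b * M₂ ^ c - 1`. -/
def linExpr (a b c : ℕ) : PExpr := .terms [⟨1, a, b, c⟩, ⟨-1, 0, 0, 0⟩]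

theorem value_linExpr (a b c : ℕ) : (linExpr a b c).value = q ^ a * M₁ ^ b * M₂ ^ c - 1 := by
  simp [linExpr, PExpr.value, ofTerms, Mono.val]
  ring

theorem lin_ne_zero (a b c : ℕ) (h : 0 < a + b + c) : q ^ a * M₁ ^ b * M₂ ^ c - 1 ≠ 0 := by
  rw [← value_linExpr]
  -- At q = M₁ = M₂ = 2 the value is 2^(a+b+c) - 1, which is positive.
  apply PExpr.value_ne_zero 1 1 1
  have h2 : 1 < 2 ^ (a + b + c) := Nat.one_lt_two_pow (by omega)
  simp only [linExpr, PExpr.intValue, List.foldr_cons, List.foldr_nil, one_mul, add_zero, pow_zero]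
  push_cast
  have h3 : (1 : ℤ) < 2 ^ (a + b + c) := by exact_mod_cast h2
  omega

theorem dimFactor_ne_zero (a b : ℕ) : dimFactor a b ≠ 0 := by
  have h1 := lin_ne_zero (a + 1) 1 0 (by omega)
  have h2 := lin_ne_zero (b + 1) 0 1 (by omega)
  have h3 := lin_ne_zero (a + b + 2) 1 1 (by omega)
  simp only [pow_one, pow_zero, mul_one] at h1 h2 h3
  exact mul_ne_zero (mul_ne_zero h1 h2) h3

theorem shift_dimFactor (a b : ℕ) (e : Expo) :
    shift e (dimFactor a b) = dimFactor (a + e 0) (b + e 1) := by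
  simp only [dimFactor, map_mul, map_sub, map_pow, map_one, shift_q, shift_M₁, shift_M₂]
  ring

/-- The vector of `K ^ 5` on which `L₁ ^ a * L₂ ^ b` takes the class of `1`. -/
def vec (a b : ℕ) : Fin 5 → K :=
  (actL₁ ^ a) ((actL₂ ^ b) ((dimFactor 0 0)⁻¹ • Pi.single 0 1))

/-- The terms of `dimFactor 0 b • vec 0 b`. -/
def vecTermsL₂ : ℕ → Fin 5 → List LTerm
  | 0 => unitTerms 0
  | b + 1 => stepTerms matL₂ 0 1 (vecTermsL₂ b)

/-- The terms of `dimFactor a b • vec a b`. -/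
def vecTerms : ℕ → ℕ → Fin 5 → List LTerm
  | 0, b => vecTermsL₂ b
  | a + 1, b => stepTerms matL₁ 1 0 (vecTerms a b)

theorem actL₁_vec (a b : ℕ) : actL₁ (vec a b) = vec (a + 1) b := by
  rw [vec, vec, end_pow_succ_apply]

theorem actL₂_vec (a b : ℕ) : actL₂ (vec a b) = vec a (b + 1) := by
  rw [vec, vec, end_pow_apply_comm actL_commute, end_pow_succ_apply]

/-- The matrices have Laurent entries, so the action merely shifts the denominator of the cyclic
vector. Apart from monomials, `dimFactor a b` is all the denominator there is, and it matches
factors visible in the coefficients of the P's and Q's. -/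
theorem vec_eq (a b : ℕ) : vec a b = (dimFactor a b)⁻¹ • fun i => laurent (vecTerms a b i) := by
  induction a with
  | zero =>
    induction b with
    | zero => simp only [vecTerms, vecTermsL₂, laurent_unitTerms]; rfl
    | succ b ih =>
      rw [← actL₂_vec, ih, actL₂, semilinear_smul, semilinear_laurent, map_inv₀, shift_dimFactor]
      simp [vecTerms, vecTermsL₂]
  | succ a ih =>
    rw [← actL₁_vec, ih, actL₁, semilinear_smul, semilinear_laurent, map_inv₀, shift_dimFactor]
    simp [vecTerms]

/-! ### Evaluation of operators on the cyclic vector -/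

/-- The action on the class of `1` in `K ^ 5`. -/
def rho : W →+ (Fin 5 → K) :=
  (Finsupp.liftAddHom fun e : Multiplicative Expo =>
    ((LinearMap.toSpanSingleton K (Fin 5 → K) (vec (e.toAdd 0) (e.toAdd 1))).toAddMonoidHom)).comp
    SkewMonoidAlgebra.coeffAddEquiv.toAddMonoidHom

theorem rho_single (e : Multiplicative Expo) (c : K) :
    rho (SkewMonoidAlgebra.single e c) = c • vec (e.toAdd 0) (e.toAdd 1) := by
  simp [rho, SkewMonoidAlgebra.coeffAddEquiv]

theorem rho_smul (c : K) (P : W) : rho (c • P) = c • rho P := by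
  induction P using SkewMonoidAlgebra.induction_on' with
  | single g a => rw [SkewMonoidAlgebra.smul_single, rho_single, rho_single, smul_smul, smul_eq_mul]
  | add f g hf hg => rw [smul_add, map_add, map_add, smul_add, hf, hg]

theorem expo_zero_zero : expo 0 0 = 0 := by simp [expo]

theorem L₁_pow_mul_L₂_pow (a b : ℕ) :
    L₁ ^ a * L₂ ^ b = SkewMonoidAlgebra.single (.ofAdd (expo a b)) 1 := by
  have h1 : ∀ a, L₁ ^ a = SkewMonoidAlgebra.single (.ofAdd (expo a 0)) 1 := by
    intro a
    induction a with
    | zero => rw [pow_zero, SkewMonoidAlgebra.one_def, expo_zero_zero, ofAdd_zero]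
    | succ a ih =>
      rw [pow_succ, ih, L₁, SkewMonoidAlgebra.single_mul_single, ← ofAdd_add, expo_add]
      simp
  have h2 : ∀ a, L₂ ^ a = SkewMonoidAlgebra.single (.ofAdd (expo 0 a)) 1 := by
    intro a
    induction a with
    | zero => rw [pow_zero, SkewMonoidAlgebra.one_def, expo_zero_zero, ofAdd_zero]
    | succ a ih =>
      rw [pow_succ, ih, L₂, SkewMonoidAlgebra.single_mul_single, ← ofAdd_add, expo_add]
      simp
  rw [h1, h2, SkewMonoidAlgebra.single_mul_single, ← ofAdd_add, expo_add]
  simp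

theorem rho_mono (a b : ℕ) : rho (L₁ ^ a * L₂ ^ b) = vec a b := by
  rw [L₁_pow_mul_L₂_pow, rho_single]
  simp

/-- Semilinearity moves the coefficients of P past L₁. With the analogue for L₂ this is all of the
module structure that is needed; no instance on K⁵ is set up. -/
theorem rho_L₁_mul (P : W) : rho (L₁ * P) = actL₁ (rho P) := by
  induction P using SkewMonoidAlgebra.induction_on' with
  | single g a =>
    rw [L₁, SkewMonoidAlgebra.single_mul_single, rho_single, rho_single, actL₁, semilinear_smul,
      ← actL₁, actL₁_vec, smul_eq_shift]
    simp [add_comm]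
  | add f g hf hg => rw [mul_add, map_add, map_add, map_add, hf, hg]

theorem rho_L₂_mul (P : W) : rho (L₂ * P) = actL₂ (rho P) := by
  induction P using SkewMonoidAlgebra.induction_on' with
  | single g a =>
    rw [L₂, SkewMonoidAlgebra.single_mul_single, rho_single, rho_single, actL₂, semilinear_smul,
      ← actL₂, actL₂_vec, smul_eq_shift]
    simp [add_comm]
  | add f g hf hg => rw [mul_add, map_add, map_add, map_add, hf, hg]

theorem single_eq_smul (e : Multiplicative Expo) (c : K) :
    (SkewMonoidAlgebra.single e c : W) = c • (L₁ ^ (e.toAdd 0) * L₂ ^ (e.toAdd 1)) := by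
  rw [L₁_pow_mul_L₂_pow, expo_eq, SkewMonoidAlgebra.smul_single]
  simp

/-- The left ideal of the operators annihilating the class of `1`. -/
def annihilator : Ideal W where
  carrier := {P | rho P = 0}
  zero_mem' := map_zero _
  add_mem' {P Q} hP hQ := by simp only [Set.mem_ofPred_eq] at *; rw [map_add, hP, hQ, add_zero]
  smul_mem' R P hP := by
    -- Multiplication by L₁ or L₂ acts on values of `rho` through an additive map, so monomials
    -- preserve the kernel; coefficients do so by `rho_smul`.
    have hpow : ∀ a b : ℕ, rho (L₁ ^ a * L₂ ^ b * P) = 0 := by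
      intro a b
      induction a with
      | zero =>
        induction b with
        | zero => simpa using hP
        | succ b ih =>
          rw [pow_zero, one_mul] at ih ⊢
          rw [pow_succ', mul_assoc, rho_L₂_mul, ih, map_zero]
      | succ a ih => rw [pow_succ', mul_assoc, mul_assoc, rho_L₁_mul, ← mul_assoc, ih, map_zero]
    simp only [Set.mem_ofPred_eq, smul_eq_mul] at *
    induction R using SkewMonoidAlgebra.induction_on' with
    | single g a =>
      rw [single_eq_smul, smul_mul_assoc, rho_smul, hpow, smul_zero]
    | add f g hf hg => rw [add_mul, map_add, hf, hg, add_zero]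

theorem mem_annihilator {P : W} : P ∈ annihilator ↔ rho P = 0 := Iff.rfl

/-! ### The operators annihilate the class of `1` -/

/-- The effect of `τ` on a term. -/
def Mono.swap (t : Mono) : Mono := ⟨t.c, t.i, t.k, t.j⟩

theorem ofTerms_swap (l : List Mono) : ofTerms (l.map Mono.swap) = tauK (ofTerms l) := by
  simp only [ofTerms, map_list_sum, List.map_map]
  congr 1
  refine List.map_congr_left fun t _ => ?_
  simp only [Function.comp_apply, Mono.val, Mono.swap, map_mul, map_pow, tauK_q, tauK_M₁,
    tauK_M₂, map_intCast]
  ring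

/-- The terms of `F₁`. -/
def terms₁ : {l : List Mono // F₁ = ofTerms l} := ⟨_, rfl⟩

/-- The terms of `F₂`. -/
def terms₂ : {l : List Mono // F₂ = ofTerms l} := ⟨_, rfl⟩

/-- The terms of `F₃`. -/
def terms₃ : {l : List Mono // F₃ = ofTerms l} := ⟨_, rfl⟩

/-- The terms of `F₄`. -/
def terms₄ : {l : List Mono // F₄ = ofTerms l} := ⟨_, rfl⟩

/-- The terms of `F₅`. -/
def terms₅ : {l : List Mono // F₅ = ofTerms l} := ⟨_, rfl⟩

/-- The terms of `F₆`. -/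
def terms₆ : {l : List Mono // F₆ = ofTerms l} := ⟨_, rfl⟩

/-- The terms of `F₇`. -/
def terms₇ : {l : List Mono // F₇ = ofTerms l} := ⟨_, rfl⟩

/-- The terms of `F₈`. -/
def terms₈ : {l : List Mono // F₈ = ofTerms l} := ⟨_, rfl⟩

/-- The terms of `F₉`. -/
def terms₉ : {l : List Mono // F₉ = ofTerms l} := ⟨_, rfl⟩

/-- The terms of `F₁₀`. -/
def terms₁₀ : {l : List Mono // F₁₀ = ofTerms l} := ⟨_, rfl⟩

/-- The terms of `F₁₁`. -/
def terms₁₁ : {l : List Mono // F₁₁ = ofTerms l} := ⟨_, rfl⟩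

/-- The terms of `F₁₂`. -/
def terms₁₂ : {l : List Mono // F₁₂ = ofTerms l} := ⟨_, rfl⟩

/-- The terms of `F₁₃`. -/
def terms₁₃ : {l : List Mono // F₁₃ = ofTerms l} := ⟨_, rfl⟩

/-- The terms of `F₁₄`. -/
def terms₁₄ : {l : List Mono // F₁₄ = ofTerms l} := ⟨_, rfl⟩

/-- The terms of `F₁₅`. -/
def terms₁₅ : {l : List Mono // F₁₅ = ofTerms l} := ⟨_, rfl⟩

/-- The terms of `F₁₆`. -/
def terms₁₆ : {l : List Mono // F₁₆ = ofTerms l} := ⟨_, rfl⟩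

/-- The terms of `F₁₇`. -/
def terms₁₇ : {l : List Mono // F₁₇ = ofTerms l} := ⟨_, rfl⟩

/-- The terms of `F₁₈`. -/
def terms₁₈ : {l : List Mono // F₁₈ = ofTerms l} := ⟨_, rfl⟩

/-- The terms of `F₁₉`. -/
def terms₁₉ : {l : List Mono // F₁₉ = ofTerms l} := ⟨_, rfl⟩

/-- The terms of `F₂₀`. -/
def terms₂₀ : {l : List Mono // F₂₀ = ofTerms l} := ⟨_, rfl⟩

/-- The terms of `F₂₁`. -/
def terms₂₁ : {l : List Mono // F₂₁ = ofTerms l} := ⟨_, rfl⟩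

/-- The terms of `F₂₂`. -/
def terms₂₂ : {l : List Mono // F₂₂ = ofTerms l} := ⟨_, rfl⟩

/-- The terms of `F₂₃`. -/
def terms₂₃ : {l : List Mono // F₂₃ = ofTerms l} := ⟨_, rfl⟩

/-- The terms of `F₂₄`. -/
def terms₂₄ : {l : List Mono // F₂₄ = ofTerms l} := ⟨_, rfl⟩

/-- The scalar multiple by `q ^ a * M₁ ^ b * M₂ ^ c` of the `i`-th coordinate of the linear
combination of the vectors `dimFactor a b • vec a b` with the given coefficients. -/
def combination (i : Fin 5) (l : List (PExpr × ℕ × ℕ)) : PExpr :=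
  l.foldr (fun t s => .add (.mul t.1 (.terms (clear 75 21 26 (vecTerms t.2.1 t.2.2 i)))) s)
    (.terms [])

/-- The test whether a linear combination of the vectors `dimFactor a b • vec a b` vanishes. -/
def isRelation (l : List (PExpr × ℕ × ℕ)) : Bool :=
  decide (∀ i : Fin 5, (l.all fun t => clears 75 21 26 (vecTerms t.2.1 t.2.2 i)) = true ∧
    (combination i l).isZero = true)

theorem value_combination (i : Fin 5) (l : List (PExpr × ℕ × ℕ))
    (h : ∀ t ∈ l, clears 75 21 26 (vecTerms t.2.1 t.2.2 i) = true) :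
    (combination i l).value = q ^ 75 * M₁ ^ 21 * M₂ ^ 26 *
      (l.map fun t => t.1.value * laurent (vecTerms t.2.1 t.2.2 i)).sum := by
  induction l with
  | nil => simp [combination, PExpr.value, ofTerms]
  | cons t l ih =>
    have ht := ofTerms_clear (h t List.mem_cons_self)
    have ih := ih fun s hs => h s (List.mem_cons_of_mem _ hs)
    simp only [combination, List.foldr_cons, PExpr.value, List.map_cons, List.sum_cons] at ih ⊢
    rw [ih, ht]
    ring

/-- The weights `dimFactor` cancel the denominators in `vec_eq`, so the relation becomes five
Laurent polynomial identities. A common monomial factor then leaves ordinary polynomials for the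
zero test. -/
theorem sum_eq_zero_of_isRelation {l : List (PExpr × ℕ × ℕ)} (h : isRelation l = true) :
    (l.map fun t => (t.1.value * dimFactor t.2.1 t.2.2) • vec t.2.1 t.2.2).sum = 0 := by
  have hl : (l.map fun t => (t.1.value * dimFactor t.2.1 t.2.2) • vec t.2.1 t.2.2) =
      l.map fun t => fun i => t.1.value * laurent (vecTerms t.2.1 t.2.2 i) := by
    refine List.map_congr_left fun t _ => ?_
    rw [vec_eq, smul_smul, mul_assoc, mul_inv_cancel₀ (dimFactor_ne_zero _ _), mul_one]
    rfl
  rw [hl]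
  ext i
  obtain ⟨h1, h2⟩ := of_decide_eq_true h i
  have h3 := value_combination i l (List.all_eq_true.mp h1)
  rw [PExpr.value_eq_zero h2] at h3
  have h4 : q ^ 75 * M₁ ^ 21 * M₂ ^ 26 ≠ 0 :=
    mul_ne_zero (mul_ne_zero (pow_ne_zero _ q_ne_zero) (pow_ne_zero _ M₁_ne_zero))
      (pow_ne_zero _ M₂_ne_zero)
  have h5 := (mul_eq_zero.mp h3.symm).resolve_left h4
  rw [← Pi.evalAddMonoidHom_apply (fun _ : Fin 5 => K) i (List.sum _), map_list_sum, List.map_map]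
  exact h5

/-- The product of a list of expressions. -/
def PExpr.prod : List PExpr → PExpr
  | [] => .terms [⟨1, 0, 0, 0⟩]
  | [a] => a
  | a :: b :: l => .mul a (PExpr.prod (b :: l))

/-- The expression `c * q ^ i * M₁ ^ j * M₂ ^ k`. -/
def termExpr (c : ℤ) (i j k : ℕ) : PExpr := .terms [⟨c, i, j, k⟩]

theorem value_termExpr (c : ℤ) (i j k : ℕ) :
    (termExpr c i j k).value = c * q ^ i * M₁ ^ j * M₂ ^ k := by
  simp [termExpr, PExpr.value, ofTerms, Mono.val]

/-- The coefficients of the relation expressing that `P₁` annihilates the class of `1`. -/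
def relP₁ : List (PExpr × ℕ × ℕ) :=
  [(.prod [termExpr (-1) 6 3 1, linExpr 5 1 2, .terms terms₁.1], 2, 0),
   (.prod [termExpr (-1) 4 1 1, .terms [⟨1, 0, 1, 0⟩, ⟨-1, 0, 0, 1⟩], .terms terms₆.1], 1, 1),
   (.prod [termExpr (1) 6 1 3, linExpr 5 2 1, .terms (terms₁.1.map Mono.swap)], 0, 2),
   (.prod [termExpr (1) 0 0 1, linExpr 5 2 1, .terms terms₇.1], 1, 0),
   (.prod [termExpr (-1) 0 1 0, linExpr 5 1 2, .terms (terms₇.1.map Mono.swap)], 0, 1),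
   (.prod [termExpr (1) 3 0 0, .terms [⟨1, 0, 1, 0⟩, ⟨-1, 0, 0, 1⟩], .terms terms₂.1], 0, 0)]

theorem isRelation_P₁ : isRelation relP₁ = true := by
  decide +kernel

/-- The coefficients of the relation expressing that `P₂` annihilates the class of `1`. -/
def relP₂ : List (PExpr × ℕ × ℕ) :=
  [(.prod [termExpr (-1) 21 3 7, linExpr 5 1 2, .terms terms₁.1], 0, 3),
   (.prod [termExpr (1) 7 2 3, linExpr 1 1 0, linExpr 6 1 2, .terms terms₈.1], 1, 1),
   (.prod [termExpr (1) 6 0 3, .terms terms₁₆.1], 0, 2),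
   (.prod [termExpr (1) 8 2 2, linExpr 1 1 0, linExpr 6 1 2, .terms terms₃.1], 1, 0),
   (.prod [linExpr 5 1 2, .terms terms₁₄.1], 0, 1),
   (.prod [termExpr (-1) 2 0 0, .terms terms₉.1], 0, 0)]

theorem isRelation_P₂ : isRelation relP₂ = true := by
  decide +kernel

/-- The coefficients of the relation expressing that `P₃` annihilates the class of `1`. -/
def relP₃ : List (PExpr × ℕ × ℕ) :=
  [(.prod [termExpr (-1) 17 3 5, linExpr 5 1 2, .terms terms₁.1], 1, 2),
   (.prod [termExpr (1) 5 1 2, linExpr 6 1 2, .terms terms₁₂.1], 1, 1),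
   (.prod [termExpr (1) 6 0 3, .terms terms₁₃.1], 0, 2),
   (.prod [termExpr (1) 7 1 2, .terms terms₁₁.1], 1, 0),
   (.prod [termExpr (-1) 0 0 0, linExpr 5 1 2, .terms terms₁₅.1], 0, 1),
   (.prod [termExpr (1) 2 0 0, linExpr 6 1 2, .terms terms₄.1], 0, 0)]

theorem isRelation_P₃ : isRelation relP₃ = true := by
  decide +kernel

/-- The coefficients of the relation expressing that `Q₁` annihilates the class of `1`. -/
def relQ₁ : List (PExpr × ℕ × ℕ) :=
  [(.prod [termExpr (1) 47 5 10, linExpr 6 1 2, linExpr 7 1 2, .terms terms₅.1], 0, 5),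
   (.prod [termExpr (-1) 24 2 6, linExpr 6 1 2, .terms terms₂₀.1], 0, 4),
   (.prod [termExpr (1) 9 0 3, linExpr 9 1 2, .terms terms₂₃.1], 0, 3),
   (.prod [linExpr 7 1 2, .terms terms₂₄.1], 0, 2),
   (.prod [termExpr (1) 2 0 0, linExpr 10 1 2, .terms terms₁₈.1], 0, 1),
   (.prod [termExpr (-1) 6 0 0, linExpr 9 1 2, linExpr 10 1 2, .terms terms₁₀.1], 0, 0)]

theorem isRelation_Q₁ : isRelation relQ₁ = true := by
  decide +kernel

/-- The coefficients of the relation expressing that `Q₂` annihilates the class of `1`. -/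
def relQ₂ : List (PExpr × ℕ × ℕ) :=
  [(.prod [termExpr (1) 8 3 2, linExpr 1 0 0, .terms [⟨1, 2, 2, 0⟩, ⟨1, 1, 1, 0⟩, ⟨1, 0, 0, 0⟩], linExpr 1 1 0, linExpr 6 1 2, linExpr 7 1 2, linExpr 8 1 2, .terms terms₅.1], 1, 0),
   (.prod [termExpr (-1) 37 5 10, linExpr 6 1 2, .terms terms₈.1], 0, 4),
   (.prod [termExpr (1) 18 2 6, .terms terms₁₉.1], 0, 3),
   (.prod [termExpr (-1) 6 0 3, linExpr 7 1 2, .terms terms₂₁.1], 0, 2),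
   (.prod [termExpr (-1) 0 0 0, .terms terms₂₂.1], 0, 1),
   (.prod [termExpr (1) 2 0 0, linExpr 8 1 2, .terms terms₁₇.1], 0, 0)]

theorem isRelation_Q₂ : isRelation relQ₂ = true := by
  decide +kernel

set_option linter.unusedSimpArgs false

theorem add_smul_congr {a b : K} {x y v : Fin 5 → K} (h : x = y) (h' : a = b) :
    x + a • v = y + b • v := by rw [h, h']

theorem rho_L₁_pow (a : ℕ) : rho (L₁ ^ a) = vec a 0 := by
  rw [← rho_mono, pow_zero, mul_one]

theorem rho_L₂_pow (b : ℕ) : rho (L₂ ^ b) = vec 0 b := by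
  rw [← rho_mono, pow_zero, one_mul]

theorem rho_L₁ : rho L₁ = vec 1 0 := by
  rw [← rho_L₁_pow, pow_one]

theorem rho_L₂ : rho L₂ = vec 0 1 := by
  rw [← rho_L₂_pow, pow_one]

theorem rho_L₁_mul_L₂_pow (b : ℕ) : rho (L₁ * L₂ ^ b) = vec 1 b := by
  rw [← rho_mono, pow_one]

theorem rho_L₁_mul_L₂ : rho (L₁ * L₂) = vec 1 1 := by
  rw [← rho_L₁_mul_L₂_pow, pow_one]

theorem rho_one : rho 1 = vec 0 0 := by
  rw [← rho_mono, pow_zero, pow_zero, one_mul]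

/-- The coefficient of L₁^a L₂^b in P₁ contains the full factor `dimFactor a b`; what remains is the
entry of `relP₁`. -/
theorem rho_P₁ : rho P₁ = 0 := by
  have h := sum_eq_zero_of_isRelation isRelation_P₁
  -- No auxiliary factor is needed here; the scalar 1 takes the place of the factor needed for P₂,
  -- Q₁ and Q₂.
  have hg : (1 : K) ≠ 0 := one_ne_zero
  have h1 : (1 : K) • rho P₁ = 0 := by
    rw [← h, P₁]
    simp only [map_add, map_sub, rho_smul, rho_L₁_pow, rho_L₂_pow, rho_L₁, rho_L₂, rho_L₁_mul_L₂,
      rho_L₁_mul_L₂_pow, rho_one, relP₁, List.map_cons, List.map_nil, List.sum_cons, List.sum_nil,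
      PExpr.prod, PExpr.value, value_termExpr, value_linExpr, ofTerms_swap, ← terms₁.2, ← terms₂.2, ← terms₆.2, ← terms₇.2]
    simp only [smul_add, smul_sub, smul_smul, add_zero, sub_eq_add_neg, ← neg_smul, ← add_assoc]
    simp only [dimFactor, ofTerms, Mono.val, List.map_cons, List.map_nil, List.sum_cons,
      List.sum_nil]
    -- Both sides are combinations of the same six vectors in the same order, so the coefficients
    -- can be compared one at a time.
    iterate 5 refine add_smul_congr ?_ ?_
    on_goal 1 => refine congrArg (· • _) ?_
    all_goals
      push_cast
      ring
  exact (smul_eq_zero.mp h1).resolve_left hg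

theorem rho_P₂ : rho P₂ = 0 := by
  have h := sum_eq_zero_of_isRelation isRelation_P₂
  -- The coefficients of pure powers of L₂ in P₂ lack the factor qM₁ - 1 of `dimFactor 0 b`. The
  -- operator is therefore multiplied by it, which explains the extra `linExpr 1 1 0` at the terms
  -- with L₁ in `relP₂`.
  have hg : (q * M₁ - 1) ≠ 0 := (by simpa using lin_ne_zero 1 1 0 (by omega))
  have h1 : (q * M₁ - 1) • rho P₂ = 0 := by
    rw [← h, P₂]
    simp only [map_add, map_sub, rho_smul, rho_L₁_pow, rho_L₂_pow, rho_L₁, rho_L₂, rho_L₁_mul_L₂,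
      rho_L₁_mul_L₂_pow, rho_one, relP₂, List.map_cons, List.map_nil, List.sum_cons, List.sum_nil,
      PExpr.prod, PExpr.value, value_termExpr, value_linExpr, ofTerms_swap, ← terms₁.2, ← terms₃.2, ← terms₈.2, ← terms₉.2, ← terms₁₄.2, ← terms₁₆.2]
    simp only [smul_add, smul_sub, smul_smul, add_zero, sub_eq_add_neg, ← neg_smul, ← add_assoc]
    simp only [dimFactor, ofTerms, Mono.val, List.map_cons, List.map_nil, List.sum_cons,
      List.sum_nil]
    iterate 5 refine add_smul_congr ?_ ?_
    on_goal 1 => refine congrArg (· • _) ?_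
    all_goals
      push_cast
      ring
  exact (smul_eq_zero.mp h1).resolve_left hg

theorem rho_P₃ : rho P₃ = 0 := by
  have h := sum_eq_zero_of_isRelation isRelation_P₃
  have hg : (1 : K) ≠ 0 := one_ne_zero
  have h1 : (1 : K) • rho P₃ = 0 := by
    rw [← h, P₃]
    simp only [map_add, map_sub, rho_smul, rho_L₁_pow, rho_L₂_pow, rho_L₁, rho_L₂, rho_L₁_mul_L₂,
      rho_L₁_mul_L₂_pow, rho_one, relP₃, List.map_cons, List.map_nil, List.sum_cons, List.sum_nil,
      PExpr.prod, PExpr.value, value_termExpr, value_linExpr, ofTerms_swap, ← terms₁.2, ← terms₄.2, ← terms₁₁.2, ← terms₁₂.2, ← terms₁₃.2, ← terms₁₅.2]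
    simp only [smul_add, smul_sub, smul_smul, add_zero, sub_eq_add_neg, ← neg_smul, ← add_assoc]
    simp only [dimFactor, ofTerms, Mono.val, List.map_cons, List.map_nil, List.sum_cons,
      List.sum_nil]
    iterate 5 refine add_smul_congr ?_ ?_
    on_goal 1 => refine congrArg (· • _) ?_
    all_goals
      push_cast
      ring
  exact (smul_eq_zero.mp h1).resolve_left hg

theorem rho_Q₁ : rho Q₁ = 0 := by
  have h := sum_eq_zero_of_isRelation isRelation_Q₁
  -- As for P₂: Q₁ involves only powers of L₂, and none of its coefficients displays the factor qM₁
  -- - 1 of `dimFactor 0 b`.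
  have hg : (q * M₁ - 1) ≠ 0 := (by simpa using lin_ne_zero 1 1 0 (by omega))
  have h1 : (q * M₁ - 1) • rho Q₁ = 0 := by
    rw [← h, Q₁]
    simp only [map_add, map_sub, rho_smul, rho_L₁_pow, rho_L₂_pow, rho_L₁, rho_L₂, rho_L₁_mul_L₂,
      rho_L₁_mul_L₂_pow, rho_one, relQ₁, List.map_cons, List.map_nil, List.sum_cons, List.sum_nil,
      PExpr.prod, PExpr.value, value_termExpr, value_linExpr, ofTerms_swap, ← terms₅.2, ← terms₁₀.2, ← terms₁₈.2, ← terms₂₀.2, ← terms₂₃.2, ← terms₂₄.2]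
    simp only [smul_add, smul_sub, smul_smul, add_zero, sub_eq_add_neg, ← neg_smul, ← add_assoc]
    simp only [dimFactor, ofTerms, Mono.val, List.map_cons, List.map_nil, List.sum_cons,
      List.sum_nil]
    iterate 5 refine add_smul_congr ?_ ?_
    on_goal 1 => refine congrArg (· • _) ?_
    all_goals
      push_cast
      ring
  exact (smul_eq_zero.mp h1).resolve_left hg

theorem rho_Q₂ : rho Q₂ = 0 := by
  have h := sum_eq_zero_of_isRelation isRelation_Q₂
  have hg : (q * M₁ - 1) ≠ 0 := (by simpa using lin_ne_zero 1 1 0 (by omega))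
  have h1 : (q * M₁ - 1) • rho Q₂ = 0 := by
    rw [← h, Q₂]
    simp only [map_add, map_sub, rho_smul, rho_L₁_pow, rho_L₂_pow, rho_L₁, rho_L₂, rho_L₁_mul_L₂,
      rho_L₁_mul_L₂_pow, rho_one, relQ₂, List.map_cons, List.map_nil, List.sum_cons, List.sum_nil,
      PExpr.prod, PExpr.value, value_termExpr, value_linExpr, ofTerms_swap, ← terms₅.2, ← terms₈.2, ← terms₁₇.2, ← terms₁₉.2, ← terms₂₁.2, ← terms₂₂.2]
    simp only [smul_add, smul_sub, smul_smul, add_zero, sub_eq_add_neg, ← neg_smul, ← add_assoc]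
    simp only [dimFactor, ofTerms, Mono.val, List.map_cons, List.map_nil, List.sum_cons,
      List.sum_nil]
    iterate 5 refine add_smul_congr ?_ ?_
    on_goal 1 => refine congrArg (· • _) ?_
    all_goals
      push_cast
      ring
  exact (smul_eq_zero.mp h1).resolve_left hg

/-! ### Linear independence of the classes of five monomials -/

/-- A left inverse modulo p makes the determinant a unit modulo p, and 0 is not a unit once p > 1.
Primality plays no role, and no determinant is ever computed. -/
theorem det_ne_zero_of_mul_modEq_one {n : Type*} [Fintype n] [DecidableEq n] {A B : Matrix n n ℤ}
    (p : ℕ) (hp : 1 < p) (h : ∀ i j, ((B * A) i j - (1 : Matrix n n ℤ) i j) % p = 0) :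
    A.det ≠ 0 := by
  have : Fact (1 < p) := ⟨hp⟩
  have h1 : (B.map (Int.castRingHom (ZMod p))) * (A.map (Int.castRingHom (ZMod p))) = 1 := by
    rw [← Matrix.map_mul]
    ext i j
    have hij := (ZMod.intCast_zmod_eq_zero_iff_dvd _ p).mpr (Int.dvd_of_emod_eq_zero (h i j))
    rw [Int.cast_sub, sub_eq_zero] at hij
    rw [Matrix.map_apply, eq_intCast, hij, Matrix.one_apply, Matrix.one_apply]
    split_ifs <;> simp
  intro h0
  have h2 := congrArg Matrix.det h1
  rw [Matrix.det_mul, ← RingHom.mapMatrix_apply _ A, ← RingHom.map_det, h0, map_zero, mul_zero,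
    Matrix.det_one] at h2
  exact zero_ne_one h2

/-- Determinants commute with ring homomorphisms: a nonzero value at one integer point makes the
polynomial determinant nonzero, and `PExpr.eval₂Hom_injective` carries this into `K`. -/
theorem PExpr.det_value_ne_zero {n : Type*} [Fintype n] [DecidableEq n] (A : Matrix n n PExpr)
    (a b c : ℕ) (h : (A.map (PExpr.intValue a b c)).det ≠ 0) : (A.map PExpr.value).det ≠ 0 := by
  have h1 : A.map (PExpr.intValue a b c) = (A.map PExpr.poly).map (eval ![2 ^ a, 2 ^ b, 2 ^ c]) := by
    ext i j
    simp only [Matrix.map_apply, PExpr.intValue_eq]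
  have h2 : A.map PExpr.value =
      (A.map PExpr.poly).map (eval₂Hom (Int.castRingHom K) ![q, M₁, M₂]) := by
    ext i j
    simp only [Matrix.map_apply, PExpr.value_eq]
  rw [h1, ← RingHom.mapMatrix_apply, ← RingHom.map_det] at h
  rw [h2, ← RingHom.mapMatrix_apply, ← RingHom.map_det]
  have hp : (A.map PExpr.poly).det ≠ 0 := fun h0 => h (by rw [h0, map_zero])
  exact fun h0 => hp (PExpr.eval₂Hom_injective (by rw [h0, map_zero]))

/-- The exponents of the monomials below the staircase for the total degree lexicographic order. -/
def stdExps : Fin 5 → ℕ × ℕ := ![(0, 0), (0, 1), (1, 0), (0, 2), (1, 1)]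

/-- The matrix formed by the vectors `vec a b` for `(a, b)` in `stdExps`, without denominators. -/
def vecMatrix : Matrix (Fin 5) (Fin 5) PExpr := fun s i =>
  .terms (clear 30 20 20 (vecTerms (stdExps s).1 (stdExps s).2 i))

/-- The inverse of `vecMatrix` modulo `101`, at `q = 2`, `M₁ = 2 ^ 3`, `M₂ = 2 ^ 5`. -/
def vecMatrixInv : Matrix (Fin 5) (Fin 5) ℤ :=
  !![14, 0, 0, 0, 0; 77, 73, 82, 63, 83; 3, 91, 34, 81, 84; 41, 59, 73, 59, 36;
    61, 47, 30, 28, 57]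

theorem vecMatrixInv_check : ∀ i j : Fin 5,
    (((vecMatrixInv i 0 * PExpr.intValue 1 3 5 (vecMatrix 0 j) +
      (vecMatrixInv i 1 * PExpr.intValue 1 3 5 (vecMatrix 1 j) +
      (vecMatrixInv i 2 * PExpr.intValue 1 3 5 (vecMatrix 2 j) +
      (vecMatrixInv i 3 * PExpr.intValue 1 3 5 (vecMatrix 3 j) +
      vecMatrixInv i 4 * PExpr.intValue 1 3 5 (vecMatrix 4 j))))) -
      if i = j then 1 else 0) % (101 : ℤ)) = 0 := by
  decide +kernel

theorem vecMatrix_clears : ∀ s i : Fin 5,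
    clears 30 20 20 (vecTerms (stdExps s).1 (stdExps s).2 i) = true := by
  decide +kernel

theorem det_vecMatrix_ne_zero : (vecMatrix.map PExpr.value).det ≠ 0 := by
  apply PExpr.det_value_ne_zero vecMatrix 1 3 5
  apply det_ne_zero_of_mul_modEq_one (B := vecMatrixInv) 101 (by norm_num)
  intro i j
  have h := vecMatrixInv_check i j
  simp only [Matrix.mul_apply, Fin.sum_univ_five, Matrix.one_apply, Matrix.map_apply]
  simpa only [add_assoc, Nat.cast_ofNat] using h

/-- The rows of `vecMatrix` are these vectors up to nonzero scalars: the denominators `dimFactor`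
and the clearing monomial. This is the lower bound 5 for the rank of `annihilator`. -/
theorem vec_linearIndependent :
    LinearIndependent K fun s : Fin 5 => vec (stdExps s).1 (stdExps s).2 := by
  rw [Fintype.linearIndependent_iff]
  intro c hc
  have hD := fun s : Fin 5 => dimFactor_ne_zero (stdExps s).1 (stdExps s).2
  -- Each unknown coefficient absorbs the denominator of its own vector; the clearing monomial is
  -- common to all rows.
  have h0 : Matrix.vecMul (fun s => c s * (dimFactor (stdExps s).1 (stdExps s).2)⁻¹)
      (vecMatrix.map PExpr.value) = 0 := by
    ext i
    have hi := congrFun hc i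
    simp only [Finset.sum_apply, Pi.smul_apply, vec_eq, smul_eq_mul, Pi.zero_apply] at hi
    simp only [Matrix.vecMul, dotProduct, Matrix.map_apply, vecMatrix, PExpr.value,
      ofTerms_clear (vecMatrix_clears _ i), Pi.zero_apply]
    rw [← mul_zero (q ^ 30 * M₁ ^ 20 * M₂ ^ 20), ← hi, Finset.mul_sum]
    exact Finset.sum_congr rfl fun s _ => by ring
  intro s
  have hs := congrFun (Matrix.eq_zero_of_vecMul_eq_zero det_vecMatrix_ne_zero h0) s
  exact (mul_eq_zero.mp hs).resolve_right (inv_ne_zero (hD s))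

/-! ### The symmetry `τ` in the representation -/

theorem tauK_tauK (x : K) : tauK (tauK x) = x := by
  have h : (tauK : K →+* K).comp (tauK : K →+* K) = RingHom.id K := by
    apply hom_ext <;> simp [tauK_q, tauK_M₁, tauK_M₂]
  exact DFunLike.congr_fun h x

/-- The semilinear involution of `K ^ 5` corresponding to `τ`. -/
def tauV : (Fin 5 → K) →+ (Fin 5 → K) where
  toFun v i := tauK (v (swapIdx i))
  map_zero' := by ext i; simp
  map_add' v w := by ext i; simp

theorem tauV_apply (v : Fin 5 → K) (i : Fin 5) : tauV v i = tauK (v (swapIdx i)) := rfl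

theorem swapIdx_swapIdx : ∀ i, swapIdx (swapIdx i) = i := by decide

theorem tauV_tauV (v : Fin 5 → K) : tauV (tauV v) = v := by
  ext i
  rw [tauV_apply, tauV_apply, tauK_tauK, swapIdx_swapIdx]

theorem tauV_smul (c : K) (v : Fin 5 → K) : tauV (c • v) = tauK c • tauV v := by
  ext i
  simp [tauV_apply]

theorem swapExpo_expo (a b : ℕ) : swapExpo (expo a b) = expo b a := by
  ext i; fin_cases i <;> simp [swapExpo_zero, swapExpo_one]

/-- The matrix of L₂ was defined from that of L₁ by exchanging M₁ with M₂ and permuting coordinates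
by `swapIdx`, so conjugation by `tauV` carries one action to the other. -/
theorem tauV_actL₁ (v : Fin 5 → K) : tauV (actL₁ v) = actL₂ (tauV v) := by
  ext i
  have hs : Function.Bijective swapIdx :=
    Function.Involutive.bijective swapIdx_swapIdx
  rw [tauV_apply, actL₁, actL₂, semilinear_apply, semilinear_apply, map_sum,
    ← hs.sum_comp]
  refine Finset.sum_congr rfl fun j _ => ?_
  rw [map_mul, tauK_shift, swapExpo_expo, tauV_apply, matL₂, laurent_swap]

theorem tauV_actL₂ (v : Fin 5 → K) : tauV (actL₂ v) = actL₁ (tauV v) := by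
  rw [← tauV_tauV (actL₁ (tauV v)), tauV_actL₁, tauV_tauV]

theorem tauV_vec (a b : ℕ) : tauV (vec a b) = vec b a := by
  induction a with
  | zero =>
    induction b with
    | zero =>
      -- The cyclic vector is fixed: its denominator is symmetric in M₁ and M₂, and `swapIdx` fixes
      -- the index 0.
      have h : tauK (dimFactor 0 0) = dimFactor 0 0 := by
        simp only [dimFactor, map_mul, map_sub, map_pow, map_one, tauK_q, tauK_M₁, tauK_M₂]
        ring
      rw [vec, pow_zero, pow_zero, AddMonoid.End.one_apply, AddMonoid.End.one_apply, tauV_smul,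
        map_inv₀, h]
      congr 1
      ext i
      fin_cases i <;> simp [tauV_apply, swapIdx]
    | succ b ih => rw [← actL₂_vec, tauV_actL₂, ih, actL₁_vec]
  | succ a ih => rw [← actL₁_vec, tauV_actL₁, ih, actL₂_vec]

/-- Consequently the annihilator is τ-stable, which yields the symmetry of `J` without rewriting
τ(P₂) and τ(P₃) in terms of the generators. -/
theorem rho_tau (P : W) : rho (tau P) = tauV (rho P) := by
  induction P using SkewMonoidAlgebra.induction_on' with
  | single g a =>
    have h := tau_single g.toAdd a
    rw [ofAdd_toAdd] at h
    rw [h, rho_single, rho_single, tauV_smul, tauV_vec]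
    simp [swapExpo_zero, swapExpo_one]
  | add f g hf hg => rw [map_add, map_add, map_add, map_add, hf, hg]

theorem tau_tau (P : W) : tau (tau P) = P := by
  induction P using SkewMonoidAlgebra.induction_on' with
  | single g a =>
    have h := tau_single g.toAdd a
    rw [ofAdd_toAdd] at h
    have h2 : swapExpo (swapExpo g.toAdd) = g.toAdd := by
      ext i; fin_cases i <;> simp [swapExpo_zero, swapExpo_one]
    rw [h, tau_single, tauK_tauK, h2, ofAdd_toAdd]
  | add f g hf hg => rw [map_add, map_add, hf, hg]

theorem tau_smul (c : K) (P : W) : tau (c • P) = tauK c • tau P := by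
  rw [← coef_mul, ← coef_mul, map_mul, coef_apply, coef_apply, ← ofAdd_zero, tau_single, map_zero]

theorem tau_L₁ : tau L₁ = L₂ := by
  rw [L₁, tau_single, swapExpo_expo, map_one, L₂]

theorem tau_L₂ : tau L₂ = L₁ := by
  rw [← tau_L₁, tau_tau]

/-- The test whether the polynomial with the given terms is symmetric. -/
def isSymmetric (l : List Mono) : Bool :=
  (PExpr.add (.terms (l.map Mono.swap)) (.mul (.terms [⟨-1, 0, 0, 0⟩]) (.terms l))).isZero

theorem tauK_eq_of_isSymmetric {l : List Mono} (h : isSymmetric l = true) :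
    tauK (ofTerms l) = ofTerms l := by
  have h1 := PExpr.value_eq_zero h
  simp only [PExpr.value, ofTerms_swap] at h1
  rw [← sub_eq_zero, ← h1]
  simp [ofTerms, Mono.val]
  ring

theorem tauK_F₂ : tauK F₂ = F₂ := by
  rw [terms₂.2]
  exact tauK_eq_of_isSymmetric (by decide +kernel)

theorem tauK_F₆ : tauK F₆ = F₆ := by
  rw [terms₆.2]
  exact tauK_eq_of_isSymmetric (by decide +kernel)

/-- The hypotheses pair the coefficients as τ does: L₁² with L₂², L₁ with L₂, and L₁L₂ and 1 with
themselves. -/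
theorem eq_neg_of_smul_eq {R M : Type*} [CommRing R] [AddCommGroup M] [Module R M]
    {u v w x y z : M} {a b c d e f a' b' c' d' e' f' : R} (ha : a' = -c) (hb : b' = -b) (hc : c' = -a) (hd : d' = -e)
    (he : e' = -d) (hf : f' = -f) :
    a' • w - b' • v + c' • u + d' • y + e' • x + f' • z =
      -(a • u - b • v + c • w + d • x + e • y + f • z) := by
  rw [ha, hb, hc, hd, he, hf]
  module

/-- For L₁L₂ and 1 the sign comes from the antisymmetric factor M₁ - M₂, as F₆ and F₂ are symmetric.
The other coefficients are exchanged in pairs with opposite signs. -/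
theorem tau_P₁ : tau P₁ = -P₁ := by
  simp only [P₁, map_add, map_sub, tau_smul, map_mul, map_pow, map_neg, map_one, tau_L₁, tau_L₂,
    tauK_q, tauK_M₁, tauK_M₂, tauK_tauK, tauK_F₂, tauK_F₆]
  rw [← L₁_mul_L₂]
  apply eq_neg_of_smul_eq <;> ring

/-! ### Nonvanishing of leading coefficients -/

theorem F₁_ne_zero : F₁ ≠ 0 := by
  rw [terms₁.2]
  exact PExpr.value_ne_zero (e := .terms terms₁.1) 1 3 5 (by decide +kernel)

theorem F₅_ne_zero : F₅ ≠ 0 := by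
  rw [terms₅.2]
  exact PExpr.value_ne_zero (e := .terms terms₅.1) 1 3 5 (by decide +kernel)

/-- F₈ is a factor of the coefficient of L₁L₂ in P₂, which is solved for in the second staircase,
where L₂³ replaces L₁L₂ as a basis monomial. -/
theorem F₈_ne_zero : F₈ ≠ 0 := by
  rw [terms₈.2]
  exact PExpr.value_ne_zero (e := .terms terms₈.1) 1 3 5 (by decide +kernel)

/-! ### Monomials and the operators supported on a given set of monomials -/

/-- The monomial with exponent `e`. -/
def mon (e : Expo) : W := SkewMonoidAlgebra.single (.ofAdd e) 1

theorem mon_expo (a b : ℕ) : mon (expo a b) = L₁ ^ a * L₂ ^ b := (L₁_pow_mul_L₂_pow a b).symm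

theorem mon_mul_mon (d e : Expo) : mon d * mon e = mon (d + e) := by
  simp [mon, SkewMonoidAlgebra.single_mul_single]

theorem coeff_mon (d e : Expo) : (mon d).coeff (.ofAdd e) = if d = e then 1 else 0 := by
  classical
  rw [mon, SkewMonoidAlgebra.coeff_single_apply]
  simp

theorem single_eq_smul_mon (g : Multiplicative Expo) (c : K) :
    (SkewMonoidAlgebra.single g c : W) = c • mon g.toAdd := by
  rw [mon, SkewMonoidAlgebra.smul_single, smul_eq_mul, mul_one, ofAdd_toAdd]

theorem mon_mul_smul (e : Expo) (c : K) (P : W) : mon e * c • P = shift e c • (mon e * P) := by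
  induction P using SkewMonoidAlgebra.induction_on' with
  | single g a =>
    rw [SkewMonoidAlgebra.smul_single, mon, SkewMonoidAlgebra.single_mul_single,
      SkewMonoidAlgebra.single_mul_single, SkewMonoidAlgebra.smul_single, smul_eq_shift,
      smul_eq_shift]
    simp
  | add f g hf hg => rw [smul_add, mul_add, mul_add, smul_add, hf, hg]

theorem expo_inj {a b c d : ℕ} : expo a b = expo c d ↔ a = c ∧ b = d := by
  constructor
  · intro h
    exact ⟨by simpa using DFunLike.congr_fun h 0, by simpa using DFunLike.congr_fun h 1⟩
  · rintro ⟨rfl, rfl⟩; rfl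

/-- The operators all of whose monomials have exponents in `S`. -/
def supported (S : Finset (ℕ × ℕ)) : Submodule K W where
  carrier := {P | ∀ e : Expo, (e 0, e 1) ∉ S → P.coeff (.ofAdd e) = 0}
  zero_mem' := fun e _ => by simp
  add_mem' := fun {P Q} hP hQ e he => by
    rw [SkewMonoidAlgebra.coeff_add, Finsupp.add_apply, hP e he, hQ e he, add_zero]
  smul_mem' := fun c P hP e he => by
    rw [SkewMonoidAlgebra.coeff_smul, Finsupp.smul_apply, hP e he, smul_zero]

theorem mon_mem_supported {S : Finset (ℕ × ℕ)} {e : Expo} (h : (e 0, e 1) ∈ S) :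
    mon e ∈ supported S := by
  intro d hd
  rw [coeff_mon, if_neg]
  rintro rfl
  exact hd h

theorem sum_smul_mon (P : W) :
    ∑ g ∈ P.support, P.coeff g • mon g.toAdd = P := by
  conv_rhs => rw [← SkewMonoidAlgebra.sum_single P]
  rw [SkewMonoidAlgebra.sum_def']
  exact Finset.sum_congr rfl fun g _ => (single_eq_smul_mon g _).symm

theorem supported_le {S : Finset (ℕ × ℕ)} {T : Submodule K W}
    (h : ∀ e : Expo, (e 0, e 1) ∈ S → mon e ∈ T) : supported S ≤ T := by
  intro P hP
  rw [← sum_smul_mon P]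
  refine T.sum_mem fun g hg => T.smul_mem _ (h _ ?_)
  by_contra hn
  exact (SkewMonoidAlgebra.mem_support_iff.mp hg) (hP g.toAdd hn)

theorem eq_top_of_mon_mem {T : Submodule K W} (h : ∀ e : Expo, mon e ∈ T) : T = ⊤ := by
  refine Submodule.eq_top_iff'.mpr fun P => ?_
  rw [← sum_smul_mon P]
  exact T.sum_mem fun g _ => T.smul_mem _ (h _)

theorem supported_eq_sum {S : Finset (ℕ × ℕ)} {P : W} (hP : P ∈ supported S) :
    P = ∑ s : S, P.coeff (.ofAdd (expo s.1.1 s.1.2)) • mon (expo s.1.1 s.1.2) := by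
  apply SkewMonoidAlgebra.ext
  intro g
  have hsum : (∑ s : S, P.coeff (.ofAdd (expo s.1.1 s.1.2)) • mon (expo s.1.1 s.1.2)).coeff g =
      ∑ s : S, P.coeff (.ofAdd (expo s.1.1 s.1.2)) *
        (if expo s.1.1 s.1.2 = g.toAdd then 1 else 0) := by
    rw [← SkewMonoidAlgebra.coeffAddEquiv_apply, map_sum, Finsupp.finsetSum_apply]
    refine Finset.sum_congr rfl fun s _ => ?_
    rw [SkewMonoidAlgebra.coeffAddEquiv_apply, SkewMonoidAlgebra.coeff_smul, Finsupp.smul_apply,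
      smul_eq_mul, ← coeff_mon, ofAdd_toAdd]
  rw [hsum]
  by_cases hg : (g.toAdd 0, g.toAdd 1) ∈ S
  · rw [Finset.sum_eq_single ⟨_, hg⟩]
    · simp [expo_eq]
    · rintro ⟨s, hs⟩ _ hne
      rw [if_neg, mul_zero]
      intro h
      apply hne
      rw [← expo_eq g.toAdd, expo_inj] at h
      exact Subtype.ext (Prod.ext h.1 h.2)
    · simp
  · rw [Finset.sum_eq_zero]
    · exact hP g.toAdd hg
    · rintro ⟨s, hs⟩ _
      rw [if_neg, mul_zero]
      intro h
      rw [← expo_eq g.toAdd, expo_inj] at h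
      exact hg (by rw [← h.1, ← h.2]; exact hs)

/-- The sum of a left ideal and the space of operators supported on a set of monomials. -/
def reducible (I : Ideal W) (S : Finset (ℕ × ℕ)) : Submodule K W :=
  I.restrictScalars K ⊔ supported S

theorem ideal_le_reducible {I : Ideal W} {S : Finset (ℕ × ℕ)} {P : W} (h : P ∈ I) :
    P ∈ reducible I S := Submodule.mem_sup_left h

theorem expo_mem_reducible {I : Ideal W} {S : Finset (ℕ × ℕ)} {a b : ℕ} (h : (a, b) ∈ S) :
    mon (expo a b) ∈ reducible I S :=
  Submodule.mem_sup_right (mon_mem_supported (by simpa using h))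

/-- A left ideal absorbs the monomial, and coefficients of the remainder pass through it up to a
shift. Only the products of the monomial with those in S remain to be examined. -/
theorem mon_mul_mem_reducible {I : Ideal W} {S : Finset (ℕ × ℕ)} {d : Expo}
    (h : ∀ s ∈ S, mon (expo s.1 s.2 + d) ∈ reducible I S) {P : W} (hP : P ∈ reducible I S) :
    mon d * P ∈ reducible I S := by
  obtain ⟨X, hX, N, hN, rfl⟩ := Submodule.mem_sup.mp hP
  rw [mul_add]
  refine Submodule.add_mem _ (ideal_le_reducible (I.mul_mem_left _ hX)) ?_
  rw [supported_eq_sum hN, Finset.mul_sum]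
  refine Submodule.sum_mem _ fun s _ => ?_
  rw [mon_mul_smul, mon_mul_mon, add_comm]
  exact Submodule.smul_mem _ _ (h s.1 s.2)

/-- Any monomial is reached from 1 by multiplications by L₂ and L₁, so it is enough that one step
out of S can be reduced back. -/
theorem reducible_eq_top {I : Ideal W} {S : Finset (ℕ × ℕ)} (h0 : (0, 0) ∈ S)
    (h1 : ∀ s ∈ S, mon (expo s.1 s.2 + expo 1 0) ∈ reducible I S)
    (h2 : ∀ s ∈ S, mon (expo s.1 s.2 + expo 0 1) ∈ reducible I S) : reducible I S = ⊤ := by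
  have h : ∀ a b, mon (expo a b) ∈ reducible I S := by
    intro a b
    induction a with
    | zero =>
      induction b with
      | zero => exact expo_mem_reducible h0
      | succ b ih => simpa [mon_mul_mon, expo_add, add_comm] using mon_mul_mem_reducible h2 ih
    | succ a ih => simpa [mon_mul_mon, expo_add, add_comm] using mon_mul_mem_reducible h1 ih
  refine eq_top_of_mon_mem fun e => ?_
  rw [← expo_eq e]
  exact h _ _

/-! ### Bases of the quotient -/

theorem rho_mon (e : Expo) : rho (mon e) = vec (e 0) (e 1) := by
  rw [mon, rho_single, one_smul]
  rfl

theorem rho_supported {S : Finset (ℕ × ℕ)} {P : W} (hP : P ∈ supported S) :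
    rho P = ∑ s : S, P.coeff (.ofAdd (expo s.1.1 s.1.2)) • vec s.1.1 s.1.2 := by
  conv_lhs => rw [supported_eq_sum hP]
  rw [map_sum]
  refine Finset.sum_congr rfl fun s _ => ?_
  rw [rho_smul, rho_mon, expo_zero', expo_one']

theorem span_vec_eq_top :
    Submodule.span K (Set.range fun s : Fin 5 => vec (stdExps s).1 (stdExps s).2) = ⊤ :=
  vec_linearIndependent.span_eq_top_of_card_eq_finrank (by simp)

/-- Five independent vectors in K⁵ form a basis, and each of them is the image of a monomial. -/
theorem rho_surjective : Function.Surjective rho := by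
  intro v
  have hv : v ∈ Submodule.span K (Set.range fun s : Fin 5 => vec (stdExps s).1 (stdExps s).2) := by
    rw [span_vec_eq_top]
    trivial
  obtain ⟨c, rfl⟩ := (Submodule.mem_span_range_iff_exists_fun K).mp hv
  refine ⟨∑ s, c s • mon (expo (stdExps s).1 (stdExps s).2), ?_⟩
  rw [map_sum]
  refine Finset.sum_congr rfl fun s _ => ?_
  rw [rho_smul, rho_mon, expo_zero', expo_one']

/-- If five monomials span the quotient by a left ideal annihilating the class of `1`, they act
linearly independently on the class of `1`. -/
theorem eq_zero_of_rho_eq_zero {I : Ideal W} (hI : I ≤ annihilator) {S : Finset (ℕ × ℕ)}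
    (hS : S.card = 5) (hT : reducible I S = ⊤) {P : W} (hP : P ∈ supported S) (h : rho P = 0) :
    P = 0 := by
  -- Since `rho` is onto and kills I, the images of the monomials in S span K⁵. As there are five of
  -- them, they are independent.
  have hspan : ⊤ ≤ Submodule.span K (Set.range fun s : S => vec s.1.1 s.1.2) := by
    intro v _
    obtain ⟨Q, rfl⟩ := rho_surjective v
    have hQ : Q ∈ reducible I S := by rw [hT]; trivial
    obtain ⟨X, hX, N, hN, rfl⟩ := Submodule.mem_sup.mp hQ
    rw [map_add, mem_annihilator.mp (hI hX), zero_add, rho_supported hN]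
    exact Submodule.sum_mem _ fun s _ => Submodule.smul_mem _ _ (Submodule.subset_span ⟨s, rfl⟩)
  have hli := linearIndependent_of_top_le_span_of_card_eq_finrank hspan (by simp [hS])
  rw [rho_supported hP] at h
  have hc := Fintype.linearIndependent_iff.mp hli _ h
  rw [supported_eq_sum hP]
  exact Finset.sum_eq_zero fun s _ => by
    rw [hc s]
    exact zero_smul K (mon (expo s.1.1 s.1.2))

/-- Reduce an element of the annihilator modulo I: the remainder lies in the span of S and is killed
by `rho`, hence is zero. This identifies an ideal without any Gröbner basis computation. -/
theorem eq_annihilator_of_reducible_eq_top {I : Ideal W} (hI : I ≤ annihilator)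
    {S : Finset (ℕ × ℕ)} (hS : S.card = 5) (hT : reducible I S = ⊤) : I = annihilator := by
  refine le_antisymm hI fun P hP => ?_
  have hQ : P ∈ reducible I S := by rw [hT]; trivial
  obtain ⟨X, hX, N, hN, rfl⟩ := Submodule.mem_sup.mp hQ
  rw [mem_annihilator, map_add, mem_annihilator.mp (hI hX), zero_add] at hP
  rw [eq_zero_of_rho_eq_zero hI hS hT hN hP, add_zero]
  exact hX

/-- The exponents of the monomials below the staircases in the six chambers of the fan. -/
def stair : Fin 6 → Finset (ℕ × ℕ) :=
  ![{(0, 0), (0, 1), (0, 2), (0, 3), (0, 4)}, {(0, 0), (0, 1), (0, 2), (0, 3), (1, 0)},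
    {(0, 0), (0, 1), (1, 0), (0, 2), (1, 1)}, {(0, 0), (1, 0), (0, 1), (2, 0), (1, 1)},
    {(0, 0), (1, 0), (2, 0), (3, 0), (0, 1)}, {(0, 0), (1, 0), (2, 0), (3, 0), (4, 0)}]

theorem card_stair : ∀ i, (stair i).card = 5 := by decide

theorem lin_M₁_ne_zero (a : ℕ) : q ^ a * M₁ - 1 ≠ 0 := by
  simpa using lin_ne_zero a 1 0 (by omega)

theorem lin_M₂_ne_zero (a : ℕ) : q ^ a * M₂ - 1 ≠ 0 := by
  simpa using lin_ne_zero a 0 1 (by omega)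

theorem lin_M₁_M₂_ne_zero (a : ℕ) : q ^ a * M₁ * M₂ - 1 ≠ 0 := by
  simpa using lin_ne_zero a 1 1 (by omega)

theorem lin_M₁_M₂_sq_ne_zero (a : ℕ) : q ^ a * M₁ * M₂ ^ 2 - 1 ≠ 0 := by
  simpa using lin_ne_zero a 1 2 (by omega)

theorem quadratic_ne_zero : q ^ 2 * M₁ ^ 2 + q * M₁ + 1 ≠ 0 := by
  have h := PExpr.value_ne_zero (e := .terms [⟨1, 2, 2, 0⟩, ⟨1, 1, 1, 0⟩, ⟨1, 0, 0, 0⟩]) 1 1 1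
    (by decide +kernel)
  simpa [PExpr.value, ofTerms, Mono.val, add_assoc] using h

theorem q_sub_one_ne_zero : q - 1 ≠ 0 := by
  simpa using lin_ne_zero 1 0 0 (by omega)

/-! ### Reduction to staircases modulo `J` and modulo the ideal of Q₁ and Q₂ -/

theorem P₁_mem_J : P₁ ∈ J := Ideal.subset_span (by simp)
theorem P₂_mem_J : P₂ ∈ J := Ideal.subset_span (by simp)
theorem P₃_mem_J : P₃ ∈ J := Ideal.subset_span (by simp)

theorem J_le_annihilator : J ≤ annihilator := by
  refine Ideal.span_le.mpr ?_
  rintro P (rfl | rfl | rfl)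
  exacts [rho_P₁, rho_P₂, rho_P₃]

theorem span_Q_le_annihilator : Ideal.span {Q₁, Q₂} ≤ annihilator := by
  refine Ideal.span_le.mpr ?_
  rintro P (rfl | rfl)
  exacts [rho_Q₁, rho_Q₂]

section

variable {T : Submodule K W}

/-- The coefficient of L₁² in P₁ is invertible, so L₁² can be solved for. The subspace T is left
general because this and its analogues serve twice: with T = `reducible` they reduce modulo an
ideal; with T = `supported` they show that an operator is not zero. -/
theorem expo_two_zero_mem (hP : P₁ ∈ T) (h00 : mon (expo 0 0) ∈ T) (h01 : mon (expo 0 1) ∈ T)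
    (h10 : mon (expo 1 0) ∈ T) (h02 : mon (expo 0 2) ∈ T) (h11 : mon (expo 1 1) ∈ T) :
    mon (expo 2 0) ∈ T := by
  simp only [mon_expo, pow_zero, pow_one, one_mul, mul_one] at *
  rw [P₁, T.add_mem_iff_left (T.smul_mem _ h00), T.add_mem_iff_left (T.smul_mem _ h01),
    T.add_mem_iff_left (T.smul_mem _ h10), T.add_mem_iff_left (T.smul_mem _ h02),
    T.sub_mem_iff_left (T.smul_mem _ h11), T.smul_mem_iff] at hP
  · exact hP
  · have h1 := lin_M₂_ne_zero 1
    rw [pow_one] at h1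
    simp [q_ne_zero, M₁_ne_zero, M₂_ne_zero, lin_M₁_ne_zero, h1, lin_M₁_M₂_ne_zero,
      lin_M₁_M₂_sq_ne_zero, F₁_ne_zero]

theorem expo_zero_three_mem (hP : P₂ ∈ T) (h00 : mon (expo 0 0) ∈ T) (h01 : mon (expo 0 1) ∈ T)
    (h10 : mon (expo 1 0) ∈ T) (h02 : mon (expo 0 2) ∈ T) (h11 : mon (expo 1 1) ∈ T) :
    mon (expo 0 3) ∈ T := by
  simp only [mon_expo, pow_zero, pow_one, one_mul, mul_one] at *
  rw [P₂, T.sub_mem_iff_left (T.smul_mem _ h00), T.add_mem_iff_left (T.smul_mem _ h01),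
    T.add_mem_iff_left (T.smul_mem _ h10), T.add_mem_iff_left (T.smul_mem _ h02),
    T.add_mem_iff_left (T.smul_mem _ h11), T.smul_mem_iff] at hP
  · exact hP
  · simp [q_ne_zero, M₁_ne_zero, M₂_ne_zero, lin_M₂_ne_zero, lin_M₁_M₂_ne_zero,
      lin_M₁_M₂_sq_ne_zero, F₁_ne_zero]

/-- The same P₂ is now solved for L₁L₂ instead of L₂³; this is the passage across the wall (2,1). -/
theorem expo_one_one_mem (hP : P₂ ∈ T) (h00 : mon (expo 0 0) ∈ T) (h01 : mon (expo 0 1) ∈ T)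
    (h10 : mon (expo 1 0) ∈ T) (h02 : mon (expo 0 2) ∈ T) (h03 : mon (expo 0 3) ∈ T) :
    mon (expo 1 1) ∈ T := by
  simp only [mon_expo, pow_zero, pow_one, one_mul, mul_one] at *
  rw [P₂, T.sub_mem_iff_left (T.smul_mem _ h00), T.add_mem_iff_left (T.smul_mem _ h01),
    T.add_mem_iff_left (T.smul_mem _ h10), T.add_mem_iff_left (T.smul_mem _ h02),
    T.add_mem_iff_right (T.smul_mem _ h03), T.smul_mem_iff] at hP
  · exact hP
  · simp [q_ne_zero, M₁_ne_zero, M₂_ne_zero, lin_M₁_ne_zero, lin_M₂_ne_zero, lin_M₁_M₂_ne_zero,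
      lin_M₁_M₂_sq_ne_zero, F₈_ne_zero]

theorem expo_one_two_mem (hP : P₃ ∈ T) (h00 : mon (expo 0 0) ∈ T) (h01 : mon (expo 0 1) ∈ T)
    (h10 : mon (expo 1 0) ∈ T) (h02 : mon (expo 0 2) ∈ T) (h11 : mon (expo 1 1) ∈ T) :
    mon (expo 1 2) ∈ T := by
  simp only [mon_expo, pow_zero, pow_one, one_mul, mul_one] at *
  rw [P₃, T.add_mem_iff_left (T.smul_mem _ h00), T.sub_mem_iff_left (T.smul_mem _ h01),
    T.add_mem_iff_left (T.smul_mem _ h10), T.add_mem_iff_left (T.smul_mem _ h02),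
    T.add_mem_iff_left (T.smul_mem _ h11), T.smul_mem_iff] at hP
  · exact hP
  · simp [q_ne_zero, M₁_ne_zero, M₂_ne_zero, lin_M₁_ne_zero, lin_M₂_ne_zero, lin_M₁_M₂_ne_zero,
      lin_M₁_M₂_sq_ne_zero, F₁_ne_zero]

theorem expo_zero_five_mem (hP : Q₁ ∈ T) (h00 : mon (expo 0 0) ∈ T) (h01 : mon (expo 0 1) ∈ T)
    (h02 : mon (expo 0 2) ∈ T) (h03 : mon (expo 0 3) ∈ T) (h04 : mon (expo 0 4) ∈ T) :
    mon (expo 0 5) ∈ T := by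
  simp only [mon_expo, pow_zero, pow_one, one_mul] at *
  rw [Q₁, T.sub_mem_iff_left (T.smul_mem _ h00), T.add_mem_iff_left (T.smul_mem _ h01),
    T.add_mem_iff_left (T.smul_mem _ h02), T.add_mem_iff_left (T.smul_mem _ h03),
    T.sub_mem_iff_left (T.smul_mem _ h04), T.smul_mem_iff] at hP
  · exact hP
  · simp [q_ne_zero, M₁_ne_zero, M₂_ne_zero, lin_M₂_ne_zero, lin_M₁_M₂_ne_zero,
      lin_M₁_M₂_sq_ne_zero, F₅_ne_zero]

theorem expo_one_zero_mem (hP : Q₂ ∈ T) (h00 : mon (expo 0 0) ∈ T) (h01 : mon (expo 0 1) ∈ T)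
    (h02 : mon (expo 0 2) ∈ T) (h03 : mon (expo 0 3) ∈ T) (h04 : mon (expo 0 4) ∈ T) :
    mon (expo 1 0) ∈ T := by
  simp only [mon_expo, pow_zero, pow_one, one_mul, mul_one] at *
  rw [Q₂, T.add_mem_iff_left (T.smul_mem _ h00), T.sub_mem_iff_left (T.smul_mem _ h01),
    T.sub_mem_iff_left (T.smul_mem _ h02), T.add_mem_iff_left (T.smul_mem _ h03),
    T.sub_mem_iff_left (T.smul_mem _ h04), T.smul_mem_iff] at hP
  · exact hP
  · have h1 := lin_M₂_ne_zero 1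
    rw [pow_one] at h1
    simp [q_ne_zero, M₁_ne_zero, M₂_ne_zero, lin_M₁_ne_zero, h1, lin_M₁_M₂_ne_zero,
      lin_M₁_M₂_sq_ne_zero, F₅_ne_zero, q_sub_one_ne_zero, quadratic_ne_zero]

end

/-- The border of this staircase is L₁², L₂³, L₁L₂² and L₁²L₂. The P's reduce the first three. -/
theorem reducible_J_stair_two : reducible J (stair 2) = ⊤ := by
  set T := reducible J (stair 2)
  have h00 : mon (expo 0 0) ∈ T := expo_mem_reducible (by decide)
  have h01 : mon (expo 0 1) ∈ T := expo_mem_reducible (by decide)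
  have h10 : mon (expo 1 0) ∈ T := expo_mem_reducible (by decide)
  have h02 : mon (expo 0 2) ∈ T := expo_mem_reducible (by decide)
  have h11 : mon (expo 1 1) ∈ T := expo_mem_reducible (by decide)
  have h20 := expo_two_zero_mem (ideal_le_reducible P₁_mem_J) h00 h01 h10 h02 h11
  have h03 := expo_zero_three_mem (ideal_le_reducible P₂_mem_J) h00 h01 h10 h02 h11
  have h12 := expo_one_two_mem (ideal_le_reducible P₃_mem_J) h00 h01 h10 h02 h11
  have h2 : ∀ s ∈ stair 2, mon (expo s.1 s.2 + expo 0 1) ∈ T := by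
    simp only [stair, expo_add, Fin.isValue, Matrix.cons_val, Finset.forall_mem_insert,
      Finset.mem_singleton, forall_eq]
    exact ⟨h01, h02, h11, h03, h12⟩
  -- L₁²L₂ is L₂ times the reducible L₁², and by `h2` multiplication by L₂ preserves T.
  have h21 : mon (expo 2 1) ∈ T := by
    have h := mon_mul_mem_reducible h2 h20
    rwa [mon_mul_mon, expo_add] at h
  refine reducible_eq_top (by decide) ?_ h2
  simp only [stair, expo_add, Fin.isValue, Matrix.cons_val, Finset.forall_mem_insert,
    Finset.mem_singleton, forall_eq]
  exact ⟨h10, h11, h20, h12, h21⟩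

theorem J_eq_annihilator : J = annihilator :=
  eq_annihilator_of_reducible_eq_top J_le_annihilator (card_stair 2) reducible_J_stair_two

theorem reducible_span_Q_stair_zero : reducible (Ideal.span {Q₁, Q₂}) (stair 0) = ⊤ := by
  set T := reducible (Ideal.span {Q₁, Q₂}) (stair 0)
  have h00 : mon (expo 0 0) ∈ T := expo_mem_reducible (by decide)
  have h01 : mon (expo 0 1) ∈ T := expo_mem_reducible (by decide)
  have h02 : mon (expo 0 2) ∈ T := expo_mem_reducible (by decide)
  have h03 : mon (expo 0 3) ∈ T := expo_mem_reducible (by decide)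
  have h04 : mon (expo 0 4) ∈ T := expo_mem_reducible (by decide)
  have h05 := expo_zero_five_mem (T := T) (ideal_le_reducible (Ideal.subset_span (by simp)))
    h00 h01 h02 h03 h04
  have h10 := expo_one_zero_mem (T := T) (ideal_le_reducible (Ideal.subset_span (by simp)))
    h00 h01 h02 h03 h04
  have h2 : ∀ s ∈ stair 0, mon (expo s.1 s.2 + expo 0 1) ∈ T := by
    simp only [stair, expo_add, Fin.isValue, Matrix.cons_val, Finset.forall_mem_insert,
      Finset.mem_singleton, forall_eq]
    exact ⟨h01, h02, h03, h04, h05⟩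
  -- Q₂ reduces L₁. By `h2`, which rests on Q₁ through L₂⁵, multiplication by L₂ preserves T and
  -- thus reaches every L₁L₂^b.
  have hstep : ∀ b, mon (expo 1 b) ∈ T := by
    intro b
    induction b with
    | zero => exact h10
    | succ b ih =>
      have h := mon_mul_mem_reducible h2 ih
      rwa [mon_mul_mon, expo_add, zero_add, add_comm 1 b] at h
  refine reducible_eq_top (by decide) ?_ h2
  simp only [stair, expo_add, Fin.isValue, Matrix.cons_val, Finset.forall_mem_insert,
    Finset.mem_singleton, forall_eq]
  exact ⟨hstep 0, hstep 1, hstep 2, hstep 3, hstep 4⟩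

theorem span_Q_eq_annihilator : Ideal.span {Q₁, Q₂} = annihilator :=
  eq_annihilator_of_reducible_eq_top span_Q_le_annihilator (card_stair 0)
    reducible_span_Q_stair_zero

/-- Both ideals are the annihilator of the same vector; no expression of one set of generators
through the other is required. -/
theorem J_eq_span_Q : J = Ideal.span {Q₁, Q₂} :=
  J_eq_annihilator.trans span_Q_eq_annihilator.symm

theorem Q₁_mem_J : Q₁ ∈ J := by rw [J_eq_span_Q]; exact Ideal.subset_span (by simp)
theorem Q₂_mem_J : Q₂ ∈ J := by rw [J_eq_span_Q]; exact Ideal.subset_span (by simp)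

theorem reducible_J_stair_zero : reducible J (stair 0) = ⊤ := by
  rw [J_eq_span_Q]
  exact reducible_span_Q_stair_zero

/-- Once P₂ has been solved for L₁L₂, all monomials of `stair 2` are available, and they already
span modulo `J`. -/
theorem reducible_J_stair_one : reducible J (stair 1) = ⊤ := by
  set T := reducible J (stair 1)
  have h00 : mon (expo 0 0) ∈ T := expo_mem_reducible (by decide)
  have h01 : mon (expo 0 1) ∈ T := expo_mem_reducible (by decide)
  have h10 : mon (expo 1 0) ∈ T := expo_mem_reducible (by decide)
  have h02 : mon (expo 0 2) ∈ T := expo_mem_reducible (by decide)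
  have h03 : mon (expo 0 3) ∈ T := expo_mem_reducible (by decide)
  have h11 := expo_one_one_mem (ideal_le_reducible P₂_mem_J) h00 h01 h10 h02 h03
  rw [eq_top_iff, ← reducible_J_stair_two]
  refine sup_le le_sup_left (supported_le fun e he => ?_)
  rw [← expo_eq e]
  generalize e 0 = a at *
  generalize e 1 = b at *
  simp only [stair, Fin.isValue, Matrix.cons_val, Finset.mem_insert, Finset.mem_singleton,
    Prod.mk.injEq] at he
  rcases he with ⟨rfl, rfl⟩ | ⟨rfl, rfl⟩ | ⟨rfl, rfl⟩ | ⟨rfl, rfl⟩ | ⟨rfl, rfl⟩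
  exacts [h00, h01, h10, h02, h11]

theorem tau_mem_J {P : W} (hP : P ∈ J) : tau P ∈ J := by
  rw [J_eq_annihilator, mem_annihilator] at *
  rw [rho_tau, hP, map_zero]

theorem tau_image_J : tau '' (J : Set W) = J := by
  ext P
  constructor
  · rintro ⟨Q, hQ, rfl⟩
    exact tau_mem_J hQ
  · exact fun hP => ⟨tau P, tau_mem_J hP, tau_tau P⟩

theorem tau_mon (e : Expo) : tau (mon e) = mon (swapExpo e) := by
  rw [mon, tau_single, map_one, mon]

/-- Since τ preserves `J`, the reflection of a spanning set of monomials spans. This supplies the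
last three staircases from the first three. -/
theorem reducible_J_swap {S S' : Finset (ℕ × ℕ)} (hS : ∀ s ∈ S, s.swap ∈ S')
    (h : reducible J S = ⊤) : reducible J S' = ⊤ := by
  refine Submodule.eq_top_iff'.mpr fun P => ?_
  have hP : tau P ∈ reducible J S := by rw [h]; trivial
  obtain ⟨X, hX, N, hN, hXN⟩ := Submodule.mem_sup.mp hP
  rw [← tau_tau P, ← hXN, map_add]
  refine Submodule.add_mem _ (ideal_le_reducible (tau_mem_J hX)) ?_
  rw [supported_eq_sum hN, map_sum]
  refine Submodule.sum_mem _ fun s _ => ?_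
  rw [tau_smul, tau_mon, swapExpo_expo]
  exact Submodule.smul_mem _ _ (expo_mem_reducible (hS s.1 s.2))

theorem reducible_J_stair : ∀ i, reducible J (stair i) = ⊤ := by
  intro i
  fin_cases i
  · exact reducible_J_stair_zero
  · exact reducible_J_stair_one
  · exact reducible_J_stair_two
  · exact reducible_J_swap (S' := stair 3) (by decide) reducible_J_stair_two
  · exact reducible_J_swap (S' := stair 4) (by decide) reducible_J_stair_one
  · exact reducible_J_swap (S' := stair 5) (by decide) reducible_J_stair_zero

/-- Every operator is congruent modulo `J` to an operator supported on the staircase. -/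
theorem exists_sub_mem_J (i : Fin 6) (P : W) : ∃ N ∈ supported (stair i), P - N ∈ J := by
  have hP : P ∈ reducible J (stair i) := by rw [reducible_J_stair]; trivial
  obtain ⟨X, hX, N, hN, rfl⟩ := Submodule.mem_sup.mp hP
  exact ⟨N, hN, by rwa [add_sub_cancel_right]⟩

/-- Together with `exists_sub_mem_J` this says that each of the six staircases is a basis of the
quotient. The sections on Gröbner bases and on initial ideals both rest on these two facts. -/
theorem eq_zero_of_mem_J (i : Fin 6) {P : W} (hJ : P ∈ J) (hP : P ∈ supported (stair i)) :
    P = 0 :=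
  eq_zero_of_rho_eq_zero J_le_annihilator (card_stair i) (reducible_J_stair i) hP
    (J_le_annihilator hJ)

/-! ### The rank of `J` -/

/-- The action on the class of `1`, as a linear map. -/
def rhoLin : W →ₗ[K] (Fin 5 → K) where
  toFun := rho
  map_add' := map_add rho
  map_smul' := rho_smul

theorem ker_rhoLin : LinearMap.ker rhoLin = J.restrictScalars K := by
  ext P
  rw [LinearMap.mem_ker, Submodule.restrictScalars_mem, J_eq_annihilator]
  rfl

/-- The representation identifies the quotient by `J` with `K ^ 5`. -/
def quotEquiv : (W ⧸ J) ≃ₗ[K] (Fin 5 → K) :=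
  (Submodule.Quotient.restrictScalarsEquiv K J).symm.trans
    ((Submodule.quotEquivOfEq _ _ ker_rhoLin.symm).trans
      (rhoLin.quotKerEquivOfSurjective rho_surjective))

theorem finite_quot : Module.Finite K (W ⧸ J) := Module.Finite.equiv quotEquiv.symm

theorem finrank_quot : Module.finrank K (W ⧸ J) = 5 := by
  rw [quotEquiv.finrank_eq, Module.finrank_fin_fun]

/-! ### Gröbner bases and staircases -/

theorem toSyn_le_leadExp (m : MonomialOrder (Fin 2)) {P : W} {d : Expo}
    (hd : P.coeff (.ofAdd d) ≠ 0) : m.toSyn d ≤ m.toSyn (leadExp m P) := by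
  rw [leadExp, AddEquiv.apply_symm_apply]
  exact Finset.le_sup (f := fun e : Multiplicative Expo => m.toSyn e.toAdd)
    (SkewMonoidAlgebra.mem_support_iff.mpr hd)

theorem coeff_leadExp_ne_zero (m : MonomialOrder (Fin 2)) {P : W} (hP : P ≠ 0) :
    P.coeff (.ofAdd (leadExp m P)) ≠ 0 := by
  have hs : P.support.Nonempty :=
    Finset.nonempty_iff_ne_empty.mpr fun h => hP (SkewMonoidAlgebra.support_eq_empty.mp h)
  obtain ⟨g, hg, h⟩ := Finset.exists_mem_eq_sup P.support hs fun e => m.toSyn e.toAdd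
  rw [leadExp, h, AddEquiv.symm_apply_apply, ofAdd_toAdd]
  exact SkewMonoidAlgebra.mem_support_iff.mp hg

/-- A finite set of exponents is an initial segment for a monomial order. -/
def IsInitialSegment (m : MonomialOrder (Fin 2)) (S : Finset (ℕ × ℕ)) : Prop :=
  ∀ d e : Expo, (e 0, e 1) ∈ S → m.toSyn d ≤ m.toSyn e → (d 0, d 1) ∈ S

/-- If the leading exponent were in the initial segment, so would be the whole support,
contradicting independence modulo `J`. -/
theorem leadExp_notMem {m : MonomialOrder (Fin 2)} {i : Fin 6}
    (hm : IsInitialSegment m (stair i)) {P : W} (hJ : P ∈ J) (hP : P ≠ 0) :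
    (leadExp m P 0, leadExp m P 1) ∉ stair i := by
  intro h
  refine hP (eq_zero_of_mem_J i hJ fun d hd => ?_)
  by_contra hne
  exact hd (hm _ _ h (toSyn_le_leadExp m hne))

/-- The leading exponent avoids the staircase, so the single extra monomial is the only candidate.
This finds leading monomials without comparing the terms. -/
theorem leadExp_eq {m : MonomialOrder (Fin 2)} {i : Fin 6} (hm : IsInitialSegment m (stair i))
    {P : W} (hJ : P ∈ J) (hP : P ≠ 0) {a b : ℕ} (hS : P ∈ supported (insert (a, b) (stair i))) :
    leadExp m P = expo a b := by
  have h1 := leadExp_notMem hm hJ hP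
  have h2 : (leadExp m P 0, leadExp m P 1) ∈ insert (a, b) (stair i) := by
    by_contra hn
    exact coeff_leadExp_ne_zero m hP (hS _ hn)
  have h3 := (Finset.mem_insert.mp h2).resolve_right h1
  rw [Prod.mk.injEq] at h3
  rw [← expo_eq (leadExp m P), h3.1, h3.2]

theorem isGroebnerBasis_of_leadExp {m : MonomialOrder (Fin 2)} {i : Fin 6}
    (hm : IsInitialSegment m (stair i)) {G : Set W} (hG : G ⊆ J)
    (h : ∀ e : Expo, (e 0, e 1) ∉ stair i → ∃ g ∈ G, g ≠ 0 ∧ leadExp m g ≤ e) :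
    IsGroebnerBasis m G J :=
  ⟨hG, fun _ hJ hP => h _ (leadExp_notMem hm hJ hP)⟩

theorem belowStaircase_eq {m : MonomialOrder (Fin 2)} {i : Fin 6}
    (hm : IsInitialSegment m (stair i)) {G : Set W} (hG : G ⊆ J)
    (h : ∀ e : Expo, (e 0, e 1) ∉ stair i → ∃ g ∈ G, g ≠ 0 ∧ leadExp m g ≤ e) :
    belowStaircase m J = {e | (e 0, e 1) ∈ stair i} := by
  ext e
  constructor
  · intro he
    by_contra hn
    obtain ⟨g, hg, hg0, hle⟩ := h e hn
    exact he g (hG hg) hg0 hle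
  · intro he P hJ hP hle
    exact leadExp_notMem hm hJ hP (hm _ _ he (m.toSyn_monotone hle))

/-! ### The two orders and their initial segments -/

theorem apply_zero_le_of_toLex_le {d e : Expo} (h : toLex d ≤ toLex e) : d 0 ≤ e 0 := by
  by_contra! hlt
  exact absurd h (not_le.mpr (Finsupp.Lex.lt_iff.mpr ⟨0, by simp, hlt⟩))

theorem apply_one_le_of_toLex_le {d e : Expo} (h : toLex d ≤ toLex e) (h0 : d 0 = e 0) :
    d 1 ≤ e 1 := by
  by_contra! hlt
  refine absurd h (not_le.mpr (Finsupp.Lex.lt_iff.mpr ⟨1, fun j hj => ?_, hlt⟩))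
  have hj0 : j = 0 := by omega
  rw [hj0]
  exact h0.symm

theorem isInitialSegment_lex : IsInitialSegment MonomialOrder.lex (stair 0) := by
  intro d e he hle
  rw [MonomialOrder.lex_le_iff] at hle
  have h0 := apply_zero_le_of_toLex_le hle
  have h1 := apply_one_le_of_toLex_le hle
  simp only [stair, Fin.isValue, Matrix.cons_val, Finset.mem_insert, Finset.mem_singleton,
    Prod.mk.injEq] at he ⊢
  omega

theorem isInitialSegment_degLex : IsInitialSegment MonomialOrder.degLex (stair 2) := by
  intro d e he hle
  rw [MonomialOrder.degLex_le_iff, Finsupp.DegLex.le_iff] at hle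
  simp only [ofDegLex_toDegLex, Finsupp.degree_eq_sum, Fin.sum_univ_two] at hle
  have h0 := hle.imp_right fun h => And.imp_right apply_zero_le_of_toLex_le h
  simp only [stair, Fin.isValue, Matrix.cons_val, Finset.mem_insert, Finset.mem_singleton,
    Prod.mk.injEq] at he ⊢
  omega

theorem expo_le {a b : ℕ} {e : Expo} : expo a b ≤ e ↔ a ≤ e 0 ∧ b ≤ e 1 := by
  rw [Finsupp.le_def, Fin.forall_fin_two, expo_zero', expo_one']

theorem expo_mem_supported {S : Finset (ℕ × ℕ)} {a b : ℕ} (h : (a, b) ∈ S) :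
    mon (expo a b) ∈ supported S := mon_mem_supported (by simpa using h)

theorem mem_of_mon_mem_supported {S : Finset (ℕ × ℕ)} {a b : ℕ}
    (h : mon (expo a b) ∈ supported S) : (a, b) ∈ S := by
  by_contra hn
  have h1 := h (expo a b) (by simpa using hn)
  rw [coeff_mon, if_pos rfl] at h1
  exact one_ne_zero h1

/-! ### The leading monomials of the five operators -/

/-- If P₁ were 0, solving it for L₁² would put L₁² into the span of the other five monomials. The
next four lemmas argue alike. -/
theorem P₁_ne_zero : P₁ ≠ 0 := by
  intro h
  have h1 : mon (expo 2 0) ∈ supported (stair 2) :=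
    expo_two_zero_mem (h ▸ Submodule.zero_mem _) (expo_mem_supported (by decide))
      (expo_mem_supported (by decide)) (expo_mem_supported (by decide))
      (expo_mem_supported (by decide)) (expo_mem_supported (by decide))
  exact absurd (mem_of_mon_mem_supported h1) (by decide)

theorem P₂_ne_zero : P₂ ≠ 0 := by
  intro h
  have h1 : mon (expo 0 3) ∈ supported (stair 2) :=
    expo_zero_three_mem (h ▸ Submodule.zero_mem _) (expo_mem_supported (by decide))
      (expo_mem_supported (by decide)) (expo_mem_supported (by decide))
      (expo_mem_supported (by decide)) (expo_mem_supported (by decide))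
  exact absurd (mem_of_mon_mem_supported h1) (by decide)

theorem P₃_ne_zero : P₃ ≠ 0 := by
  intro h
  have h1 : mon (expo 1 2) ∈ supported (stair 2) :=
    expo_one_two_mem (h ▸ Submodule.zero_mem _) (expo_mem_supported (by decide))
      (expo_mem_supported (by decide)) (expo_mem_supported (by decide))
      (expo_mem_supported (by decide)) (expo_mem_supported (by decide))
  exact absurd (mem_of_mon_mem_supported h1) (by decide)

theorem Q₁_ne_zero : Q₁ ≠ 0 := by
  intro h
  have h1 : mon (expo 0 5) ∈ supported (stair 0) :=
    expo_zero_five_mem (h ▸ Submodule.zero_mem _) (expo_mem_supported (by decide))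
      (expo_mem_supported (by decide)) (expo_mem_supported (by decide))
      (expo_mem_supported (by decide)) (expo_mem_supported (by decide))
  exact absurd (mem_of_mon_mem_supported h1) (by decide)

theorem Q₂_ne_zero : Q₂ ≠ 0 := by
  intro h
  have h1 : mon (expo 1 0) ∈ supported (stair 0) :=
    expo_one_zero_mem (h ▸ Submodule.zero_mem _) (expo_mem_supported (by decide))
      (expo_mem_supported (by decide)) (expo_mem_supported (by decide))
      (expo_mem_supported (by decide)) (expo_mem_supported (by decide))
  exact absurd (mem_of_mon_mem_supported h1) (by decide)

section

variable {T : Submodule K W}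

theorem P₁_mem (h00 : mon (expo 0 0) ∈ T) (h01 : mon (expo 0 1) ∈ T) (h10 : mon (expo 1 0) ∈ T)
    (h02 : mon (expo 0 2) ∈ T) (h11 : mon (expo 1 1) ∈ T) (h20 : mon (expo 2 0) ∈ T) :
    P₁ ∈ T := by
  simp only [mon_expo, pow_zero, pow_one, one_mul, mul_one] at *
  exact T.add_mem (T.add_mem (T.add_mem (T.add_mem (T.sub_mem (T.smul_mem _ h20)
    (T.smul_mem _ h11)) (T.smul_mem _ h02)) (T.smul_mem _ h10)) (T.smul_mem _ h01))
    (T.smul_mem _ h00)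

theorem P₂_mem (h00 : mon (expo 0 0) ∈ T) (h01 : mon (expo 0 1) ∈ T) (h10 : mon (expo 1 0) ∈ T)
    (h02 : mon (expo 0 2) ∈ T) (h11 : mon (expo 1 1) ∈ T) (h03 : mon (expo 0 3) ∈ T) :
    P₂ ∈ T := by
  simp only [mon_expo, pow_zero, pow_one, one_mul, mul_one] at *
  exact T.sub_mem (T.add_mem (T.add_mem (T.add_mem (T.add_mem (T.smul_mem _ h03)
    (T.smul_mem _ h11)) (T.smul_mem _ h02)) (T.smul_mem _ h10)) (T.smul_mem _ h01))
    (T.smul_mem _ h00)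

theorem P₃_mem (h00 : mon (expo 0 0) ∈ T) (h01 : mon (expo 0 1) ∈ T) (h10 : mon (expo 1 0) ∈ T)
    (h02 : mon (expo 0 2) ∈ T) (h11 : mon (expo 1 1) ∈ T) (h12 : mon (expo 1 2) ∈ T) :
    P₃ ∈ T := by
  simp only [mon_expo, pow_zero, pow_one, one_mul, mul_one] at *
  exact T.add_mem (T.sub_mem (T.add_mem (T.add_mem (T.add_mem (T.smul_mem _ h12)
    (T.smul_mem _ h11)) (T.smul_mem _ h02)) (T.smul_mem _ h10)) (T.smul_mem _ h01))
    (T.smul_mem _ h00)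

theorem Q₁_mem (h00 : mon (expo 0 0) ∈ T) (h01 : mon (expo 0 1) ∈ T) (h02 : mon (expo 0 2) ∈ T)
    (h03 : mon (expo 0 3) ∈ T) (h04 : mon (expo 0 4) ∈ T) (h05 : mon (expo 0 5) ∈ T) :
    Q₁ ∈ T := by
  simp only [mon_expo, pow_zero, pow_one, one_mul] at *
  exact T.sub_mem (T.add_mem (T.add_mem (T.add_mem (T.sub_mem (T.smul_mem _ h05)
    (T.smul_mem _ h04)) (T.smul_mem _ h03)) (T.smul_mem _ h02)) (T.smul_mem _ h01))
    (T.smul_mem _ h00)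

theorem Q₂_mem (h00 : mon (expo 0 0) ∈ T) (h01 : mon (expo 0 1) ∈ T) (h02 : mon (expo 0 2) ∈ T)
    (h03 : mon (expo 0 3) ∈ T) (h04 : mon (expo 0 4) ∈ T) (h10 : mon (expo 1 0) ∈ T) :
    Q₂ ∈ T := by
  simp only [mon_expo, pow_zero, pow_one, one_mul, mul_one] at *
  exact T.add_mem (T.sub_mem (T.sub_mem (T.add_mem (T.sub_mem (T.smul_mem _ h10)
    (T.smul_mem _ h04)) (T.smul_mem _ h03)) (T.smul_mem _ h02)) (T.smul_mem _ h01))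
    (T.smul_mem _ h00)

end

theorem P_subset_J : {P₁, P₂, P₃} ⊆ (J : Set W) := Ideal.subset_span

theorem Q_subset_J : {Q₁, Q₂} ⊆ (J : Set W) := by
  rw [J_eq_span_Q]
  exact Ideal.subset_span

theorem exists_leadExp_degLex_le {e : Expo} (he : (e 0, e 1) ∉ stair 2) :
    ∃ g ∈ ({P₁, P₂, P₃} : Set W), g ≠ 0 ∧ leadExp MonomialOrder.degLex g ≤ e := by
  have h1 : leadExp MonomialOrder.degLex P₁ = expo 2 0 :=
    leadExp_eq isInitialSegment_degLex P₁_mem_J P₁_ne_zero (P₁_mem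
      (expo_mem_supported (by decide)) (expo_mem_supported (by decide))
      (expo_mem_supported (by decide)) (expo_mem_supported (by decide))
      (expo_mem_supported (by decide)) (expo_mem_supported (by decide)))
  have h2 : leadExp MonomialOrder.degLex P₂ = expo 0 3 :=
    leadExp_eq isInitialSegment_degLex P₂_mem_J P₂_ne_zero (P₂_mem
      (expo_mem_supported (by decide)) (expo_mem_supported (by decide))
      (expo_mem_supported (by decide)) (expo_mem_supported (by decide))
      (expo_mem_supported (by decide)) (expo_mem_supported (by decide)))
  have h3 : leadExp MonomialOrder.degLex P₃ = expo 1 2 :=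
    leadExp_eq isInitialSegment_degLex P₃_mem_J P₃_ne_zero (P₃_mem
      (expo_mem_supported (by decide)) (expo_mem_supported (by decide))
      (expo_mem_supported (by decide)) (expo_mem_supported (by decide))
      (expo_mem_supported (by decide)) (expo_mem_supported (by decide)))
  have hcases : (2 ≤ e 0 ∧ 0 ≤ e 1) ∨ (0 ≤ e 0 ∧ 3 ≤ e 1) ∨ (1 ≤ e 0 ∧ 2 ≤ e 1) := by
    simp only [stair, Fin.isValue, Matrix.cons_val, Finset.mem_insert, Finset.mem_singleton,
      Prod.mk.injEq] at he
    omega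
  rcases hcases with h | h | h
  · exact ⟨P₁, by simp, P₁_ne_zero, h1 ▸ expo_le.mpr h⟩
  · exact ⟨P₂, by simp, P₂_ne_zero, h2 ▸ expo_le.mpr h⟩
  · exact ⟨P₃, by simp, P₃_ne_zero, h3 ▸ expo_le.mpr h⟩

theorem exists_leadExp_lex_le {e : Expo} (he : (e 0, e 1) ∉ stair 0) :
    ∃ g ∈ ({Q₁, Q₂} : Set W), g ≠ 0 ∧ leadExp MonomialOrder.lex g ≤ e := by
  have h1 : leadExp MonomialOrder.lex Q₁ = expo 0 5 :=
    leadExp_eq isInitialSegment_lex Q₁_mem_J Q₁_ne_zero (Q₁_mem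
      (expo_mem_supported (by decide)) (expo_mem_supported (by decide))
      (expo_mem_supported (by decide)) (expo_mem_supported (by decide))
      (expo_mem_supported (by decide)) (expo_mem_supported (by decide)))
  have h2 : leadExp MonomialOrder.lex Q₂ = expo 1 0 :=
    leadExp_eq isInitialSegment_lex Q₂_mem_J Q₂_ne_zero (Q₂_mem
      (expo_mem_supported (by decide)) (expo_mem_supported (by decide))
      (expo_mem_supported (by decide)) (expo_mem_supported (by decide))
      (expo_mem_supported (by decide)) (expo_mem_supported (by decide)))
  have hcases : (0 ≤ e 0 ∧ 5 ≤ e 1) ∨ (1 ≤ e 0 ∧ 0 ≤ e 1) := by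
    simp only [stair, Fin.isValue, Matrix.cons_val, Finset.mem_insert, Finset.mem_singleton,
      Prod.mk.injEq] at he
    omega
  rcases hcases with h | h
  · exact ⟨Q₁, by simp, Q₁_ne_zero, h1 ▸ expo_le.mpr h⟩
  · exact ⟨Q₂, by simp, Q₂_ne_zero, h2 ▸ expo_le.mpr h⟩

theorem isGroebnerBasis_degLex : IsGroebnerBasis MonomialOrder.degLex {P₁, P₂, P₃} J :=
  isGroebnerBasis_of_leadExp isInitialSegment_degLex P_subset_J fun _ => exists_leadExp_degLex_le

theorem isGroebnerBasis_lex : IsGroebnerBasis MonomialOrder.lex {Q₁, Q₂} J :=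
  isGroebnerBasis_of_leadExp isInitialSegment_lex Q_subset_J fun _ => exists_leadExp_lex_le

theorem eq_expo_iff {e : Expo} {a b : ℕ} : e = expo a b ↔ e 0 = a ∧ e 1 = b := by
  rw [← expo_inj, expo_eq]

theorem belowStaircase_degLex : belowStaircase MonomialOrder.degLex J =
    {expo 0 0, expo 0 1, expo 1 0, expo 0 2, expo 1 1} := by
  rw [belowStaircase_eq isInitialSegment_degLex P_subset_J fun _ => exists_leadExp_degLex_le]
  ext e
  simp [stair, eq_expo_iff]

theorem belowStaircase_lex : belowStaircase MonomialOrder.lex J =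
    {expo 0 0, expo 0 1, expo 0 2, expo 0 3, expo 0 4} := by
  rw [belowStaircase_eq isInitialSegment_lex Q_subset_J fun _ => exists_leadExp_lex_le]
  ext e
  simp [stair, eq_expo_iff]

/-! ### Initial ideals -/

theorem weightDeg_eq (w : Fin 2 → ℝ) (e : Expo) : weightDeg w e = w 0 * e 0 + w 1 * e 1 :=
  Fin.sum_univ_two _

theorem weightDeg_add (w : Fin 2 → ℝ) (d e : Expo) :
    weightDeg w (d + e) = weightDeg w d + weightDeg w e := by
  simp only [weightDeg_eq, Finsupp.add_apply]
  push_cast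
  ring

theorem weightDeg_smul (t : ℝ) (w : Fin 2 → ℝ) (e : Expo) :
    weightDeg (t • w) e = t * weightDeg w e := by
  simp only [weightDeg_eq, Pi.smul_apply, smul_eq_mul]
  ring

theorem coeff_initialForm_of_le {w : Fin 2 → ℝ} {P : W} {e : Expo}
    (h : ∀ d : Expo, P.coeff (.ofAdd d) ≠ 0 → weightDeg w d ≤ weightDeg w e) :
    (initialForm w P).coeff (.ofAdd e) = P.coeff (.ofAdd e) := by
  classical
  rw [initialForm, SkewMonoidAlgebra.coeff_ofCoeff, Finsupp.filter_apply, if_pos]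
  exact fun d hd => h d.toAdd (SkewMonoidAlgebra.mem_support_iff.mp hd)

theorem le_of_coeff_initialForm_ne_zero {w : Fin 2 → ℝ} {P : W} {e : Expo}
    (h : (initialForm w P).coeff (.ofAdd e) ≠ 0) :
    P.coeff (.ofAdd e) ≠ 0 ∧
      ∀ d : Expo, P.coeff (.ofAdd d) ≠ 0 → weightDeg w d ≤ weightDeg w e := by
  classical
  rw [initialForm, SkewMonoidAlgebra.coeff_ofCoeff, Finsupp.filter_apply] at h
  split_ifs at h with hc
  · exact ⟨h, fun d hd => hc _ (SkewMonoidAlgebra.mem_support_iff.mpr hd)⟩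
  · exact absurd rfl h

theorem initialForm_smul {t : ℝ} (ht : 0 < t) (w : Fin 2 → ℝ) (P : W) :
    initialForm (t • w) P = initialForm w P := by
  simp only [initialForm, weightDeg_smul, mul_le_mul_iff_right₀ ht]

theorem initialIdeal_smul {t : ℝ} (ht : 0 < t) (w : Fin 2 → ℝ) (I : Ideal W) :
    initialIdeal (t • w) I = initialIdeal w I := by
  have h : initialForm (t • w) = initialForm w := funext (initialForm_smul ht w)
  rw [initialIdeal, initialIdeal, h]

theorem initialForm_eq_mon {w : Fin 2 → ℝ} {P : W} {m : Expo}
    (h1 : ∀ e : Expo, P.coeff (.ofAdd e) ≠ 0 → weightDeg w e ≤ weightDeg w m)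
    (h2 : ∀ e : Expo, weightDeg w e = weightDeg w m →
      P.coeff (.ofAdd e) = (mon m).coeff (.ofAdd e)) :
    initialForm w P = mon m := by
  have hm : P.coeff (.ofAdd m) ≠ 0 := by
    rw [h2 m rfl, coeff_mon, if_pos rfl]
    exact one_ne_zero
  have key : ∀ e : Expo, (initialForm w P).coeff (.ofAdd e) = (mon m).coeff (.ofAdd e) := by
    intro e
    by_cases he : weightDeg w e = weightDeg w m
    · rw [coeff_initialForm_of_le (by rwa [he]), h2 e he]
    · rw [coeff_mon, if_neg (by rintro rfl; exact he rfl)]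
      by_contra hne
      obtain ⟨h3, h4⟩ := le_of_coeff_initialForm_ne_zero hne
      exact he (le_antisymm (h1 e h3) (h4 m hm))
  exact SkewMonoidAlgebra.ext fun g => key g.toAdd

theorem coeff_single_mul_eq (a e : Expo) (c : K) (P : W) :
    (SkewMonoidAlgebra.single (.ofAdd a) c * P : W).coeff (.ofAdd e) =
      if a ≤ e then c * shift a (P.coeff (.ofAdd (e - a))) else 0 := by
  split_ifs with h
  · rw [SkewMonoidAlgebra.coeff_single_mul_aux P (z := .ofAdd (e - a)), smul_eq_shift, toAdd_ofAdd]
    intro b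
    rw [← ofAdd_toAdd b, ← ofAdd_add, Multiplicative.ofAdd.apply_eq_iff_eq,
      Multiplicative.ofAdd.apply_eq_iff_eq]
    constructor
    · rintro rfl; exact (add_tsub_cancel_left _ _).symm
    · intro hb; rw [hb]; exact add_tsub_cancel_of_le h
  · refine SkewMonoidAlgebra.coeff_single_mul_of_not_exists_mul _ _ ?_
    rintro ⟨b, hb⟩
    have he : e = a + b.toAdd := congrArg Multiplicative.toAdd hb
    exact h (he ▸ le_self_add)

/-- An element of the initial ideal and a weight `d` have a common lift: an element of the ideal of
weight at most `d` with the same component of weight `d`. -/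
theorem exists_mem_of_mem_initialIdeal {w : Fin 2 → ℝ} {I : Ideal W} {X : W}
    (hX : X ∈ initialIdeal w I) : ∀ d : ℝ, ∃ P ∈ I,
      (∀ e : Expo, P.coeff (.ofAdd e) ≠ 0 → weightDeg w e ≤ d) ∧
      ∀ e : Expo, weightDeg w e = d → P.coeff (.ofAdd e) = X.coeff (.ofAdd e) := by
  -- Elements of the initial ideal need not be homogeneous, so the induction hypothesis is kept for
  -- all weights d at once; lifts of equal weight can then be added.
  induction hX using Submodule.span_induction with
  | mem X h =>
    obtain ⟨P, hP, rfl⟩ := h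
    intro d
    by_cases hd : ∃ e : Expo, (initialForm w P).coeff (.ofAdd e) ≠ 0 ∧ weightDeg w e = d
    · obtain ⟨e, he, rfl⟩ := hd
      obtain ⟨_, h2⟩ := le_of_coeff_initialForm_ne_zero he
      exact ⟨P, hP, h2, fun e' he' => (coeff_initialForm_of_le (by rwa [he'])).symm⟩
    -- An initial form has nonzero terms in one weight only; for any other d the lift 0 will do.
    · push Not at hd
      refine ⟨0, I.zero_mem, fun e he => absurd rfl he, fun e he => ?_⟩
      by_contra hne
      exact hd e (fun h => hne h.symm) he
  | zero => exact fun d => ⟨0, I.zero_mem, fun e he => absurd rfl he, fun e _ => rfl⟩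
  | add X Y _ _ hX hY =>
    intro d
    obtain ⟨P, hP, hP1, hP2⟩ := hX d
    obtain ⟨Q, hQ, hQ1, hQ2⟩ := hY d
    refine ⟨P + Q, I.add_mem hP hQ, fun e he => ?_, fun e he => ?_⟩
    · by_contra hlt
      refine he ?_
      rw [SkewMonoidAlgebra.coeff_add, Finsupp.add_apply, not_ne_iff.mp (mt (hP1 e) hlt),
        not_ne_iff.mp (mt (hQ1 e) hlt), add_zero]
    · rw [SkewMonoidAlgebra.coeff_add, SkewMonoidAlgebra.coeff_add, Finsupp.add_apply,
        Finsupp.add_apply, hP2 e he, hQ2 e he]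
  | smul R X _ hX =>
    induction R using SkewMonoidAlgebra.induction_on' with
    | single g c =>
      intro d
      -- Multiplication by the term raises all weights by that of g, so the lift is taken in the
      -- correspondingly lower weight.
      obtain ⟨P, hP, hP1, hP2⟩ := hX (d - weightDeg w g.toAdd)
      have hsub : ∀ e : Expo, g.toAdd ≤ e →
          weightDeg w e = weightDeg w g.toAdd + weightDeg w (e - g.toAdd) := by
        intro e he
        rw [← weightDeg_add, add_tsub_cancel_of_le he]
      refine ⟨SkewMonoidAlgebra.single g c * P, I.mul_mem_left _ hP, fun e he => ?_,
        fun e he => ?_⟩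
      · rw [← ofAdd_toAdd g, coeff_single_mul_eq] at he
        split_ifs at he with h
        · have h1 := hP1 (e - g.toAdd) fun h0 => he (by rw [h0, map_zero, mul_zero])
          rw [hsub e h]
          linarith
        · exact absurd rfl he
      · rw [smul_eq_mul, ← ofAdd_toAdd g, coeff_single_mul_eq, coeff_single_mul_eq]
        split_ifs with h
        · rw [hP2 (e - g.toAdd) (by rw [← he, hsub e h]; ring)]
        · rfl
    | add R R' hR hR' =>
      intro d
      obtain ⟨P, hP, hP1, hP2⟩ := hR d
      obtain ⟨Q, hQ, hQ1, hQ2⟩ := hR' d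
      refine ⟨P + Q, I.add_mem hP hQ, fun e he => ?_, fun e he => ?_⟩
      · by_contra hlt
        refine he ?_
        rw [SkewMonoidAlgebra.coeff_add, Finsupp.add_apply, not_ne_iff.mp (mt (hP1 e) hlt),
          not_ne_iff.mp (mt (hQ1 e) hlt), add_zero]
      · rw [add_smul, SkewMonoidAlgebra.coeff_add, SkewMonoidAlgebra.coeff_add, Finsupp.add_apply,
          Finsupp.add_apply, hP2 e he, hQ2 e he]

/-- Every exponent outside `S` has at least the weight of every exponent in `S`. -/
def Dominated (w : Fin 2 → ℝ) (S : Finset (ℕ × ℕ)) : Prop :=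
  ∀ e s : Expo, (e 0, e 1) ∉ S → (s 0, s 1) ∈ S → weightDeg w s ≤ weightDeg w e

/-- Every exponent outside `S` has larger weight than every exponent in `S`. -/
def StrictlyDominated (w : Fin 2 → ℝ) (S : Finset (ℕ × ℕ)) : Prop :=
  ∀ e s : Expo, (e 0, e 1) ∉ S → (s 0, s 1) ∈ S → weightDeg w s < weightDeg w e

/-- Lift the monomial m to P in `J`. Outside monomials weigh at least as much as m, those in P at
most as much, and in the weight of m only m occurs. Hence P is supported on the staircase and
vanishes. Equality of weights is allowed, so the lemma also applies on walls. -/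
theorem notMem_stair_of_mon_mem {w : Fin 2 → ℝ} {i : Fin 6} (hw : Dominated w (stair i))
    {m : Expo} (h : mon m ∈ initialIdeal w J) : (m 0, m 1) ∉ stair i := by
  intro hm
  obtain ⟨P, hP, h1, h2⟩ := exists_mem_of_mem_initialIdeal h (weightDeg w m)
  have h0 : P = 0 := by
    refine eq_zero_of_mem_J i hP fun e he => ?_
    by_contra hne
    have heq := le_antisymm (h1 e hne) (hw e m he hm)
    rw [h2 e heq, coeff_mon] at hne
    split_ifs at hne with hme
    · exact he (hme ▸ hm)
    · exact hne rfl
  have h3 := h2 m rfl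
  rw [h0, coeff_mon, if_pos rfl] at h3
  exact zero_ne_one h3

/-- The remainder N lives on the staircase, where no weight exceeds that of m. So the initial form
is the component of weight `weightDeg w m`, and it contains m. -/
theorem initialForm_mon_sub {w : Fin 2 → ℝ} {i : Fin 6} (hw : Dominated w (stair i)) {m : Expo}
    (hm : (m 0, m 1) ∉ stair i) {N : W} (hN : N ∈ supported (stair i)) (e : Expo) :
    (initialForm w (mon m - N)).coeff (.ofAdd e) =
      if weightDeg w e = weightDeg w m then (mon m - N).coeff (.ofAdd e) else 0 := by
  have hle : ∀ d : Expo, (mon m - N).coeff (.ofAdd d) ≠ 0 → weightDeg w d ≤ weightDeg w m := by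
    intro d hd
    by_cases hdS : (d 0, d 1) ∈ stair i
    · exact hw m d hm hdS
    · rw [SkewMonoidAlgebra.coeff_sub, Finsupp.sub_apply, hN d hdS, sub_zero, coeff_mon] at hd
      split_ifs at hd with h
      · rw [h]
      · exact absurd rfl hd
  have hm0 : (mon m - N).coeff (.ofAdd m) ≠ 0 := by
    rw [SkewMonoidAlgebra.coeff_sub, Finsupp.sub_apply, hN m hm, sub_zero, coeff_mon, if_pos rfl]
    exact one_ne_zero
  split_ifs with h
  · exact coeff_initialForm_of_le (by rwa [h])
  · by_contra hne
    obtain ⟨h3, h4⟩ := le_of_coeff_initialForm_ne_zero hne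
    exact h (le_antisymm (hle e h3) (h4 m hm0))

/-- Under strict domination the remainder is lighter than m, so the initial form of m - N is m
itself. -/
theorem mon_mem_initialIdeal {w : Fin 2 → ℝ} {i : Fin 6} (hw : StrictlyDominated w (stair i))
    {m : Expo} (hm : (m 0, m 1) ∉ stair i) : mon m ∈ initialIdeal w J := by
  obtain ⟨N, hN, hP⟩ := exists_sub_mem_J i (mon m)
  have h : initialForm w (mon m - N) = mon m := by
    refine SkewMonoidAlgebra.ext fun g => ?_
    have hg := initialForm_mon_sub (fun e s he hs => (hw e s he hs).le) hm hN g.toAdd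
    rw [ofAdd_toAdd] at hg
    rw [hg]
    have hcm := coeff_mon m g.toAdd
    rw [ofAdd_toAdd] at hcm
    split_ifs with h
    · have hgS : (g.toAdd 0, g.toAdd 1) ∉ stair i := fun hgS => (hw _ _ hm hgS).ne h
      have hNg := hN _ hgS
      rw [ofAdd_toAdd] at hNg
      rw [SkewMonoidAlgebra.coeff_sub, Finsupp.sub_apply, hNg, sub_zero]
    · rw [hcm, if_neg]
      rintro rfl
      exact h rfl
  rw [← h]
  exact Ideal.subset_span ⟨_, hP, rfl⟩

/-- The right-hand side does not depend on w; this makes the initial ideal constant on a chamber. An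
initial form cannot contain a staircase monomial, for then all terms of the element of `J` would lie
on the staircase. -/
theorem initialIdeal_eq_span {w : Fin 2 → ℝ} {i : Fin 6} (hw : StrictlyDominated w (stair i)) :
    initialIdeal w J = Ideal.span (mon '' {e : Expo | (e 0, e 1) ∉ stair i}) := by
  refine le_antisymm (Ideal.span_le.mpr ?_) (Ideal.span_le.mpr ?_)
  · rintro _ ⟨P, hP, rfl⟩
    have hS : ∀ g ∈ (initialForm w P).support, (g.toAdd 0, g.toAdd 1) ∉ stair i := by
      intro g hg hgS
      obtain ⟨h3, h4⟩ := le_of_coeff_initialForm_ne_zero (e := g.toAdd)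
        (SkewMonoidAlgebra.mem_support_iff.mp hg)
      refine h3 ?_
      have h0 : P = 0 := by
        refine eq_zero_of_mem_J i hP fun e he => ?_
        by_contra hne
        exact absurd (h4 e hne) (not_le.mpr (hw e _ he hgS))
      rw [h0]
      rfl
    rw [SetLike.mem_coe, ← sum_smul_mon (initialForm w P)]
    refine Submodule.sum_mem _ fun g hg => ?_
    rw [← coef_mul]
    exact Ideal.mul_mem_left _ _ (Ideal.subset_span ⟨_, hS g hg, rfl⟩)
  · rintro _ ⟨e, he, rfl⟩
    exact mon_mem_initialIdeal hw he

/-- A monomial of staircase j outside staircase i lies in the initial ideal for w but not in the one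
for v. -/
theorem initialIdeal_ne_of_strictlyDominated {w v : Fin 2 → ℝ} {i j : Fin 6} (hij : i ≠ j)
    (hw : StrictlyDominated w (stair i)) (hv : Dominated v (stair j)) :
    initialIdeal v J ≠ initialIdeal w J := by
  have hex : ∀ i j : Fin 6, i ≠ j → ∃ m ∈ stair j, m ∉ stair i := by decide
  obtain ⟨m, hm, hmi⟩ := hex i j hij
  intro h
  have h1 : mon (expo m.1 m.2) ∈ initialIdeal w J := mon_mem_initialIdeal hw (by simpa using hmi)
  rw [← h] at h1
  exact notMem_stair_of_mon_mem hv h1 (by simpa using hm)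

/-- This is the case of w on a wall. Choose e in staircase j but not in i. The initial form of e - N
is homogeneous for w. Were the initial ideals equal, its v-component through e would also lie in
them. Two independent weights isolate the single exponent e, so the monomial e itself would belong
to the initial ideal, which staircase j forbids. -/
theorem initialIdeal_ne_of_dominated {w v : Fin 2 → ℝ} {i j : Fin 6} (hij : i ≠ j)
    (hi : Dominated w (stair i)) (hj : Dominated w (stair j)) (hwv : w 0 * v 1 ≠ w 1 * v 0) :
    initialIdeal v J ≠ initialIdeal w J := by
  have hex : ∀ i j : Fin 6, i ≠ j → ∃ m ∈ stair j, m ∉ stair i := by decide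
  obtain ⟨m, hmj, hmi⟩ := hex i j hij
  have hm : (expo m.1 m.2 0, expo m.1 m.2 1) ∉ stair i := by simpa using hmi
  set e := expo m.1 m.2
  obtain ⟨N, hN, hP⟩ := exists_sub_mem_J i (mon e)
  have hX : initialForm w (mon e - N) ∈ initialIdeal w J := Ideal.subset_span ⟨_, hP, rfl⟩
  intro h
  obtain ⟨P, hPJ, h1, h2⟩ := exists_mem_of_mem_initialIdeal (h ▸ hX) (weightDeg v e)
  have h3 : initialForm v P = mon e := by
    refine initialForm_eq_mon h1 fun d hd => ?_
    rw [h2 d hd, initialForm_mon_sub hi hm hN]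
    split_ifs with hdw
    -- By Cramer's rule, equality of both the v-weight and the w-weight determines the exponent, as
    -- the two vectors are not proportional.
    · have hde : d = e := by
        rw [weightDeg_eq, weightDeg_eq] at hd hdw
        have hne : w 0 * v 1 - w 1 * v 0 ≠ 0 := sub_ne_zero.mpr hwv
        have h0 : (w 0 * v 1 - w 1 * v 0) * ((d 0 : ℝ) - e 0) = 0 := by
          linear_combination v 1 * hdw - w 1 * hd
        have h1 : (w 0 * v 1 - w 1 * v 0) * ((d 1 : ℝ) - e 1) = 0 := by
          linear_combination w 0 * hd - v 0 * hdw
        have h0' := sub_eq_zero.mp ((mul_eq_zero.mp h0).resolve_left hne)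
        have h1' := sub_eq_zero.mp ((mul_eq_zero.mp h1).resolve_left hne)
        rw [← expo_eq d, Nat.cast_injective h0', Nat.cast_injective h1', expo_eq]
      rw [hde, SkewMonoidAlgebra.coeff_sub, Finsupp.sub_apply, hN e hm, sub_zero]
    · rw [coeff_mon, if_neg]
      rintro rfl
      exact hdw rfl
  have h4 : mon e ∈ initialIdeal v J := h3 ▸ Ideal.subset_span ⟨_, hPJ, rfl⟩
  rw [h] at h4
  exact notMem_stair_of_mon_mem hj h4 (by simpa [e] using hmj)

/-! ### Plane geometry of the fan -/

/-- First coordinates of generators of the rays of the fan. -/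
def rayFst : Fin 7 → ℕ := ![4, 4, 4, 4, 2, 1, 0]

/-- Second coordinates of generators of the rays of the fan. -/
def raySnd : Fin 7 → ℕ := ![0, 1, 2, 4, 4, 4, 4]

/-- A generator of the `i`-th ray of the fan. -/
def rayGen (i : Fin 7) : Fin 2 → ℝ := ![rayFst i, raySnd i]

/-- The linear form vanishing on the `i`-th ray, positive counterclockwise of it. -/
def side (i : Fin 7) (x : Fin 2 → ℝ) : ℝ := rayFst i * x 1 - raySnd i * x 0

/-- The sector of the quadrant between the rays `i` and `j`. -/
def sector (i j : Fin 7) : Set (Fin 2 → ℝ) :=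
  {x | (∀ k, 0 ≤ x k) ∧ 0 ≤ side i x ∧ side j x ≤ 0}

theorem mem_sector {i j : Fin 7} {x : Fin 2 → ℝ} :
    x ∈ sector i j ↔ (∀ k, 0 ≤ x k) ∧ 0 ≤ side i x ∧ side j x ≤ 0 := Iff.rfl

/-- The generators are scaled so that along the quadrant their first coordinates never increase and
their second coordinates never decrease. The linear forms are then ordered on the quadrant, and
intersections of sectors reduce to maxima and minima of indices. -/
theorem side_anti {i j : Fin 7} (h : i ≤ j) {x : Fin 2 → ℝ} (hx : ∀ k, 0 ≤ x k) :
    side j x ≤ side i x := by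
  have h1 : ∀ i j : Fin 7, i ≤ j → rayFst j ≤ rayFst i ∧ raySnd i ≤ raySnd j := by decide
  obtain ⟨ha, hb⟩ := h1 i j h
  have ha' : (rayFst j : ℝ) ≤ rayFst i := by exact_mod_cast ha
  have hb' : (raySnd i : ℝ) ≤ raySnd j := by exact_mod_cast hb
  exact sub_le_sub (mul_le_mul_of_nonneg_right ha' (hx 1)) (mul_le_mul_of_nonneg_right hb' (hx 0))

theorem sector_inter (i j k l : Fin 7) :
    sector i j ∩ sector k l = sector (max i k) (min j l) := by
  ext x
  simp only [Set.mem_inter_iff, mem_sector]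
  constructor
  · rintro ⟨⟨hx, h1, h2⟩, -, h3, h4⟩
    refine ⟨hx, ?_, ?_⟩
    · rcases max_choice i k with h | h <;> rw [h] <;> assumption
    · rcases min_choice j l with h | h <;> rw [h] <;> assumption
  · rintro ⟨hx, h1, h2⟩
    exact ⟨⟨hx, h1.trans (side_anti (le_max_left _ _) hx), (side_anti (min_le_left _ _) hx).trans h2⟩,
      hx, h1.trans (side_anti (le_max_right _ _) hx), (side_anti (min_le_right _ _) hx).trans h2⟩

theorem zero_mem_sector (i j : Fin 7) : (0 : Fin 2 → ℝ) ∈ sector i j := by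
  simp [mem_sector, side]

theorem rayGen_nonneg (i : Fin 7) (k : Fin 2) : 0 ≤ rayGen i k := by
  fin_cases k <;> simp [rayGen]

theorem side_rayGen (i j : Fin 7) :
    side i (rayGen j) = ((rayFst i * raySnd j - raySnd i * rayFst j : ℤ) : ℝ) := by
  simp [side, rayGen]

theorem side_self (i : Fin 7) : side i (rayGen i) = 0 := by
  simp [side, rayGen, mul_comm]

theorem side_add (i : Fin 7) (x y : Fin 2 → ℝ) : side i (x + y) = side i x + side i y := by
  simp only [side, Pi.add_apply]
  ring

theorem side_smul (i : Fin 7) (t : ℝ) (x : Fin 2 → ℝ) : side i (t • x) = t * side i x := by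
  simp only [side, Pi.smul_apply, smul_eq_mul]
  ring

/-- The linear form `side` as a continuous linear map. -/
def sideL (i : Fin 7) : (Fin 2 → ℝ) →L[ℝ] ℝ :=
  (rayFst i : ℝ) • ContinuousLinearMap.proj 1 - (raySnd i : ℝ) • ContinuousLinearMap.proj 0

theorem sideL_apply (i : Fin 7) (x : Fin 2 → ℝ) : sideL i x = side i x := by
  simp [sideL, side]

theorem neg_sideL_apply (i : Fin 7) (x : Fin 2 → ℝ) : (-sideL i) x = -side i x := by
  rw [← sideL_apply]
  rfl

theorem side_pos_of_lt {i j : Fin 7} (h : i < j) : 0 < side i (rayGen j) := by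
  have h1 : ∀ i j : Fin 7, i < j → 0 < (rayFst i * raySnd j - raySnd i * rayFst j : ℤ) := by
    decide
  rw [side_rayGen]
  exact_mod_cast h1 i j h

theorem side_neg_of_lt {i j : Fin 7} (h : i < j) : side j (rayGen i) < 0 := by
  have h1 : side j (rayGen i) = -side i (rayGen j) := by
    simp only [side_rayGen]
    push_cast
    ring
  rw [h1]
  exact neg_neg_of_pos (side_pos_of_lt h)

/-- Coordinates with respect to the generators of two rays. -/
theorem smul_rayGen_add {i j : Fin 7} (x : Fin 2 → ℝ) :
    side i (rayGen j) • x = (-side j x) • rayGen i + side i x • rayGen j := by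
  ext k
  fin_cases k <;> simp [side, rayGen] <;> ring

theorem mem_sector_iff_of_lt {i j : Fin 7} (h : i < j) {x : Fin 2 → ℝ} :
    x ∈ sector i j ↔ ∃ s t : ℝ, 0 ≤ s ∧ 0 ≤ t ∧ x = s • rayGen i + t • rayGen j := by
  have hpos := side_pos_of_lt h
  constructor
  · rintro ⟨-, h1, h2⟩
    refine ⟨(side i (rayGen j))⁻¹ * (-side j x), (side i (rayGen j))⁻¹ * side i x,
      mul_nonneg (inv_nonneg.mpr hpos.le) (neg_nonneg.mpr h2),
      mul_nonneg (inv_nonneg.mpr hpos.le) h1, ?_⟩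
    rw [mul_smul, mul_smul, ← smul_add, ← smul_rayGen_add, smul_smul, inv_mul_cancel₀ hpos.ne',
      one_smul]
  · rintro ⟨s, t, hs, ht, rfl⟩
    refine ⟨fun k => ?_, ?_, ?_⟩
    · simp only [Pi.add_apply, Pi.smul_apply, smul_eq_mul]
      have := rayGen_nonneg i k
      have := rayGen_nonneg j k
      positivity
    · rw [side_add, side_smul, side_smul, side_self, mul_zero, zero_add]
      positivity
    · rw [side_add, side_smul, side_smul, side_self, mul_zero, add_zero]
      exact mul_nonpos_of_nonneg_of_nonpos hs (side_neg_of_lt h).le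

theorem rayGen_sum_pos (i : Fin 7) : 0 < (rayFst i : ℝ) + raySnd i := by
  have h : ∀ i : Fin 7, 0 < rayFst i + raySnd i := by decide
  exact_mod_cast h i

theorem mem_sector_self_iff {i : Fin 7} {x : Fin 2 → ℝ} :
    x ∈ sector i i ↔ ∃ t : ℝ, 0 ≤ t ∧ x = t • rayGen i := by
  have hpos := rayGen_sum_pos i
  constructor
  · rintro ⟨h0, h1, h2⟩
    have h3 := le_antisymm h2 h1
    rw [side] at h3
    refine ⟨(x 0 + x 1) / (rayFst i + raySnd i),
      div_nonneg (add_nonneg (h0 0) (h0 1)) hpos.le, ?_⟩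
    ext k
    fin_cases k
    · simp only [rayGen, Fin.zero_eta, Pi.smul_apply, Matrix.cons_val_zero, smul_eq_mul]
      field_simp
      linear_combination -h3
    · simp only [rayGen, Fin.mk_one, Pi.smul_apply, Matrix.cons_val_one, Matrix.cons_val_fin_one,
        smul_eq_mul]
      field_simp
      linear_combination h3
  · rintro ⟨t, ht, rfl⟩
    rw [mem_sector, side_smul, side_self, mul_zero]
    exact ⟨fun k => mul_nonneg ht (rayGen_nonneg i k), le_rfl, le_rfl⟩

/-- Crossed indices encode the origin. Thus chambers, rays and the origin have one common
parametrization that is closed under intersection. -/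
theorem sector_of_lt {i j : Fin 7} (h : j < i) : sector i j = {0} := by
  refine Set.Subset.antisymm ?_ (Set.singleton_subset_iff.mpr (zero_mem_sector i j))
  rintro x ⟨h0, h1, h2⟩
  have hi : x ∈ sector i i := ⟨h0, h1, (side_anti h.le h0).trans h2⟩
  obtain ⟨t, ht, rfl⟩ := mem_sector_self_iff.mp hi
  rw [side_smul] at h2
  have h3 := side_pos_of_lt h
  have h4 : t = 0 := le_antisymm (by
    by_contra hlt
    exact absurd h2 (not_le.mpr (mul_pos (not_le.mp hlt) h3))) ht
  rw [h4, zero_smul]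
  rfl

/-! ### Faces of the sectors -/

/-- A linear functional attaining its maximum on a cone has maximum 0: compare the maximizer with
its multiples by 0 and by 2. -/
theorem eq_of_isExposed_of_cone {A B : Set (Fin 2 → ℝ)}
    (hA : ∀ x ∈ A, ∀ t : ℝ, 0 ≤ t → t • x ∈ A) (hB : B.Nonempty) (h : IsExposed ℝ A B) :
    ∃ l : (Fin 2 → ℝ) →L[ℝ] ℝ, (∀ x ∈ A, l x ≤ 0) ∧ B = {x ∈ A | l x = 0} := by
  obtain ⟨l, rfl⟩ := h hB
  obtain ⟨x, hx, hmax⟩ := hB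
  have h0 : l x = 0 := by
    have h1 := hmax _ (hA x hx 2 (by norm_num))
    have h2 := hmax _ (hA x hx 0 le_rfl)
    rw [map_smul, smul_eq_mul] at h1 h2
    linarith
  refine ⟨l, fun y hy => h0 ▸ hmax y hy, ?_⟩
  ext y
  simp only [Set.mem_ofPred_eq]
  refine and_congr_right fun hy => ⟨fun h => ?_, fun h z hz => ?_⟩
  · exact le_antisymm (h0 ▸ hmax y hy) (h0 ▸ h x hx)
  · rw [h]
    exact h0 ▸ hmax z hz

theorem isExposed_of_nonpos {A : Set (Fin 2 → ℝ)} (h0 : (0 : Fin 2 → ℝ) ∈ A)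
    (l : (Fin 2 → ℝ) →L[ℝ] ℝ) (hl : ∀ x ∈ A, l x ≤ 0) : IsExposed ℝ A {x ∈ A | l x = 0} := by
  intro _
  refine ⟨l, ?_⟩
  ext y
  simp only [Set.mem_ofPred_eq]
  refine and_congr_right fun hy => ⟨fun h z hz => ?_, fun h => ?_⟩
  · rw [h]
    exact hl z hz
  · exact le_antisymm (hl y hy) (by simpa using h 0 h0)

theorem smul_mem_sector {i j : Fin 7} {x : Fin 2 → ℝ} (hx : x ∈ sector i j) {t : ℝ} (ht : 0 ≤ t) :
    t • x ∈ sector i j := by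
  obtain ⟨h0, h1, h2⟩ := hx
  refine ⟨fun k => mul_nonneg ht (h0 k), ?_, ?_⟩
  · rw [side_smul]; exact mul_nonneg ht h1
  · rw [side_smul]; exact mul_nonpos_of_nonneg_of_nonpos ht h2

theorem isExposed_sector {i j i' j' : Fin 7} (hij : (j : ℕ) ≤ i + 1) (hi : i ≤ i') (hj : j' ≤ j) :
    IsExposed ℝ (sector i j) (sector i' j') := by
  have h0 := zero_mem_sector i j
  by_cases hlt : j' < i'
  -- The functional -(x₀ + x₁) vanishes on the quadrant only at the origin, so it exposes the
  -- vertex.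
  · obtain ⟨l, hl⟩ : ∃ l : (Fin 2 → ℝ) →L[ℝ] ℝ, ∀ x, l x = -(x 0 + x 1) :=
      ⟨-((ContinuousLinearMap.proj 0 : (Fin 2 → ℝ) →L[ℝ] ℝ) + ContinuousLinearMap.proj 1),
        fun x => rfl⟩
    have h1 := isExposed_of_nonpos h0 l (fun x hx => by
      rw [hl]
      linarith [hx.1 0, hx.1 1])
    convert h1 using 1
    rw [sector_of_lt hlt]
    ext x
    rw [Set.mem_singleton_iff, Set.mem_ofPred_eq, hl]
    constructor
    · rintro rfl
      exact ⟨h0, by simp⟩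
    · rintro ⟨hx, h⟩
      have h2 := hx.1 0
      have h3 := hx.1 1
      ext k
      fin_cases k <;> simp <;> linarith
  · by_cases heq : i' = i
    · by_cases heq2 : j' = j
      · rw [heq, heq2]
      -- Since j ≤ i + 1, the only proper choice left with i' = i and j' not below i' is the ray i,
      -- cut out by its own linear form.
      · have h1 := isExposed_of_nonpos h0 (-sideL i) (fun x hx => by
          rw [neg_sideL_apply]
          exact neg_nonpos.mpr hx.2.1)
        have hj' : j' = i := by omega
        convert h1 using 1
        ext x
        simp only [Set.mem_ofPred_eq, neg_sideL_apply, neg_eq_zero,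
          mem_sector, heq, hj']
        constructor
        · rintro ⟨hx, h2, h3⟩
          exact ⟨⟨hx, h2, (side_anti (by omega) hx).trans h3⟩, le_antisymm h3 h2⟩
        · rintro ⟨⟨hx, h2, h3⟩, h4⟩
          exact ⟨hx, h2, h4.le⟩
    · have h1 := isExposed_of_nonpos h0 (sideL j) (fun x hx => by
        rw [sideL_apply]
        exact hx.2.2)
      have hi' : i' = j := by omega
      have hj' : j' = j := by omega
      convert h1 using 1
      ext x
      simp only [Set.mem_ofPred_eq, sideL_apply, mem_sector, hi', hj']
      constructor
      · rintro ⟨hx, h2, h3⟩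
        exact ⟨⟨hx, h2.trans (side_anti (by omega) hx), h3⟩, le_antisymm h3 h2⟩
      · rintro ⟨⟨hx, h2, h3⟩, h4⟩
        exact ⟨hx, h4.ge, h3⟩

/-- The sectors of the fan: the six chambers, their boundary rays and the origin. -/
def sectors : Set (Set (Fin 2 → ℝ)) := {C | ∃ i j : Fin 7, (j : ℕ) ≤ i + 1 ∧ C = sector i j}

theorem rayGen_mem_sector_left {i j : Fin 7} (h : i ≤ j) : rayGen i ∈ sector i j :=
  ⟨rayGen_nonneg i, (side_self i).ge,
    (side_anti h (rayGen_nonneg i)).trans (side_self i).le⟩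

theorem rayGen_mem_sector_right {i j : Fin 7} (h : i ≤ j) : rayGen j ∈ sector i j :=
  ⟨rayGen_nonneg j, (side_self j).ge.trans (side_anti h (rayGen_nonneg j)), (side_self j).le⟩

/-- The exposing functional is nonpositive on the generators, so a face consists of the combinations
of those generators on which it vanishes. The cases are which of them these are. -/
theorem face_mem_sectors {i j : Fin 7} (hij : (j : ℕ) ≤ i + 1) {B : Set (Fin 2 → ℝ)}
    (hB : B.Nonempty) (h : IsExposed ℝ (sector i j) B) : B ∈ sectors := by
  obtain ⟨l, hl, rfl⟩ := eq_of_isExposed_of_cone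
    (fun x hx t ht => smul_mem_sector hx ht) hB h
  have hzero : ∀ s α : ℝ, α ≠ 0 → s * α = 0 → s = 0 := fun s α hα h =>
    (mul_eq_zero.mp h).resolve_right hα
  have horigin : {x ∈ sector i j | l x = 0} ⊆ {0} → {x ∈ sector i j | l x = 0} ∈ sectors := by
    intro hsub
    -- Any crossed pair would represent the origin.
    exact ⟨6, 0, by simp, (hsub.antisymm (Set.singleton_subset_iff.mpr
      ⟨zero_mem_sector i j, map_zero l⟩)).trans (sector_of_lt (by decide)).symm⟩
  rcases lt_trichotomy i j with hlt | rfl | hgt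
  · have hi := hl _ (rayGen_mem_sector_left hlt.le)
    have hj := hl _ (rayGen_mem_sector_right hlt.le)
    by_cases hi0 : l (rayGen i) = 0
    · by_cases hj0 : l (rayGen j) = 0
      · refine ⟨i, j, hij, ?_⟩
        ext x
        refine ⟨fun hx => hx.1, fun hx => ⟨hx, ?_⟩⟩
        obtain ⟨s, t, -, -, rfl⟩ := (mem_sector_iff_of_lt hlt).mp hx
        simp [hi0, hj0]
      · refine ⟨i, i, by omega, ?_⟩
        ext x
        rw [mem_sector_self_iff]
        constructor
        · rintro ⟨hx, hx0⟩
          obtain ⟨s, t, hs, ht, rfl⟩ := (mem_sector_iff_of_lt hlt).mp hx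
          simp only [map_add, map_smul, hi0, smul_eq_mul, mul_zero, zero_add] at hx0
          exact ⟨s, hs, by rw [hzero t _ hj0 hx0, zero_smul, add_zero]⟩
        · rintro ⟨t, ht, rfl⟩
          exact ⟨smul_mem_sector (rayGen_mem_sector_left hlt.le) ht, by simp [hi0]⟩
    · by_cases hj0 : l (rayGen j) = 0
      · refine ⟨j, j, by omega, ?_⟩
        ext x
        rw [mem_sector_self_iff]
        constructor
        · rintro ⟨hx, hx0⟩
          obtain ⟨s, t, hs, ht, rfl⟩ := (mem_sector_iff_of_lt hlt).mp hx
          simp only [map_add, map_smul, hj0, smul_eq_mul, mul_zero, add_zero] at hx0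
          exact ⟨t, ht, by rw [hzero s _ hi0 hx0, zero_smul, zero_add]⟩
        · rintro ⟨t, ht, rfl⟩
          exact ⟨smul_mem_sector (rayGen_mem_sector_right hlt.le) ht, by simp [hj0]⟩
      · refine horigin ?_
        rintro x ⟨hx, hx0⟩
        obtain ⟨s, t, hs, ht, rfl⟩ := (mem_sector_iff_of_lt hlt).mp hx
        simp only [map_add, map_smul, smul_eq_mul] at hx0
        have h1 := mul_nonpos_of_nonneg_of_nonpos hs hi
        have h2 := mul_nonpos_of_nonneg_of_nonpos ht hj
        have hs0 := hzero s _ hi0 (by linarith)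
        have ht0 := hzero t _ hj0 (by linarith)
        simp [hs0, ht0]
  · by_cases hi0 : l (rayGen i) = 0
    · refine ⟨i, i, hij, ?_⟩
      ext x
      refine ⟨fun hx => hx.1, fun hx => ⟨hx, ?_⟩⟩
      obtain ⟨t, -, rfl⟩ := mem_sector_self_iff.mp hx
      simp [hi0]
    · refine horigin ?_
      rintro x ⟨hx, hx0⟩
      obtain ⟨t, ht, rfl⟩ := mem_sector_self_iff.mp hx
      rw [map_smul, smul_eq_mul] at hx0
      simp [hzero t _ hi0 hx0]
  · refine horigin ?_
    rw [sector_of_lt hgt]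
    exact fun x hx => hx.1

theorem polyhedral_of_mem_sectors {C : Set (Fin 2 → ℝ)} (hC : C ∈ sectors) :
    ∃ s : Finset (Fin 2 → ℝ), C = PointedCone.hull ℝ (s : Set (Fin 2 → ℝ)) := by
  classical
  obtain ⟨i, j, hij, rfl⟩ := hC
  rcases lt_trichotomy i j with hlt | rfl | hgt
  · refine ⟨{rayGen i, rayGen j}, ?_⟩
    ext x
    rw [mem_sector_iff_of_lt hlt, SetLike.mem_coe, Finset.coe_pair, PointedCone.hull,
      Submodule.mem_span_pair]
    constructor
    · rintro ⟨s, t, hs, ht, rfl⟩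
      exact ⟨⟨s, hs⟩, ⟨t, ht⟩, rfl⟩
    · rintro ⟨s, t, rfl⟩
      exact ⟨s, t, s.2, t.2, rfl⟩
  · refine ⟨{rayGen i}, ?_⟩
    ext x
    rw [mem_sector_self_iff, SetLike.mem_coe, Finset.coe_singleton, PointedCone.hull,
      Submodule.mem_span_singleton]
    constructor
    · rintro ⟨t, ht, rfl⟩
      exact ⟨⟨t, ht⟩, rfl⟩
    · rintro ⟨t, rfl⟩
      exact ⟨t, t.2, rfl⟩
  · refine ⟨∅, ?_⟩
    rw [sector_of_lt hgt, Finset.coe_empty, PointedCone.hull, Submodule.span_empty]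
    rfl

theorem isFan_sectors : IsFan sectors where
  finite := by
    refine (Set.finite_range fun p : Fin 7 × Fin 7 => sector p.1 p.2).subset ?_
    rintro C ⟨i, j, -, rfl⟩
    exact ⟨(i, j), rfl⟩
  polyhedral C := polyhedral_of_mem_sectors
  salient := by
    rintro C ⟨i, j, -, rfl⟩ x hx hx'
    ext k
    have h1 := hx.1 k
    have h2 := hx'.1 k
    rw [Pi.neg_apply] at h2
    rw [Pi.zero_apply]
    linarith
  face_mem := by
    rintro C ⟨i, j, hij, rfl⟩ D hD h
    exact face_mem_sectors hij hD h
  inter := by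
    rintro C ⟨i, j, hij, rfl⟩ D ⟨k, l, hkl, rfl⟩
    rw [sector_inter]
    exact ⟨⟨0, zero_mem_sector _ _⟩,
      isExposed_sector hij (le_max_left _ _) (min_le_left _ _),
      isExposed_sector hkl (le_max_right _ _) (min_le_right _ _)⟩

/-- The forms `side` start nonnegative at the first axis and end nonpositive at the second, so they
change sign across some chamber; otherwise positivity would propagate to the last ray. -/
theorem exists_sector {x : Fin 2 → ℝ} (hx : ∀ k, 0 ≤ x k) :
    ∃ i : Fin 6, x ∈ sector i.castSucc i.succ := by
  by_contra! h
  have hstep : ∀ i : Fin 6, 0 ≤ side i.castSucc x → 0 < side i.succ x := by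
    intro i hi
    by_contra hn
    exact h i ⟨hx, hi, not_lt.mp hn⟩
  have hall : ∀ i : Fin 7, 0 ≤ side i x := by
    intro i
    induction i using Fin.induction with
    | zero => simpa [side, rayFst, raySnd] using hx 1
    | succ i ih => exact (hstep i ih).le
  have h6 := hstep 5 (hall _)
  have h0 := hx 0
  simp [side, rayFst, raySnd] at h6
  linarith

theorem sUnion_sectors : ⋃₀ sectors = {w : Fin 2 → ℝ | ∀ i, 0 ≤ w i} := by
  ext x
  constructor
  · rintro ⟨C, ⟨i, j, -, rfl⟩, hx⟩
    exact hx.1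
  · intro hx
    obtain ⟨i, hi⟩ := exists_sector hx
    exact ⟨_, ⟨_, _, by simp, rfl⟩, hi⟩

/-! ### Rays of the fan -/

theorem finrank_span_sector_self (i : Fin 7) :
    Module.finrank ℝ (Submodule.span ℝ (sector i i)) = 1 := by
  have h : Submodule.span ℝ (sector i i) = Submodule.span ℝ {rayGen i} := by
    apply le_antisymm
    · refine Submodule.span_le.mpr fun x hx => ?_
      obtain ⟨t, -, rfl⟩ := mem_sector_self_iff.mp hx
      exact Submodule.smul_mem _ _ (Submodule.mem_span_singleton_self _)
    · exact Submodule.span_mono (Set.singleton_subset_iff.mpr (rayGen_mem_sector_left le_rfl))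
  rw [h]
  refine finrank_span_singleton fun h0 => ?_
  have h1 := rayGen_sum_pos i
  have h2 := congrFun h0 0
  have h3 := congrFun h0 1
  simp only [rayGen, Matrix.cons_val_zero, Matrix.cons_val_one, Pi.zero_apply] at h2 h3
  linarith

/-- On a line through both generators the form `side i`, which kills the first, would also kill the
second, where it is positive. -/
theorem finrank_span_sector_of_lt {i j : Fin 7} (h : i < j) :
    Module.finrank ℝ (Submodule.span ℝ (sector i j)) ≠ 1 := by
  intro h1
  obtain ⟨v, -, hv⟩ := finrank_eq_one_iff'.mp h1
  obtain ⟨a, ha⟩ := hv ⟨_, Submodule.subset_span (rayGen_mem_sector_left h.le)⟩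
  obtain ⟨b, hb⟩ := hv ⟨_, Submodule.subset_span (rayGen_mem_sector_right h.le)⟩
  have ha' : a • (v : Fin 2 → ℝ) = rayGen i := congrArg Subtype.val ha
  have hb' : b • (v : Fin 2 → ℝ) = rayGen j := congrArg Subtype.val hb
  have hpos := side_pos_of_lt h
  have hself := side_self i
  rw [← ha', side_smul] at hself
  rcases mul_eq_zero.mp hself with h0 | h0
  · rw [h0, zero_smul] at ha'
    have hneg := side_neg_of_lt h
    rw [← ha'] at hneg
    simp [side] at hneg
  · rw [← hb', side_smul, h0, mul_zero] at hpos
    exact lt_irrefl _ hpos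

/-- The factor c converts the primitive generator of the statement into the scaled one required by
`side_anti`. -/
theorem ray_eq_sector {i : Fin 7} {a b c : ℕ} (hc : 0 < c) (ha : rayFst i = c * a)
    (hb : raySnd i = c * b) : ray ![(a : ℝ), (b : ℝ)] = sector i i := by
  have hc' : (0 : ℝ) < c := by exact_mod_cast hc
  have h : rayGen i = (c : ℝ) • ![(a : ℝ), (b : ℝ)] := by
    ext k
    fin_cases k <;> simp [rayGen, ha, hb]
  ext x
  rw [mem_sector_self_iff, h]
  constructor
  · rintro ⟨t, ht, rfl⟩
    exact ⟨t / c, div_nonneg ht hc'.le, by rw [smul_smul, div_mul_cancel₀ _ hc'.ne']⟩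
  · rintro ⟨t, ht, rfl⟩
    exact ⟨t * c, mul_nonneg ht hc'.le, by rw [smul_smul]⟩

theorem fanRays_sectors : {C ∈ fanRays sectors | ∃ w ∈ C, ∀ i, 0 < w i} =
    {ray ![4, 1], ray ![2, 1], ray ![1, 1], ray ![1, 2], ray ![1, 4]} := by
  have h1 : ray ![4, 1] = sector 1 1 := by
    simpa using ray_eq_sector (i := 1) (a := 4) (b := 1) one_pos rfl rfl
  have h2 : ray ![2, 1] = sector 2 2 := by
    simpa using ray_eq_sector (i := 2) (a := 2) (b := 1) two_pos rfl rfl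
  have h3 : ray ![1, 1] = sector 3 3 := by
    simpa using ray_eq_sector (i := 3) (a := 1) (b := 1) four_pos rfl rfl
  have h4 : ray ![1, 2] = sector 4 4 := by
    simpa using ray_eq_sector (i := 4) (a := 1) (b := 2) two_pos rfl rfl
  have h5 : ray ![1, 4] = sector 5 5 := by
    simpa using ray_eq_sector (i := 5) (a := 1) (b := 4) one_pos rfl rfl
  rw [h1, h2, h3, h4, h5]
  have hpos : ∀ i : Fin 7, i ≠ 0 → i ≠ 6 → ∀ k, 0 < rayGen i k := by
    intro i hi0 hi6 k
    have h : ∀ i : Fin 7, i ≠ 0 → i ≠ 6 → 0 < rayFst i ∧ 0 < raySnd i := by decide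
    obtain ⟨ha, hb⟩ := h i hi0 hi6
    fin_cases k
    · simpa [rayGen] using ha
    · simpa [rayGen] using hb
  have hmem : ∀ i : Fin 7, i ≠ 0 → i ≠ 6 →
      sector i i ∈ {C ∈ fanRays sectors | ∃ w ∈ C, ∀ i, 0 < w i} := fun i hi0 hi6 =>
    ⟨⟨⟨i, i, by omega, rfl⟩, finrank_span_sector_self i⟩, rayGen i,
      rayGen_mem_sector_left le_rfl, hpos i hi0 hi6⟩
  ext C
  constructor
  · rintro ⟨⟨⟨i, j, hij, rfl⟩, hrank⟩, w, hw, hwpos⟩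
    rcases lt_trichotomy i j with hlt | rfl | hgt
    · exact absurd hrank (finrank_span_sector_of_lt hlt)
    · obtain ⟨t, ht, rfl⟩ := mem_sector_self_iff.mp hw
      have hi : i ≠ 0 ∧ i ≠ 6 := by
        constructor
        · rintro rfl
          simpa [rayGen, raySnd] using hwpos 1
        · rintro rfl
          simpa [rayGen, rayFst] using hwpos 0
      have hcases : ∀ i : Fin 7, i ≠ 0 ∧ i ≠ 6 → i = 1 ∨ i = 2 ∨ i = 3 ∨ i = 4 ∨ i = 5 := by
        decide
      rcases hcases i hi with rfl | rfl | rfl | rfl | rfl <;> simp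
    · rw [sector_of_lt hgt] at hw
      have h0 := hwpos 0
      rw [Set.mem_singleton_iff.mp hw] at h0
      exact absurd h0 (lt_irrefl _)
  · rintro (rfl | rfl | rfl | rfl | rfl)
    · exact hmem 1 (by decide) (by decide)
    · exact hmem 2 (by decide) (by decide)
    · exact hmem 3 (by decide) (by decide)
    · exact hmem 4 (by decide) (by decide)
    · exact hmem 5 (by decide) (by decide)

/-! ### The Gröbner cones of `J` -/

/-- The open chamber between the rays `i` and `i + 1`. -/
def openChamber (i : Fin 6) : Set (Fin 2 → ℝ) :=
  {x | (∀ k, 0 < x k) ∧ 0 < side i.castSucc x ∧ side i.succ x < 0}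

/-- The points of the open quadrant on the `i`-th ray. -/
def openRay (i : Fin 7) : Set (Fin 2 → ℝ) := {x | (∀ k, 0 < x k) ∧ side i x = 0}

/-- The exponents of the minimal monomials outside the staircases. -/
def corners : Fin 6 → Finset (ℕ × ℕ) :=
  ![{(1, 0), (0, 5)}, {(2, 0), (1, 1), (0, 4)}, {(2, 0), (1, 2), (0, 3)},
    {(0, 2), (2, 1), (3, 0)}, {(0, 2), (1, 1), (4, 0)}, {(0, 1), (5, 0)}]

theorem exists_corner_le {i : Fin 6} {a b : ℕ} (h : (a, b) ∉ stair i) :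
    ∃ m ∈ corners i, m.1 ≤ a ∧ m.2 ≤ b := by
  fin_cases i <;>
  · simp only [stair, corners, Fin.zero_eta, Fin.mk_one, Fin.reduceFinMk, Fin.isValue,
      Matrix.cons_val, Finset.mem_insert, Finset.mem_singleton, Prod.mk.injEq, exists_eq_or_imp,
      exists_eq_left] at h ⊢
    omega

/-- The finite computation locating the walls: on each bounding ray the staircase monomials weigh at
most as much as the corners, and strictly less on the sum of the two generators. By linearity and
divisibility it governs all weights in the chamber and all monomials. -/
theorem corners_check : ∀ i : Fin 6, ∀ m ∈ corners i, ∀ s ∈ stair i,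
    rayFst i.castSucc * s.1 + raySnd i.castSucc * s.2 ≤
      rayFst i.castSucc * m.1 + raySnd i.castSucc * m.2 ∧
    rayFst i.succ * s.1 + raySnd i.succ * s.2 ≤ rayFst i.succ * m.1 + raySnd i.succ * m.2 ∧
    rayFst i.castSucc * s.1 + raySnd i.castSucc * s.2 +
      (rayFst i.succ * s.1 + raySnd i.succ * s.2) <
      rayFst i.castSucc * m.1 + raySnd i.castSucc * m.2 +
        (rayFst i.succ * m.1 + raySnd i.succ * m.2) := by
  decide

/-- The weights of exponents with respect to the generators of the two rays of a chamber. -/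
theorem weightDeg_rayGen_le {i : Fin 6} {e s : Expo} (he : (e 0, e 1) ∉ stair i)
    (hs : (s 0, s 1) ∈ stair i) :
    weightDeg (rayGen i.castSucc) s ≤ weightDeg (rayGen i.castSucc) e ∧
    weightDeg (rayGen i.succ) s ≤ weightDeg (rayGen i.succ) e ∧
    weightDeg (rayGen i.castSucc) s + weightDeg (rayGen i.succ) s <
      weightDeg (rayGen i.castSucc) e + weightDeg (rayGen i.succ) e := by
  obtain ⟨m, hm, h0, h1⟩ := exists_corner_le he
  obtain ⟨h2, h3, h4⟩ := corners_check i m hm _ hs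
  have hmono : ∀ j : Fin 7, rayFst j * m.1 + raySnd j * m.2 ≤ rayFst j * e 0 + raySnd j * e 1 :=
    fun j => add_le_add (Nat.mul_le_mul_left _ h0) (Nat.mul_le_mul_left _ h1)
  have hcast : ∀ (j : Fin 7) (d : Expo), weightDeg (rayGen j) d =
      ((rayFst j * d 0 + raySnd j * d 1 : ℕ) : ℝ) := by
    intro j d
    rw [weightDeg_eq]
    simp [rayGen]
  rw [hcast, hcast, hcast, hcast]
  exact ⟨by exact_mod_cast h2.trans (hmono _), by exact_mod_cast h3.trans (hmono _),
    by exact_mod_cast h4.trans_le (add_le_add (hmono _) (hmono _))⟩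

theorem weightDeg_smul_add (s t : ℝ) (u v : Fin 2 → ℝ) (e : Expo) :
    weightDeg (s • u + t • v) e = s * weightDeg u e + t * weightDeg v e := by
  simp only [weightDeg_eq, Pi.add_apply, Pi.smul_apply, smul_eq_mul]
  ring

theorem dominated_of_mem_sector {i : Fin 6} {w : Fin 2 → ℝ} (hw : w ∈ sector i.castSucc i.succ) :
    Dominated w (stair i) := by
  obtain ⟨s, t, hs, ht, rfl⟩ := (mem_sector_iff_of_lt i.castSucc_lt_succ).mp hw
  intro e d he hd
  obtain ⟨h1, h2, -⟩ := weightDeg_rayGen_le he hd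
  rw [weightDeg_smul_add, weightDeg_smul_add]
  exact add_le_add (mul_le_mul_of_nonneg_left h1 hs) (mul_le_mul_of_nonneg_left h2 ht)

theorem openChamber_subset_sector (i : Fin 6) : openChamber i ⊆ sector i.castSucc i.succ :=
  fun _ hx => ⟨fun k => (hx.1 k).le, hx.2.1.le, hx.2.2.le⟩

theorem strictlyDominated_of_mem_openChamber {i : Fin 6} {w : Fin 2 → ℝ} (hw : w ∈ openChamber i) :
    StrictlyDominated w (stair i) := by
  have hlt : i.castSucc < i.succ := i.castSucc_lt_succ
  obtain ⟨s, t, hs, ht, rfl⟩ :=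
    (mem_sector_iff_of_lt hlt).mp (openChamber_subset_sector i hw)
  have hs0 : 0 < s := by
    refine lt_of_le_of_ne hs fun h0 => ?_
    have h1 := hw.2.2
    rw [← h0, zero_smul, zero_add, side_smul, side_self, mul_zero] at h1
    exact lt_irrefl _ h1
  have ht0 : 0 < t := by
    refine lt_of_le_of_ne ht fun h0 => ?_
    have h1 := hw.2.1
    rw [← h0, zero_smul, add_zero, side_smul, side_self, mul_zero] at h1
    exact lt_irrefl _ h1
  intro e d he hd
  obtain ⟨h1, h2, h3⟩ := weightDeg_rayGen_le he hd
  rw [weightDeg_smul_add, weightDeg_smul_add]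
  -- If the comparison is an equality on one ray it is strict on the other, and both coefficients s
  -- and t are positive in the open chamber.
  rcases h1.lt_or_eq with h1' | h1'
  · exact add_lt_add_of_lt_of_le (mul_lt_mul_of_pos_left h1' hs0) (mul_le_mul_of_nonneg_left h2 ht)
  · rw [h1'] at h3 ⊢
    exact add_lt_add_of_le_of_lt le_rfl (mul_lt_mul_of_pos_left (by linarith) ht0)

/-- Every positive weight vector lies in an open chamber or on an interior ray. -/
theorem mem_openChamber_or_openRay {w : Fin 2 → ℝ} (hw : ∀ k, 0 < w k) :
    (∃ i, w ∈ openChamber i) ∨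
      ∃ i j : Fin 6, i.succ = j.castSucc ∧ w ∈ openRay i.succ := by
  obtain ⟨i, -, h1, h2⟩ := exists_sector fun k => (hw k).le
  rcases h1.lt_or_eq with h1 | h1
  · rcases h2.lt_or_eq with h2 | h2
    · exact Or.inl ⟨i, hw, h1, h2⟩
    · refine Or.inr ⟨i, ?_⟩
      -- The last ray is a coordinate half-axis and contains no positive vector; below, the same
      -- holds for the first ray. Hence only interior rays occur.
      have hi : i ≠ 5 := by
        rintro rfl
        have := hw 0
        simp [side, rayFst, raySnd] at h2
        linarith
      exact ⟨⟨i + 1, by omega⟩, rfl, hw, h2⟩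
  · have hi : i ≠ 0 := by
      rintro rfl
      have := hw 1
      simp [side, rayFst, raySnd] at h1
      linarith
    refine Or.inr ⟨⟨i - 1, by omega⟩, i, ?_, hw, ?_⟩
    · ext
      simp
      omega
    · rw [h1]
      congr 1
      ext
      simp
      omega

theorem openRay_subset_sector {i j : Fin 6} (hij : i.succ = j.castSucc) :
    openRay i.succ ⊆ sector i.castSucc i.succ ∧ openRay i.succ ⊆ sector j.castSucc j.succ := by
  constructor
  · rintro x ⟨h1, h2⟩
    have h0 : ∀ k, 0 ≤ x k := fun k => (h1 k).le
    exact ⟨h0, h2.ge.trans (side_anti i.castSucc_lt_succ.le h0), h2.le⟩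
  · rintro x ⟨h1, h2⟩
    have h0 : ∀ k, 0 ≤ x k := fun k => (h1 k).le
    rw [hij] at h2
    exact ⟨h0, h2.ge, (side_anti j.castSucc_lt_succ.le h0).trans h2.le⟩

/-- A positive weight vector outside an open chamber lies in another closed chamber. -/
theorem exists_ne_mem_sector {v : Fin 2 → ℝ} (hv : ∀ k, 0 < v k) {i : Fin 6}
    (h : v ∉ openChamber i) : ∃ j, i ≠ j ∧ v ∈ sector j.castSucc j.succ := by
  rcases mem_openChamber_or_openRay hv with ⟨j, hj⟩ | ⟨j, k, hjk, hr⟩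
  · exact ⟨j, fun hij => h (hij ▸ hj), openChamber_subset_sector j hj⟩
  · obtain ⟨h1, h2⟩ := openRay_subset_sector hjk
    by_cases hij : i = j
    · refine ⟨k, fun hik => ?_, h2 hr⟩
      have := congrArg Fin.val hjk
      rw [← hij, ← hik] at this
      simp at this
    · exact ⟨j, hij, h1 hr⟩

/-! ### Classes of weight vectors with equal initial ideals -/

/-- A positive weight outside the open chamber lies in a closed chamber of another staircase, and
weak domination there already separates the initial ideals. -/
theorem class_eq_openChamber {w : Fin 2 → ℝ} {i : Fin 6} (hw : w ∈ openChamber i) :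
    {v : Fin 2 → ℝ | (∀ k, 0 < v k) ∧ initialIdeal v J = initialIdeal w J} = openChamber i := by
  ext v
  constructor
  · rintro ⟨hv, h⟩
    by_contra hn
    obtain ⟨j, hij, hj⟩ := exists_ne_mem_sector hv hn
    exact initialIdeal_ne_of_strictlyDominated hij (strictlyDominated_of_mem_openChamber hw)
      (dominated_of_mem_sector hj) h
  · intro hv
    exact ⟨hv.1, (initialIdeal_eq_span (strictlyDominated_of_mem_openChamber hv)).trans
      (initialIdeal_eq_span (strictlyDominated_of_mem_openChamber hw)).symm⟩

theorem side_eq_zero_iff {w v : Fin 2 → ℝ} {i : Fin 7} (hw : ∀ k, 0 < w k) (h : side i w = 0) :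
    side i v = 0 ↔ w 0 * v 1 = w 1 * v 0 := by
  have hpos := rayGen_sum_pos i
  have hw0 := hw 0
  have hw1 := hw 1
  have ha : (rayFst i : ℝ) * (w 0 + w 1) = (rayFst i + raySnd i) * w 0 := by
    rw [side] at h
    linear_combination h
  have hb : (raySnd i : ℝ) * (w 0 + w 1) = (rayFst i + raySnd i) * w 1 := by
    rw [side] at h
    linear_combination -h
  have hsum : w 0 + w 1 ≠ 0 := by positivity
  have key : (w 0 + w 1) * side i v = (rayFst i + raySnd i) * (w 0 * v 1 - w 1 * v 0) := by
    rw [side]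
    linear_combination v 1 * ha - v 0 * hb
  constructor
  · intro h0
    rw [h0, mul_zero] at key
    exact sub_eq_zero.mp ((mul_eq_zero.mp key.symm).resolve_left hpos.ne')
  · intro h0
    rw [h0, sub_self, mul_zero] at key
    exact (mul_eq_zero.mp key).resolve_left hsum

/-- The wall belongs to the closed chambers of two staircases, which excludes all weights not
proportional to w; proportional ones agree by scaling. -/
theorem class_eq_openRay {w : Fin 2 → ℝ} {i j : Fin 6} (hij : i.succ = j.castSucc)
    (hw : w ∈ openRay i.succ) :
    {v : Fin 2 → ℝ | (∀ k, 0 < v k) ∧ initialIdeal v J = initialIdeal w J} = openRay i.succ := by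
  obtain ⟨h1, h2⟩ := openRay_subset_sector hij
  have hne : i ≠ j := by
    rintro rfl
    have := congrArg Fin.val hij
    simp at this
  ext v
  constructor
  · rintro ⟨hv, h⟩
    refine ⟨hv, (side_eq_zero_iff hw.1 hw.2).mpr ?_⟩
    by_contra hn
    exact initialIdeal_ne_of_dominated hne (dominated_of_mem_sector (h1 hw))
      (dominated_of_mem_sector (h2 hw)) hn h
  · rintro ⟨hv, h⟩
    have hpar := (side_eq_zero_iff hw.1 hw.2).mp h
    have hw0 := hw.1 0
    refine ⟨hv, ?_⟩
    have hvw : v = (v 0 / w 0) • w := by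
      ext k
      fin_cases k
      · simp [hw0.ne']
      · simp only [Fin.mk_one, Pi.smul_apply, smul_eq_mul]
        field_simp
        linear_combination hpar
    rw [hvw]
    exact initialIdeal_smul (div_pos (hv 0) hw0) w J

theorem mem_closure_of_forall_add_smul {U : Set (Fin 2 → ℝ)} {x p : Fin 2 → ℝ}
    (h : ∀ t : ℝ, 0 < t → x + t • p ∈ U) : x ∈ closure U := by
  have hc : ContinuousWithinAt (fun t : ℝ => x + t • p) (Set.Ioi 0) 0 :=
    (by fun_prop : Continuous fun t : ℝ => x + t • p).continuousWithinAt
  have h0 : (0 : ℝ) ∈ closure (Set.Ioi (0 : ℝ)) := by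
    rw [closure_Ioi]
    exact Set.self_mem_Ici
  have h1 := hc.mem_closure_image h0
  rw [zero_smul, add_zero] at h1
  refine closure_mono ?_ h1
  rintro _ ⟨t, ht, rfl⟩
  exact h t ht

theorem isClosed_sector (i j : Fin 7) : IsClosed (sector i j) := by
  have hside : ∀ k : Fin 7, Continuous (side k) := fun k => by
    unfold side
    fun_prop
  have h : sector i j = (⋂ k, {x : Fin 2 → ℝ | 0 ≤ x k}) ∩
      ({x | 0 ≤ side i x} ∩ {x | side j x ≤ 0}) := by
    ext x
    simp [mem_sector]
  rw [h]
  exact (isClosed_iInter fun k => isClosed_le continuous_const (continuous_apply k)).inter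
    ((isClosed_le continuous_const (hside i)).inter (isClosed_le (hside j) continuous_const))

theorem rayGen_add_pos {i : Fin 6} (k : Fin 2) : 0 < (rayGen i.castSucc + rayGen i.succ) k := by
  have h : ∀ i : Fin 6, 0 < rayFst i.castSucc + rayFst i.succ ∧
      0 < raySnd i.castSucc + raySnd i.succ := by decide
  obtain ⟨h0, h1⟩ := h i
  fin_cases k
  · simpa [rayGen] using (by exact_mod_cast h0 : (0 : ℝ) < rayFst i.castSucc + rayFst i.succ)
  · simpa [rayGen] using (by exact_mod_cast h1 : (0 : ℝ) < raySnd i.castSucc + raySnd i.succ)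

theorem rayGen_add_mem_openChamber (i : Fin 6) :
    rayGen i.castSucc + rayGen i.succ ∈ openChamber i := by
  refine ⟨rayGen_add_pos, ?_, ?_⟩
  · rw [side_add, side_self, zero_add]
    exact side_pos_of_lt i.castSucc_lt_succ
  · rw [side_add, side_self, add_zero]
    exact side_neg_of_lt i.castSucc_lt_succ

/-- Any point of the closed sector enters the open chamber when pushed in the direction of the sum
of the two generators. -/
theorem closure_openChamber (i : Fin 6) : closure (openChamber i) = sector i.castSucc i.succ := by
  refine Set.Subset.antisymm
    (closure_minimal (openChamber_subset_sector i) (isClosed_sector _ _)) fun x hx => ?_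
  obtain ⟨h1, h2, h3⟩ := rayGen_add_mem_openChamber i
  refine mem_closure_of_forall_add_smul (p := rayGen i.castSucc + rayGen i.succ)
    fun t ht => ⟨fun k => ?_, ?_, ?_⟩
  · exact add_pos_of_nonneg_of_pos (hx.1 k) (mul_pos ht (h1 k))
  · rw [side_add, side_smul]
    exact add_pos_of_nonneg_of_pos hx.2.1 (mul_pos ht h2)
  · rw [side_add, side_smul]
    exact add_neg_of_nonpos_of_neg hx.2.2 (mul_neg_of_pos_of_neg ht h3)

/-- A point w must be given: for the two coordinate half-axes `openRay` is empty, and the equality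
would fail. -/
theorem closure_openRay {i : Fin 7} {w : Fin 2 → ℝ} (hw : w ∈ openRay i) :
    closure (openRay i) = sector i i := by
  refine Set.Subset.antisymm (closure_minimal
    (fun x hx => ⟨fun k => (hx.1 k).le, hx.2.ge, hx.2.le⟩) (isClosed_sector _ _)) fun x hx => ?_
  refine mem_closure_of_forall_add_smul (p := w) fun t ht => ⟨fun k => ?_, ?_⟩
  · exact add_pos_of_nonneg_of_pos (hx.1 k) (mul_pos ht (hw.1 k))
  · rw [side_add, side_smul, hw.2, mul_zero, add_zero]
    exact le_antisymm hx.2.2 hx.2.1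

theorem groebnerCone_of_mem_openChamber {w : Fin 2 → ℝ} {i : Fin 6} (hw : w ∈ openChamber i) :
    groebnerCone J w = sector i.castSucc i.succ := by
  rw [groebnerCone, class_eq_openChamber hw, closure_openChamber]

theorem groebnerCone_of_mem_openRay {w : Fin 2 → ℝ} {i j : Fin 6} (hij : i.succ = j.castSucc)
    (hw : w ∈ openRay i.succ) : groebnerCone J w = sector i.succ i.succ := by
  rw [groebnerCone, class_eq_openRay hij hw, closure_openRay hw]

/-- The chambers alone already produce every cone, since each sector is a face of a closed chamber;
the cones of the wall weights add nothing new. -/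
theorem groebnerFan_J : groebnerFan J = sectors := by
  ext C
  constructor
  · rintro ⟨hC, w, hw, h⟩
    rcases mem_openChamber_or_openRay hw with ⟨i, hi⟩ | ⟨i, j, hij, hr⟩
    · rw [groebnerCone_of_mem_openChamber hi] at h
      exact face_mem_sectors (by simp) hC h
    · rw [groebnerCone_of_mem_openRay hij hr] at h
      exact face_mem_sectors (by simp) hC h
  · rintro ⟨i, j, hij, rfl⟩
    refine ⟨⟨0, zero_mem_sector i j⟩, ?_⟩
    have hex : ∃ k : Fin 6, k.castSucc ≤ i ∧ j ≤ k.succ := by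
      have h : ∀ i j : Fin 7, (j : ℕ) ≤ i + 1 → ∃ k : Fin 6, k.castSucc ≤ i ∧ j ≤ k.succ := by
        decide
      exact h i j hij
    obtain ⟨k, hk1, hk2⟩ := hex
    refine ⟨rayGen k.castSucc + rayGen k.succ, rayGen_add_pos, ?_⟩
    rw [groebnerCone_of_mem_openChamber (rayGen_add_mem_openChamber k)]
    exact isExposed_sector (by simp) hk1 hk2

end QWeyl

end

theorem theorem1p3 :
    -- (a)
    (QWeyl.IsGroebnerBasis MonomialOrder.degLex {QWeyl.P₁, QWeyl.P₂, QWeyl.P₃} QWeyl.J ∧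
      Module.Finite QWeyl.K (QWeyl.W ⧸ QWeyl.J) ∧
      Module.finrank QWeyl.K (QWeyl.W ⧸ QWeyl.J) = 5) ∧
    -- (b)
    (QWeyl.J = Ideal.span {QWeyl.Q₁, QWeyl.Q₂} ∧
      QWeyl.IsGroebnerBasis MonomialOrder.lex {QWeyl.Q₁, QWeyl.Q₂} QWeyl.J ∧
      QWeyl.belowStaircase MonomialOrder.degLex QWeyl.J =
        {QWeyl.expo 0 0, QWeyl.expo 0 1, QWeyl.expo 1 0, QWeyl.expo 0 2, QWeyl.expo 1 1} ∧
      QWeyl.belowStaircase MonomialOrder.lex QWeyl.J =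
        {QWeyl.expo 0 0, QWeyl.expo 0 1, QWeyl.expo 0 2, QWeyl.expo 0 3, QWeyl.expo 0 4}) ∧
    -- (c)
    (QWeyl.IsFan (QWeyl.groebnerFan QWeyl.J) ∧
      ⋃₀ QWeyl.groebnerFan QWeyl.J = {w : Fin 2 → ℝ | ∀ i, 0 ≤ w i} ∧
      {C ∈ QWeyl.fanRays (QWeyl.groebnerFan QWeyl.J) | ∃ w ∈ C, ∀ i, 0 < w i} =
        {QWeyl.ray ![4, 1], QWeyl.ray ![2, 1], QWeyl.ray ![1, 1], QWeyl.ray ![1, 2],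
          QWeyl.ray ![1, 4]}) ∧
    -- (d)
    (QWeyl.tau '' (QWeyl.J : Set QWeyl.W) = (QWeyl.J : Set QWeyl.W) ∧
      QWeyl.tau QWeyl.P₁ = -QWeyl.P₁) := by
  refine ⟨⟨QWeyl.isGroebnerBasis_degLex, QWeyl.finite_quot, QWeyl.finrank_quot⟩,
    ⟨QWeyl.J_eq_span_Q, QWeyl.isGroebnerBasis_lex, QWeyl.belowStaircase_degLex,
      QWeyl.belowStaircase_lex⟩, ?_, QWeyl.tau_image_J, QWeyl.tau_P₁⟩
  rw [QWeyl.groebnerFan_J]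
  exact ⟨QWeyl.isFan_sectors, QWeyl.sUnion_sectors, QWeyl.fanRays_sectors⟩
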